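/- Let $T>0$ and $d\in\mathbb N$. Let $\rho:\mathbb R\to\mathbb R$ be measurable, strictly positive on $(0,\infty)$, identically zero elsewhere, and a Lévy density, i.e. $\int_0^\infty\min(1,x^2)\rho(x)\,dx<\infty$. Let $X=(X_t)_{t\ge 0}$ be a real Lévy process (with càdlàg paths) such that $\mathbb E[X_t]=0$ and $\mathbb E[X_t^2]<\infty$ for all $t\geq 0$. We say that $X$ has generating triple $(a,0,\rho)_{h\equiv j}$, $j\in\{0,1\}$, if $\mathbb E[e^{izX_t}]=e^{-t\Psi(z)}$ for all $t\ge0$, $z\in\mathbb R$, where $$\Psi(z)=-iaz-\int_0^\infty\big(e^{izx}-1-ijzx\big)\rho(x)\,dx$$ and the integral converges absolutely. For $k\ge1$ put $$e_k(t)=\sqrt{\tfrac2T}\,\sin\!\Big(\tfrac{\pi}{T}\big(k-\tfrac12\big)t\Big),\qquad Z_k=\int_0^TX_te_k(t)\,dt,\qquad Z^{(d)}=(Z_1,\dots,Z_d)^{\mathbf T}.$$ Let $f:\mathbb R\times[0,T]\to\mathbb R^d$ have the coordinates $$f_k(x,t)=\frac{\sqrt{2T}\,x}{\pi}\,\frac{\cos\big(\frac{\pi}{T}(k-\frac12)t\big)}{k-\frac12},\qquad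 k=1,\dots,d,$$ let $g(x)=\int_x^\infty\rho(s)\,ds$ for $x\ge0$ (so $g(0)\in(0,\infty]$), let $g^{-1}:(0,g(0))\to(0,\infty)$ be the inverse of $g|_{(0,\infty)}$, and define, for $r>0$, $v\in[0,1]$ and $s\geq 0$, $$H(r,v)=f\big(g^{-1}(r/T)\,\mathbb 1(0<r<T\,g(0)),\,Tv\big),\qquad C_k(s)=\int_0^s\!\int_0^1H_k(r,v)\,dv\,dr,\quad k=1,\dots,d$$ (where $g^{-1}(r/T)\,\mathbb 1(0<r<Tg(0))$ is read as $0$ if $r\ge T g(0)$). Let $(\Gamma_i)_{i\ge1}$ be the arrival times of a unit-rate Poisson process and let $(U_i)_{i\ge1}$ be i.i.d. uniform on $[0,1]$ and independent of $(\Gamma_i)_{i\ge1}$, on some probability space. Assume that (i) or (ii) below holds. Then $(e_k)_{k\geq 1}$ is the system of Karhunen–Loève basis functions of $X$ on $[0,T]$: it is a complete orthonormal system of $L^2([0,T])$ and $$\int_0^T\operatorname{Cov}(X_s,X_t)e_k(t)\,dt=\lambda_ke_k(s)\quad (s\in[0,T]),\qquad\lambda_k=\frac{\operatorname{Var}(X_1)\,T^2}{\pi^2(k-\frac12)^2},\qquad\lambda_1>\lambda_2>\dots>0.$$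 Moreover, $Z^{(d)}$ has the following shot-noise representations. (i) If $\int_0^1x\rho(x)\,dx<\infty$ and $X$ has generating triple $(a,0,\rho)_{h\equiv0}$, then the series $\sum_{i\ge1}H(\Gamma_i,U_i)$ converges almost surely and $$Z^{(d)}\overset{d}{=}\mathbf a+\sum_{i\ge1}H(\Gamma_i,U_i),\qquad a_k=a\,\frac{(-1)^{k+1}\sqrt2\,T^{3/2}}{\pi^2(k-\frac12)^2},\quad k=1,\dots,d.$$ (ii) If $X$ has generating triple $(0,0,\rho)_{h\equiv1}$, then the integrals defining $C(n)$ converge absolutely for all $n\in\mathbb N$, the limit below exists almost surely, and $$Z^{(d)}\overset{d}{=}\lim_{n\to\infty}\Big(\sum_{i=1}^nH(\Gamma_i,U_i)-C(n)\Big).$$ -/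

import Mathlib

open MeasureTheory ProbabilityTheory Filter Topology
open scoped NNReal ENNReal

noncomputable section

/-! ### Lévy processes -/

/-- A real-valued Lévy process `(X t)_{t ≥ 0}`: it starts at `0`, has independent and stationary
increments, and its paths are almost surely right-continuous with left limits (with stationarity
of the increments this contains stochastic continuity). -/
structure IsLevyProcess {Ω : Type*} [MeasurableSpace Ω] (P : Measure Ω) (X : ℝ≥0 → Ω → ℝ) :
    Prop where
  measurable : ∀ t, Measurable (X t)
  zero : ∀ᵐ ω ∂P, X 0 ω = 0
  indep : HasIndepIncrements X P
  stationary : ∀ s t : ℝ≥0, IdentDistrib (fun ω => X (s + t) ω - X s ω) (X t) P P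
  cadlag : ∀ᵐ ω ∂P, ∀ t : ℝ≥0, ContinuousWithinAt (fun s => X s ω) (Set.Ici t) t ∧
    ∃ l : ℝ, Tendsto (fun s => X s ω) (𝓝[<] t) (𝓝 l)

/-- The class of Lévy processes with zero mean and finite second moment at every time. -/
structure IsCenteredSquareIntegrableLevy {Ω : Type*} [MeasurableSpace Ω] (P : Measure Ω)
    (X : ℝ≥0 → Ω → ℝ) : Prop where
  levy : IsLevyProcess P X
  memLp_two : ∀ t, MemLp (X t) 2 P
  mean_zero : ∀ t, ∫ ω, X t ω ∂P = 0

/-- Lévy measures on `ℝ ∖ {0}`, regarded as measures on `ℝ` without an atom at `0`. -/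
structure IsLevyMeasure (ν : Measure ℝ) : Prop where
  zero : ν {0} = 0
  lintegral_lt_top : ∫⁻ x, ENNReal.ofReal (min 1 (x ^ 2)) ∂ν < ∞

/-- The integrand `e^{izx} - 1 - i z x h(x)` of the Lévy-Khintchine formula with
cut-off function `h`. -/
def levyIntegrand (h : ℝ → ℝ) (z x : ℝ) : ℂ :=
  Complex.exp (Complex.I * (z : ℂ) * (x : ℂ)) - 1 - Complex.I * (z : ℂ) * (x : ℂ) * (h x : ℂ)

/-- The characteristic exponent `Ψ` belonging to the triple `(a, σ², ν)` and the cut-off `h`. -/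
def levyExponent (h : ℝ → ℝ) (a σsq : ℝ) (ν : Measure ℝ) (z : ℝ) : ℂ :=
  (1 / 2 : ℂ) * (σsq : ℂ) * (z : ℂ) ^ 2 - Complex.I * (a : ℂ) * (z : ℂ)
    - ∫ x, levyIntegrand h z x ∂ν

/-- `X` has generating triple `(a, σ², ν)` with respect to the cut-off function `h`:
`ν` is a Lévy measure, the Lévy-Khintchine integrals converge absolutely, and
`E exp(i z X_t) = exp(-t Ψ(z))` for all `t ≥ 0` and all real `z`. -/
structure HasGeneratingTriple {Ω : Type*} [MeasurableSpace Ω] (P : Measure Ω)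
    (X : ℝ≥0 → Ω → ℝ) (h : ℝ → ℝ) (a σsq : ℝ) (ν : Measure ℝ) : Prop where
  variance_nonneg : 0 ≤ σsq
  levyMeasure : IsLevyMeasure ν
  integrable : ∀ z : ℝ, Integrable (levyIntegrand h z) ν
  charFun_eq : ∀ (t : ℝ≥0) (z : ℝ),
    charFun (P.map (X t)) z = Complex.exp (-((t : ℝ) : ℂ) * levyExponent h a σsq ν z)

/-- Integrability of the small jumps: `∫_{|x| ≤ 1} |x| ν(dx) < ∞`. -/
def HasIntegrableSmallJumps (ν : Measure ℝ) : Prop :=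
  ∫⁻ x in {x : ℝ | |x| ≤ 1}, ENNReal.ofReal |x| ∂ν < ∞

/-- The measure `ρ(x) dx` on the real line. -/
def densityMeasure (ρ : ℝ → ℝ) : Measure ℝ :=
  volume.withDensity fun x => ENNReal.ofReal (ρ x)

/-- A Lévy density that is strictly positive on `(0, ∞)` and identically zero elsewhere. -/
structure IsPositiveLevyDensity (ρ : ℝ → ℝ) : Prop where
  measurable : Measurable ρ
  pos : ∀ x, 0 < x → 0 < ρ x
  eq_zero : ∀ x, x ≤ 0 → ρ x = 0
  levyMeasure : IsLevyMeasure (densityMeasure ρ)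

/-! ### The Karhunen-Loève coefficients

Sequences are indexed from `0`, so that the index `k` below is the index `k + 1` of a sequence
that is numbered from `1`. -/

/-- `k - 1/2` for the `k`-th term of a sequence numbered from `1`. -/
def halfIndex (k : ℕ) : ℝ := ((k : ℝ) + 1) - 1 / 2

/-- `e_k(t) = √(2/T) sin((π/T)(k - 1/2) t)`. -/
def klEigenfunction (T : ℝ) (k : ℕ) (t : ℝ) : ℝ :=
  √(2 / T) * Real.sin (Real.pi / T * halfIndex k * t)

/-- `λ_k = α T² / (π² (k - 1/2)²)`. -/
def klEigenvalue (α T : ℝ) (k : ℕ) : ℝ :=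
  α * T ^ 2 / (Real.pi ^ 2 * halfIndex k ^ 2)

/-- `(e k)` is the system of Karhunen-Loève basis functions of `X` on `[0, T]`: a complete
orthonormal system of `L²([0, T])` formed by eigenfunctions of the covariance operator
`(K u)(s) = ∫_0^T Cov(X_s, X_t) u(t) dt`, with positive eigenvalues `lam k` listed in decreasing
order (strictly decreasing, so that all eigenspaces are lines). -/
structure IsKarhunenLoeveSystem {Ω : Type*} [MeasurableSpace Ω] (P : Measure Ω)
    (X : ℝ≥0 → Ω → ℝ) (T : ℝ) (e : ℕ → ℝ → ℝ) (lam : ℕ → ℝ) : Prop where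
  memLp : ∀ k, MemLp (e k) 2 (volume.restrict (Set.Icc 0 T))
  orthonormal : ∀ j k, ∫ t in 0..T, e j t * e k t = if j = k then 1 else 0
  complete : ∀ u : ℝ → ℝ, MemLp u 2 (volume.restrict (Set.Icc 0 T)) →
    (∀ k, ∫ t in 0..T, u t * e k t = 0) → u =ᵐ[volume.restrict (Set.Icc 0 T)] 0
  eigen : ∀ k, ∀ s ∈ Set.Icc (0 : ℝ) T,
    ∫ t in 0..T, cov[X s.toNNReal, X t.toNNReal; P] * e k t = lam k * e k s
  pos : ∀ k, 0 < lam k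
  strictAnti : StrictAnti lam

/-- The random vector `Z^{(d)}` of the first `d` stochastic coefficients
`Z_k = ∫_0^T X_t e_k(t) dt`, the integral being taken path by path. -/
def klCoefficients {Ω : Type*} (X : ℝ≥0 → Ω → ℝ) (T : ℝ) (d : ℕ) (ω : Ω) :
    EuclideanSpace ℝ (Fin d) :=
  WithLp.toLp 2 fun k => ∫ t in 0..T, X t.toNNReal ω * klEigenfunction T k t

/-! ### The shot-noise series -/

/-- The map `f : ℝ × [0, T] → ℝ^d`. -/
def klJump (T : ℝ) (d : ℕ) (x t : ℝ) : EuclideanSpace ℝ (Fin d) :=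
  WithLp.toLp 2 fun k =>
    √(2 * T) * x / Real.pi * (Real.cos (Real.pi / T * halfIndex k * t) / halfIndex k)

/-- The drift vector with entries `a (-1)^{k+1} √2 T^{3/2} / (π² (k - 1/2)²)`. -/
def klDrift (a T : ℝ) (d : ℕ) : EuclideanSpace ℝ (Fin d) :=
  WithLp.toLp 2 fun k =>
    a * ((-1) ^ (((k : ℕ) + 1) + 1) * √2 * T ^ (3 / 2 : ℝ) / (Real.pi ^ 2 * halfIndex k ^ 2))

/-- The tail integral `g(x) = ∫_x^∞ ρ(s) ds`; the value `g(0)` may be infinite. -/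
def tailIntegral (ρ : ℝ → ℝ) (x : ℝ) : ℝ≥0∞ :=
  ∫⁻ s in Set.Ioi x, ENNReal.ofReal (ρ s)

/-- The inverse of `g : (0, ∞) → (0, g(0))`: for `0 < y < g(0)` it is the point `x > 0` with
`g(x) = y`. It is only used for such `y`. -/
def tailInverse (ρ : ℝ → ℝ) (y : ℝ) : ℝ :=
  Function.invFunOn (tailIntegral ρ) (Set.Ioi 0) (ENNReal.ofReal y)

open Classical in
/-- `H(r, v) = f(g⁻¹(r/T) 𝟙(0 < r < T g(0)), T v)`. -/
def shotNoiseKernel (ρ : ℝ → ℝ) (T : ℝ) (d : ℕ) (r v : ℝ) : EuclideanSpace ℝ (Fin d) :=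
  klJump T d
    (if 0 < r ∧ ENNReal.ofReal r < ENNReal.ofReal T * tailIntegral ρ 0
      then tailInverse ρ (r / T) else 0)
    (T * v)

/-- The compensator `C(s) = ∫_0^s ∫_0^1 H(r, v) dv dr`, taken coordinate by coordinate. -/
def shotNoiseCompensator (ρ : ℝ → ℝ) (T : ℝ) (d : ℕ) (s : ℝ) : EuclideanSpace ℝ (Fin d) :=
  WithLp.toLp 2 fun k => ∫ r in 0..s, ∫ v in 0..1, shotNoiseKernel ρ T d r v k

/-- The partial sums `S_n = ∑_{i=1}^n H(Γ_i, U_i)`. -/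
def shotNoisePartialSum {Ω : Type*} (ρ : ℝ → ℝ) (T : ℝ) (d : ℕ) (Γ U : ℕ → Ω → ℝ) (n : ℕ)
    (ω : Ω) : EuclideanSpace ℝ (Fin d) :=
  ∑ i ∈ Finset.range n, shotNoiseKernel ρ T d (Γ i ω) (U i ω)

/-- `Γ` is the sequence of arrival times of a Poisson process with unit rate: the partial sums of
an i.i.d. sequence of exponential random variables with mean `1`. -/
def IsUnitPoissonArrivals {Ω : Type*} [MeasurableSpace Ω] (P : Measure Ω) (Γ : ℕ → Ω → ℝ) : Prop :=
  ∃ τ : ℕ → Ω → ℝ, (∀ i, Measurable (τ i)) ∧ iIndepFun τ P ∧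
    (∀ i, HasLaw (τ i) (expMeasure 1) P) ∧
    ∀ n ω, Γ n ω = ∑ i ∈ Finset.range (n + 1), τ i ω

/-- `U` is an i.i.d. sequence of random variables, uniformly distributed on `[0, 1]`. -/
structure IsIIDUniform {Ω : Type*} [MeasurableSpace Ω] (P : Measure Ω) (U : ℕ → Ω → ℝ) : Prop where
  measurable : ∀ i, Measurable (U i)
  indep : iIndepFun U P
  law : ∀ i, HasLaw (U i) (volume.restrict (Set.Icc (0 : ℝ) 1)) P

end

/-! ### The sine basis -/

/-! Karhunen–Loève system. Independent stationary increments give `Cov(X_s, X_t) = min(s, t) Var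
X_1`, the Brownian kernel up to a constant. It is the Green kernel of `-u''` with `u(0) = 0`, `u'(T)
= 0`, whose eigenfunctions are the sines `e_k`. Completeness comes from Weierstrass: multiplication
by `cos(πt/T)` maps the span of the `e_k` into itself, so `u ⟂ e_k` for all `k` makes `u e_0`
orthogonal to every polynomial in `cos(πt/T)`. Hence `u e_0 = 0` almost everywhere, and `e_0 > 0` on
`(0, T]`. The eigenvalues are positive because `Var X_1 > 0` (`HasGeneratingTriple.variance_pos`).

Law of `Z`. Let `Φ = ∑ ξ_k f_k(1, ·)`, minus the primitive of `∑ ξ_k e_k` that vanishes at `T`.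
Summation by parts turns Riemann sums of `⟨Z, ξ⟩ = ∫ X_t (-Φ'(t)) dt` into sums of independent
increments of `X` weighted by values of `Φ`. Their characteristic functions are explicit, and in the
limit `E exp(i⟨Z, ξ⟩) = exp(-∫_0^T Ψ(Φ(t)) dt)` (`IsLevyProcess.integral_exp_integral`).

Law of the series. Put `y(r) = g⁻¹(r/T)`, continued by zero, and `W(v) = Φ(Tv)`. Finite variance of
`X_1` forces `∫ x² ρ(x) dx < ∞` (`HasGeneratingTriple.integrable_sq`). Since `y` carries Lebesgue
measure to `T ρ(x) dx` (`measurePreserving_jumpSize`), `y` is square integrable. This controls the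
variances of the compensated increments between consecutive arrivals, which are martingale
differences, so the centred series converges almost surely
(`IsMarkedPoisson.ae_exists_tendsto_shotNoise`). For its law, let `Q(x) = ∫_0^x (E exp(i y(r) W(U))
- 1) dr`. Then `exp(i ∑_{i ≤ n} y(Γ_i) W(U_i) - Q(Γ_n))` is a bounded sequence of mean one, and
letting `n → ∞` gives the characteristic function of the limit
(`IsMarkedPoisson.integral_exp_limit`).

Matching. Fubini, `t = Tv` and the image measure under `y` identify the two exponents
(`neg_integral_levyExponent`), and characteristic functions determine laws. This settles `h ≡ 1`.
For `h ≡ 0` the first moment of the Lévy measure is finite: the triple is recompensated, and the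
compensators `C(n)` converge to exactly the drift this creates. -/

lemma halfIndex_pos (k : ℕ) : 0 < halfIndex k := by
  unfold halfIndex
  have : (0 : ℝ) ≤ k := k.cast_nonneg
  linarith

lemma halfIndex_succ (k : ℕ) : halfIndex (k + 1) = halfIndex k + 1 := by
  unfold halfIndex; push_cast; ring

lemma halfIndex_freq_mul {T : ℝ} (hT : 0 < T) (k : ℕ) :
    Real.pi / T * halfIndex k * T = k * Real.pi + Real.pi / 2 := by
  unfold halfIndex; field_simp; ring

lemma cos_halfIndex_freq {T : ℝ} (hT : 0 < T) (k : ℕ) :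
    Real.cos (Real.pi / T * halfIndex k * T) = 0 := by
  rw [halfIndex_freq_mul hT, Real.cos_add, Real.sin_nat_mul_pi, Real.cos_pi_div_two]; simp

lemma sin_halfIndex_freq {T : ℝ} (hT : 0 < T) (k : ℕ) :
    Real.sin (Real.pi / T * halfIndex k * T) = (-1) ^ k := by
  rw [halfIndex_freq_mul hT, Real.sin_add, Real.sin_nat_mul_pi, Real.sin_pi_div_two,
    Real.cos_nat_mul_pi]; simp

lemma continuous_klEigenfunction (T : ℝ) (k : ℕ) : Continuous (klEigenfunction T k) := by
  unfold klEigenfunction; fun_prop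

lemma integral_cos_int_mul {T : ℝ} (hT : 0 < T) (n : ℤ) :
    ∫ t in 0..T, Real.cos (Real.pi / T * n * t) = if n = 0 then T else 0 := by
  split_ifs with h
  · simp [h]
  · have hn : (n : ℝ) ≠ 0 := by exact_mod_cast h
    have hc : Real.pi / T * n ≠ 0 := by positivity
    rw [intervalIntegral.integral_comp_mul_left (fun x => Real.cos x) hc, integral_cos]
    have : Real.pi / T * n * T = n * Real.pi := by field_simp
    rw [this, Real.sin_int_mul_pi]; simp

/-- Product-to-sum: sums and differences of half-integers are integers, and the sum `j + k + 1`
never vanishes, so only the difference term can contribute. -/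
lemma integral_klEigenfunction_mul {T : ℝ} (hT : 0 < T) (j k : ℕ) :
    ∫ t in 0..T, klEigenfunction T j t * klEigenfunction T k t = if j = k then 1 else 0 := by
  have h : ∀ t, klEigenfunction T j t * klEigenfunction T k t
      = 1 / T * Real.cos (Real.pi / T * ((j - k : ℤ) : ℝ) * t)
        - 1 / T * Real.cos (Real.pi / T * ((j + k + 1 : ℤ) : ℝ) * t) := by
    intro t
    have e1 : Real.pi / T * ((j - k : ℤ) : ℝ) * t
        = Real.pi / T * halfIndex j * t - Real.pi / T * halfIndex k * t := by
      unfold halfIndex; push_cast; ring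
    have e2 : Real.pi / T * ((j + k + 1 : ℤ) : ℝ) * t
        = Real.pi / T * halfIndex j * t + Real.pi / T * halfIndex k * t := by
      unfold halfIndex; push_cast; ring
    have e3 : √(2 / T) * √(2 / T) = 2 / T := Real.mul_self_sqrt (by positivity)
    rw [e1, e2, Real.cos_sub, Real.cos_add]
    unfold klEigenfunction
    linear_combination (Real.sin (Real.pi / T * halfIndex j * t)
      * Real.sin (Real.pi / T * halfIndex k * t)) * e3
  simp_rw [h]
  rw [intervalIntegral.integral_sub, intervalIntegral.integral_const_mul,
    intervalIntegral.integral_const_mul, integral_cos_int_mul hT, integral_cos_int_mul hT,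
    if_neg (show ¬((j : ℤ) + k + 1 = 0) by omega)]
  · by_cases hjk : j = k
    · subst hjk; simp [hT.ne']
    · rw [if_neg (by omega), if_neg hjk]; simp
  · exact (by fun_prop : Continuous _).intervalIntegrable _ _
  · exact (by fun_prop : Continuous _).intervalIntegrable _ _

/-- `min s t` is the Green kernel of `-d²/dt²` with a Dirichlet condition at `0` and a Neumann
condition at `T`; `hcT` is the Neumann condition for `sin(ct)`. -/
lemma integral_min_mul_sin {T c : ℝ} (hc : c ≠ 0) (hcT : Real.cos (c * T) = 0) {s : ℝ}
    (hs : s ∈ Set.Icc 0 T) :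
    ∫ t in 0..T, min s t * Real.sin (c * t) = Real.sin (c * s) / c ^ 2 := by
  have hcont : Continuous fun t => min s t * Real.sin (c * t) := by fun_prop
  rw [← intervalIntegral.integral_add_adjacent_intervals (hcont.intervalIntegrable 0 s)
    (hcont.intervalIntegrable s T)]
  have h1 : ∫ t in 0..s, min s t * Real.sin (c * t)
      = (-s * Real.cos (c * s) / c + Real.sin (c * s) / c ^ 2) := by
    rw [intervalIntegral.integral_congr (g := fun t => t * Real.sin (c * t))]
    · rw [intervalIntegral.integral_eq_sub_of_hasDerivAt
        (f := fun t => -t * Real.cos (c * t) / c + Real.sin (c * t) / c ^ 2)]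
      · simp
      · intro t _
        have hm : HasDerivAt (fun t => c * t) c t := by
          simpa using (hasDerivAt_id t).const_mul c
        have := (((hasDerivAt_id t).neg.mul hm.cos).div_const c).add (hm.sin.div_const (c ^ 2))
        refine (this.congr_deriv ?_)
        simp; field_simp; ring
      · exact (by fun_prop : Continuous _).intervalIntegrable _ _
    · intro t ht
      rw [Set.uIcc_of_le hs.1] at ht
      simp [ht.2]
  have h2 : ∫ t in s..T, min s t * Real.sin (c * t) = s * Real.cos (c * s) / c := by
    rw [intervalIntegral.integral_congr (g := fun t => s * Real.sin (c * t))]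
    · rw [intervalIntegral.integral_eq_sub_of_hasDerivAt
        (f := fun t => -s * Real.cos (c * t) / c)]
      · rw [hcT]; ring
      · intro t _
        have hm : HasDerivAt (fun t => c * t) c t := by
          simpa using (hasDerivAt_id t).const_mul c
        refine ((hm.cos.const_mul (-s)).div_const c).congr_deriv ?_
        field_simp
      · exact (by fun_prop : Continuous _).intervalIntegrable _ _
    · intro t ht
      rw [Set.uIcc_of_le hs.2] at ht
      simp [ht.1]
  rw [h1, h2]; ring

/-- Lower edge of the three-term recurrence: the frequency below `1/2` is `-1/2`, and oddness of the
sine turns it into `-e_0`. -/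
lemma klEigenfunction_zero_mul_cos (T t : ℝ) :
    klEigenfunction T 0 t * Real.cos (Real.pi / T * t)
      = (klEigenfunction T 1 t - klEigenfunction T 0 t) / 2 := by
  have h0 : Real.pi / T * halfIndex 0 * t = Real.pi / T * t - Real.pi / T * halfIndex 0 * t := by
    unfold halfIndex; push_cast; ring
  have h1 : Real.pi / T * halfIndex 1 * t = Real.pi / T * t + Real.pi / T * halfIndex 0 * t := by
    unfold halfIndex; push_cast; ring
  have h2 := congrArg Real.sin h0
  rw [Real.sin_sub] at h2
  unfold klEigenfunction
  rw [h1, Real.sin_add]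
  linear_combination (√(2 / T) / 2) * h2

lemma klEigenfunction_succ_mul_cos (T t : ℝ) (k : ℕ) :
    klEigenfunction T (k + 1) t * Real.cos (Real.pi / T * t)
      = (klEigenfunction T (k + 2) t + klEigenfunction T k t) / 2 := by
  have h0 : Real.pi / T * halfIndex k * t
      = Real.pi / T * halfIndex (k + 1) * t - Real.pi / T * t := by
    rw [halfIndex_succ]; ring
  have h1 : Real.pi / T * halfIndex (k + 2) * t
      = Real.pi / T * halfIndex (k + 1) * t + Real.pi / T * t := by
    rw [halfIndex_succ (k + 1)]; ring
  unfold klEigenfunction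
  rw [h0, h1, Real.sin_add, Real.sin_sub]
  ring

/-- A function on `[0, T]` that is orthogonal to all `e_k` is orthogonal to all products
`e_k cos(π t / T)^m`. -/
lemma integral_mul_klEigenfunction_mul_cos_pow {T : ℝ} {u : ℝ → ℝ}
    (hu : Integrable u (volume.restrict (Set.Icc 0 T)))
    (h : ∀ k, ∫ t in Set.Icc 0 T, u t * klEigenfunction T k t = 0) (m k : ℕ) :
    ∫ t in Set.Icc 0 T, u t * (klEigenfunction T k t * Real.cos (Real.pi / T * t) ^ m) = 0 := by
  have hint : ∀ m k, Integrable
      (fun t => u t * (klEigenfunction T k t * Real.cos (Real.pi / T * t) ^ m))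
      (volume.restrict (Set.Icc 0 T)) := by
    intro m k
    refine hu.mul_bdd (c := √(2 / T)) (Continuous.aestronglyMeasurable ?_) (ae_of_all _ fun t => ?_)
    · exact (continuous_klEigenfunction T k).mul (by fun_prop)
    · unfold klEigenfunction
      rw [norm_mul, norm_mul, norm_pow, Real.norm_of_nonneg (Real.sqrt_nonneg _)]
      have h1 : ‖Real.sin (Real.pi / T * halfIndex k * t)‖ ≤ 1 := Real.abs_sin_le_one _
      have h2 : ‖Real.cos (Real.pi / T * t)‖ ^ m ≤ 1 :=
        pow_le_one₀ (norm_nonneg _) (Real.abs_cos_le_one _)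
      calc _ ≤ √(2 / T) * 1 * 1 := by gcongr
        _ = _ := by ring
  induction m generalizing k with
  | zero => simpa using h k
  | succ m ih =>
    rcases k with _ | k
    · have e : ∀ t, u t * (klEigenfunction T 0 t * Real.cos (Real.pi / T * t) ^ (m + 1))
          = (1 / 2) * (u t * (klEigenfunction T 1 t * Real.cos (Real.pi / T * t) ^ m))
          - (1 / 2) * (u t * (klEigenfunction T 0 t * Real.cos (Real.pi / T * t) ^ m)) := by
        intro t
        linear_combination (u t * Real.cos (Real.pi / T * t) ^ m) * klEigenfunction_zero_mul_cos T t
      simp_rw [e]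
      rw [integral_sub ((hint _ _).const_mul _) ((hint _ _).const_mul _),
        integral_const_mul, integral_const_mul, ih, ih]; simp
    · have e : ∀ t, u t * (klEigenfunction T (k + 1) t * Real.cos (Real.pi / T * t) ^ (m + 1))
          = (1 / 2) * (u t * (klEigenfunction T (k + 2) t * Real.cos (Real.pi / T * t) ^ m))
          + (1 / 2) * (u t * (klEigenfunction T k t * Real.cos (Real.pi / T * t) ^ m)) := by
        intro t
        linear_combination (u t * Real.cos (Real.pi / T * t) ^ m)
          * klEigenfunction_succ_mul_cos T t k
      simp_rw [e]
      rw [integral_add ((hint _ _).const_mul _) ((hint _ _).const_mul _),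
        integral_const_mul, integral_const_mul, ih, ih]; simp

/-- An integrable function on `[0, T]` that is orthogonal to all powers of `cos(π t / T)`
vanishes. -/
lemma ae_eq_zero_of_integral_mul_cos_pow {T : ℝ} (hT : 0 < T) {w : ℝ → ℝ}
    (hw : Integrable w (volume.restrict (Set.Icc 0 T)))
    (h : ∀ m : ℕ, ∫ t in Set.Icc 0 T, w t * Real.cos (Real.pi / T * t) ^ m = 0) :
    w =ᵐ[volume.restrict (Set.Icc 0 T)] 0 := by
  have hcos : Continuous fun t => Real.cos (Real.pi / T * t) := by fun_prop
  have hbdd : ∀ {g : ℝ → ℝ}, Continuous g →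
      Integrable (fun t => w t * g (Real.cos (Real.pi / T * t)))
        (volume.restrict (Set.Icc 0 T)) := by
    intro g hg
    obtain ⟨C, hC⟩ := isCompact_Icc.exists_bound_of_continuousOn
      (hg.continuousOn (s := Set.Icc (-1) 1))
    exact hw.mul_bdd (c := C) (hg.comp hcos).aestronglyMeasurable
      (ae_of_all _ fun t => hC _ ⟨Real.neg_one_le_cos _, Real.cos_le_one _⟩)
  have hpoly : ∀ p : Polynomial ℝ,
      ∫ t in Set.Icc 0 T, w t * p.eval (Real.cos (Real.pi / T * t)) = 0 := by
    intro p
    simp_rw [Polynomial.eval_eq_sum_range, Finset.mul_sum]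
    rw [integral_finsetSum]
    · refine Finset.sum_eq_zero fun i _ => ?_
      simp_rw [show ∀ t, w t * (p.coeff i * Real.cos (Real.pi / T * t) ^ i)
        = p.coeff i * (w t * Real.cos (Real.pi / T * t) ^ i) from fun t => by ring]
      rw [integral_const_mul, h, mul_zero]
    · intro i _
      exact hbdd (g := fun x => p.coeff i * x ^ i) (by fun_prop)
  have hcont : ∀ g : ℝ → ℝ, Continuous g →
      ∫ t in Set.Icc 0 T, w t * g (Real.cos (Real.pi / T * t)) = 0 := by
    intro g hg
    set N := ∫ t in Set.Icc 0 T, ‖w t‖ with hN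
    have hN0 : 0 ≤ N := integral_nonneg fun t => norm_nonneg _
    refine abs_eq_zero.1 (le_antisymm (le_of_forall_pos_le_add fun ε hε => ?_) (abs_nonneg _))
    obtain ⟨p, hp⟩ := exists_polynomial_near_of_continuousOn (-1) 1 g hg.continuousOn
      (ε / (N + 1)) (by positivity)
    have e : ∫ t in Set.Icc 0 T, w t * g (Real.cos (Real.pi / T * t))
        = ∫ t in Set.Icc 0 T, w t * (g (Real.cos (Real.pi / T * t))
          - p.eval (Real.cos (Real.pi / T * t))) := by
      simp_rw [mul_sub]
      rw [integral_sub (hbdd hg) (hbdd p.continuous), hpoly, sub_zero]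
    rw [e, zero_add]
    calc |∫ t in Set.Icc 0 T, w t * (g (Real.cos (Real.pi / T * t))
          - p.eval (Real.cos (Real.pi / T * t)))|
        ≤ ∫ t in Set.Icc 0 T, ‖w t‖ * (ε / (N + 1)) := by
          rw [← Real.norm_eq_abs]
          refine norm_integral_le_of_norm_le (hw.norm.mul_const _) (ae_of_all _ fun t => ?_)
          rw [norm_mul]
          gcongr
          rw [norm_sub_rev]
          exact (hp _ ⟨Real.neg_one_le_cos _, Real.cos_le_one _⟩).le
      _ = N * (ε / (N + 1)) := by rw [integral_mul_const]
      _ ≤ ε := by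
          rw [mul_div_assoc', div_le_iff₀ (by positivity)]
          nlinarith
  -- The map `t ↦ cos(πt/T)` is injective on `[0, T]` with inverse `(T/π) arccos`, so every test
  -- function is there a continuous function of the cosine.
  refine ae_eq_zero_of_integral_contDiff_smul_eq_zero hw.locallyIntegrable fun g hg _ => ?_
  have := hcont (fun x => g (T / Real.pi * Real.arccos x))
    (hg.continuous.comp (by fun_prop))
  refine Eq.trans ?_ this
  refine setIntegral_congr_fun measurableSet_Icc fun t ht => ?_
  simp only [smul_eq_mul]
  rw [Real.arccos_cos, mul_comm]
  · congr 2
    field_simp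
  · have := ht.1; positivity
  · rw [div_mul_eq_mul_div, div_le_iff₀ hT]
    exact mul_le_mul_of_nonneg_left ht.2 Real.pi_pos.le

lemma klEigenfunction_complete {T : ℝ} (hT : 0 < T) {u : ℝ → ℝ}
    (hu : MemLp u 2 (volume.restrict (Set.Icc 0 T)))
    (h : ∀ k, ∫ t in 0..T, u t * klEigenfunction T k t = 0) :
    u =ᵐ[volume.restrict (Set.Icc 0 T)] 0 := by
  have hui : Integrable u (volume.restrict (Set.Icc 0 T)) := hu.integrable (by norm_num)
  have h' : ∀ k, ∫ t in Set.Icc 0 T, u t * klEigenfunction T k t = 0 := by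
    intro k
    rw [integral_Icc_eq_integral_Ioc, ← intervalIntegral.integral_of_le hT.le, h]
  have hw : Integrable (fun t => u t * klEigenfunction T 0 t)
      (volume.restrict (Set.Icc 0 T)) := by
    refine hui.mul_bdd (c := √(2 / T)) (continuous_klEigenfunction T 0).aestronglyMeasurable
      (ae_of_all _ fun t => ?_)
    unfold klEigenfunction
    rw [norm_mul, Real.norm_of_nonneg (Real.sqrt_nonneg _)]
    exact mul_le_of_le_one_right (Real.sqrt_nonneg _) (Real.abs_sin_le_one _)
  have hz := ae_eq_zero_of_integral_mul_cos_pow hT hw fun m => by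
    simpa only [mul_assoc] using integral_mul_klEigenfunction_mul_cos_pow hui h' m 0
  have h0 : ∀ᵐ t ∂volume.restrict (Set.Icc 0 T), t ≠ 0 :=
    ae_restrict_of_ae (Measure.ae_ne volume 0)
  filter_upwards [hz, h0, ae_restrict_mem measurableSet_Icc] with t ht ht0 htm
  -- For `t ∈ (0, T]` the phase of `e_0` lies in `(0, π/2]`, so `e_0` can be divided out.
  have hpos : 0 < klEigenfunction T 0 t := by
    have ht' : 0 < t := lt_of_le_of_ne htm.1 (Ne.symm ht0)
    have := halfIndex_pos 0
    unfold klEigenfunction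
    refine mul_pos (by positivity) (Real.sin_pos_of_pos_of_lt_pi (by positivity) ?_)
    have h1 : Real.pi / T * halfIndex 0 * t ≤ Real.pi / T * halfIndex 0 * T :=
      mul_le_mul_of_nonneg_left htm.2 (by positivity)
    rw [halfIndex_freq_mul hT] at h1
    simp only [Nat.cast_zero, zero_mul, zero_add] at h1
    linarith [Real.pi_pos]
  exact (mul_eq_zero.1 ht).resolve_right hpos.ne'

lemma klEigenvalue_pos {α T : ℝ} (hα : 0 < α) (hT : 0 < T) (k : ℕ) : 0 < klEigenvalue α T k := by
  have := halfIndex_pos k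
  unfold klEigenvalue; positivity

lemma klEigenvalue_strictAnti {α T : ℝ} (hα : 0 < α) (hT : 0 < T) :
    StrictAnti (klEigenvalue α T) := by
  refine strictAnti_nat_of_succ_lt fun k => ?_
  have := halfIndex_pos k
  unfold klEigenvalue
  rw [halfIndex_succ]
  gcongr
  linarith

/-! ### Covariances of a Lévy process -/

/-- Nonnegativity makes `f` monotone. Squeezing `f (n t)` between the values at the integers around
`n t` gives `n |f t - t f 1| ≤ f 1` for all `n`, which forces equality. Applied to the variance,
this needs no continuity in time. -/
lemma NNReal.eq_mul_of_additive_of_nonneg {f : ℝ≥0 → ℝ} (h0 : ∀ t, 0 ≤ f t)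
    (hadd : ∀ s t, f (s + t) = f s + f t) (t : ℝ≥0) : f t = t * f 1 := by
  have hmono : Monotone f := fun a b hab => by
    obtain ⟨c, rfl⟩ := exists_add_of_le hab
    rw [hadd]; linarith [h0 c]
  have hnat : ∀ (n : ℕ) s, f (n * s) = n * f s := by
    intro n s
    induction n with
    | zero => have := hadd 0 0; simp at this; simp [this]
    | succ n ih => push_cast; rw [add_mul, hadd, ih, one_mul]; ring
  have key : ∀ n : ℕ, n * |f t - t * f 1| ≤ f 1 := by
    intro n
    have h1 := hmono (Nat.floor_le (zero_le : (0:ℝ≥0) ≤ n * t))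
    have h2 := hmono (Nat.lt_floor_add_one ((n : ℝ≥0) * t)).le
    rw [hadd] at h2
    have h3 := hnat ⌊(n : ℝ≥0) * t⌋₊ 1
    rw [mul_one] at h3
    rw [hnat, h3] at h1 h2
    have h4 : ((⌊(n : ℝ≥0) * t⌋₊ : ℕ) : ℝ) ≤ n * t := by
      exact_mod_cast Nat.floor_le (zero_le : (0:ℝ≥0) ≤ n * t)
    have h5 : (n * t : ℝ) ≤ (⌊(n : ℝ≥0) * t⌋₊ : ℕ) + 1 := by
      exact_mod_cast (Nat.lt_floor_add_one ((n : ℝ≥0) * t)).le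
    have h6 := h0 1
    rw [← abs_of_nonneg (Nat.cast_nonneg (α := ℝ) n), ← abs_mul, abs_le]
    constructor <;> nlinarith
  by_contra hne
  have hpos : 0 < |f t - t * f 1| := abs_pos.2 (sub_ne_zero.2 hne)
  obtain ⟨n, hn⟩ := exists_nat_gt (f 1 / |f t - t * f 1|)
  rw [div_lt_iff₀ hpos] at hn
  linarith [key n]

section Levy

variable {Ω : Type*} [MeasurableSpace Ω] {P : Measure Ω}
  {X : ℝ≥0 → Ω → ℝ}

lemma IsCenteredSquareIntegrableLevy.variance_eq (hX : IsCenteredSquareIntegrableLevy P X)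
    (t : ℝ≥0) : Var[X t; P] = t * Var[X 1; P] := by
  refine NNReal.eq_mul_of_additive_of_nonneg (f := fun t => Var[X t; P])
    (fun t => variance_nonneg _ _) (fun s t => ?_) t
  have hind := hX.levy.indep.indepFun_eval_sub (zero_le : 0 ≤ s) (le_self_add : s ≤ s + t)
    hX.levy.zero
  have h := hind.variance_add (hX.memLp_two s) ((hX.memLp_two (s + t)).sub (hX.memLp_two s))
  have hst := (hX.levy.stationary s t).variance_eq
  rw [add_sub_cancel] at h
  rw [h, ← hst]
  rfl

lemma IsCenteredSquareIntegrableLevy.covariance_eq [IsProbabilityMeasure P]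
    (hX : IsCenteredSquareIntegrableLevy P X)
    (s t : ℝ≥0) : cov[X s, X t; P] = min s t * Var[X 1; P] := by
  wlog hst : s ≤ t generalizing s t
  · rw [covariance_comm, this t s (le_of_not_ge hst), min_comm]
  have hind := hX.levy.indep.indepFun_eval_sub (zero_le : 0 ≤ s) hst hX.levy.zero
  have h1 := hind.covariance_eq_zero (hX.memLp_two s) ((hX.memLp_two t).sub (hX.memLp_two s))
  have h2 : cov[X s, X t; P] = cov[X s, X s + (X t - X s); P] := by rw [add_sub_cancel]
  rw [h2, covariance_add_right (hX.memLp_two s) (hX.memLp_two s)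
    ((hX.memLp_two t).sub (hX.memLp_two s)), h1, covariance_self (hX.levy.measurable s).aemeasurable,
    hX.variance_eq s, min_eq_left (by exact_mod_cast hst), add_zero]

lemma isKarhunenLoeveSystem_of_variance_pos [IsProbabilityMeasure P]
    (hX : IsCenteredSquareIntegrableLevy P X)
    {T : ℝ} (hT : 0 < T) (hV : 0 < Var[X 1; P]) :
    IsKarhunenLoeveSystem P X T (klEigenfunction T) (klEigenvalue Var[X 1; P] T) where
  memLp k := by
    refine MemLp.of_bound (continuous_klEigenfunction T k).aestronglyMeasurable (√(2 / T))
      (ae_of_all _ fun t => ?_)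
    unfold klEigenfunction
    rw [norm_mul, Real.norm_of_nonneg (Real.sqrt_nonneg _)]
    exact mul_le_of_le_one_right (Real.sqrt_nonneg _) (Real.abs_sin_le_one _)
  orthonormal := integral_klEigenfunction_mul hT
  complete u hu h := klEigenfunction_complete hT hu h
  eigen k s hs := by
    have hk := halfIndex_pos k
    have hc : Real.pi / T * halfIndex k ≠ 0 := by positivity
    have e : ∀ t ∈ Set.uIcc 0 T, cov[X s.toNNReal, X t.toNNReal; P] * klEigenfunction T k t
        = (Var[X 1; P] * √(2 / T)) * (min s t * Real.sin (Real.pi / T * halfIndex k * t)) := by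
      intro t ht
      rw [Set.uIcc_of_le hT.le] at ht
      rw [hX.covariance_eq, NNReal.coe_min, Real.coe_toNNReal _ hs.1, Real.coe_toNNReal _ ht.1]
      unfold klEigenfunction; ring
    rw [intervalIntegral.integral_congr e, intervalIntegral.integral_const_mul,
      integral_min_mul_sin hc (cos_halfIndex_freq hT k) hs]
    unfold klEigenfunction klEigenvalue
    field_simp
  pos := klEigenvalue_pos hV hT
  strictAnti := klEigenvalue_strictAnti hV hT

end Levy

/-! ### Second moments of the Lévy measure -/

/-- Taylor's bound `|zx|²` holds for `|zx| ≤ 1`; beyond, the triangle inequality gives `2|zx| ≤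
2|zx|²`. This quadratic bound is why a second moment of the Lévy measure suffices to compensate all
jumps. -/
lemma norm_levyIntegrand_one_le (z x : ℝ) :
    ‖levyIntegrand (fun _ => 1) z x‖ ≤ 2 * z ^ 2 * x ^ 2 := by
  have e : levyIntegrand (fun _ => 1) z x
      = Complex.exp (Complex.I * ((z * x : ℝ) : ℂ)) - 1 - Complex.I * ((z * x : ℝ) : ℂ) := by
    unfold levyIntegrand; push_cast; ring_nf
  have hn : ‖Complex.I * ((z * x : ℝ) : ℂ)‖ = |z * x| := by simp
  have hsq : 2 * z ^ 2 * x ^ 2 = 2 * |z * x| ^ 2 := by rw [sq_abs]; ring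
  rw [e, hsq]
  rcases le_total |z * x| 1 with h | h
  · have := Complex.norm_exp_sub_one_sub_id_le (hn.trans_le h)
    rw [hn] at this
    linarith [sq_nonneg |z * x|]
  · have h1 := norm_sub_le (Complex.exp (Complex.I * ((z * x : ℝ) : ℂ)) - 1)
      (Complex.I * ((z * x : ℝ) : ℂ))
    have h2 := Real.norm_exp_I_mul_ofReal_sub_one_le (x := z * x)
    rw [hn] at h1
    rw [Real.norm_eq_abs] at h2
    nlinarith

/-- A constant cut-off affects only the imaginary part, so the moduli of the characteristic
functions, and all that is derived from them, are the same for `h ≡ 0` and `h ≡ 1`. -/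
lemma levyIntegrand_re (c z x : ℝ) :
    (levyIntegrand (fun _ => c) z x).re = -(1 - Real.cos (z * x)) := by
  have e : levyIntegrand (fun _ => c) z x
      = Complex.exp (((z * x : ℝ) : ℂ) * Complex.I) - 1 - ((z * x * c : ℝ) : ℂ) * Complex.I := by
    unfold levyIntegrand; push_cast; ring_nf
  rw [e, Complex.sub_re, Complex.sub_re, Complex.exp_ofReal_mul_I_re, Complex.re_ofReal_mul]
  simp

lemma continuous_levyIntegrand_one : Continuous fun p : ℝ × ℝ =>
    levyIntegrand (fun _ => 1) p.1 p.2 := by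
  unfold levyIntegrand; fun_prop

/-- For a finite second moment of the Lévy measure the compensated exponent is continuous. -/
lemma continuous_integral_levyIntegrand_one {ν : Measure ℝ}
    (hν : Integrable (fun x => x ^ 2) ν) :
    Continuous fun z => ∫ x, levyIntegrand (fun _ => 1) z x ∂ν := by
  refine continuous_iff_continuousAt.2 fun z₀ => ?_
  refine continuousAt_of_dominated (bound := fun x => 2 * (|z₀| + 1) ^ 2 * x ^ 2) ?_ ?_ ?_ ?_
  · exact Eventually.of_forall fun z =>
      (continuous_levyIntegrand_one.comp (by fun_prop : Continuous fun x => (z, x)))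
        |>.aestronglyMeasurable
  · filter_upwards [Metric.ball_mem_nhds z₀ one_pos] with z hz
    refine ae_of_all _ fun x => (norm_levyIntegrand_one_le z x).trans ?_
    have hz' : |z| ≤ |z₀| + 1 := by
      have h1 : |z - z₀| < 1 := by simpa [Real.dist_eq] using hz
      have h2 := abs_add_le (z - z₀) z₀
      rw [sub_add_cancel] at h2
      linarith
    have : z ^ 2 ≤ (|z₀| + 1) ^ 2 := by
      rw [← sq_abs z]; gcongr
    gcongr
  · exact hν.const_mul _
  · refine ae_of_all _ fun x => ?_
    exact (continuous_levyIntegrand_one.comp (by fun_prop : Continuous fun z => (z, x)))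
      |>.continuousAt

section Levy

variable {Ω : Type*} [MeasurableSpace Ω] {P : Measure Ω}
  {X : ℝ≥0 → Ω → ℝ} {ν : Measure ℝ} {b c : ℝ}

lemma HasGeneratingTriple.integrable_one_sub_cos
    (h : HasGeneratingTriple P X (fun _ => c) b 0 ν) (z : ℝ) :
    Integrable (fun x => 1 - Real.cos (z * x)) ν := by
  have := (h.integrable z).re.neg
  refine this.congr (ae_of_all _ fun x => ?_)
  have := levyIntegrand_re c z x
  simp only [Pi.neg_apply, RCLike.re_to_complex, this, neg_neg]

lemma HasGeneratingTriple.norm_charFun (h : HasGeneratingTriple P X (fun _ => c) b 0 ν) (z : ℝ) :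
    ‖charFun (P.map (X 1)) z‖ = Real.exp (-∫ x, (1 - Real.cos (z * x)) ∂ν) := by
  rw [h.charFun_eq, Complex.norm_exp]
  congr 1
  have h1 : (∫ x, levyIntegrand (fun _ => c) z x ∂ν).re = -∫ x, (1 - Real.cos (z * x)) ∂ν := by
    rw [← integral_neg]
    simp_rw [← levyIntegrand_re c]
    exact (integral_re (h.integrable z)).symm
  rw [← h1]
  simp [levyExponent]

variable [IsProbabilityMeasure P]

lemma one_sub_re_charFun_le {Y : Ω → ℝ} (hY : MemLp Y 2 P) (z : ℝ) :
    1 - z ^ 2 / 2 * ∫ ω, Y ω ^ 2 ∂P ≤ (charFun (P.map Y) z).re := by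
  have hYm := hY.aestronglyMeasurable.aemeasurable
  rw [charFun_apply_real, integral_map hYm (by fun_prop)]
  have hi : Integrable (fun ω => Complex.exp (z * Y ω * Complex.I)) P := by
    refine Integrable.of_bound (C := 1) ?_ (ae_of_all _ fun ω => ?_)
    · exact (by fun_prop : Continuous fun y : ℝ => Complex.exp (z * y * Complex.I))
        |>.comp_aestronglyMeasurable hY.aestronglyMeasurable
    · rw [← Complex.ofReal_mul, Complex.norm_exp_ofReal_mul_I]
  have hre := integral_re hi
  simp only [RCLike.re_to_complex] at hre
  rw [← hre]
  have h1 : 1 - z ^ 2 / 2 * ∫ ω, Y ω ^ 2 ∂P = ∫ ω, (1 - z ^ 2 / 2 * Y ω ^ 2) ∂P := by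
    rw [integral_sub (integrable_const _) (hY.integrable_sq.const_mul _), integral_const_mul]
    simp
  rw [h1]
  refine integral_mono ((integrable_const _).sub (hY.integrable_sq.const_mul _)) hi.re fun ω => ?_
  have := Real.one_sub_sq_div_two_le_cos (x := z * Y ω)
  simp only
  rw [← Complex.ofReal_mul, Complex.exp_ofReal_mul_I_re]
  linarith

/-- Square integrability of the process gives a second moment of its Lévy measure. -/
lemma HasGeneratingTriple.integrable_sq (h : HasGeneratingTriple P X (fun _ => c) b 0 ν)
    (hX : MemLp (X 1) 2 P) : Integrable (fun x => x ^ 2) ν := by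
  set V := ∫ ω, X 1 ω ^ 2 ∂P with hV
  have hV0 : 0 ≤ V := integral_nonneg fun ω => sq_nonneg _
  -- With `q = z²V`, the bounds `1 - q/2 ≤ Re φ(z) ≤ e^{-A}` and `e^A ≥ 1 + A` give `(1 - q/2)(1 +
  -- A) ≤ 1`, hence `A ≤ q/(2 - q) ≤ q` when `q ≤ 1`.
  have key : ∀ z : ℝ, z ^ 2 * V ≤ 1 → ∫ x, (1 - Real.cos (z * x)) ∂ν ≤ z ^ 2 * V := by
    intro z hz
    set A := ∫ x, (1 - Real.cos (z * x)) ∂ν with hA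
    have h1 := one_sub_re_charFun_le hX z
    have h2 := Complex.re_le_norm (charFun (P.map (X 1)) z)
    rw [h.norm_charFun z, ← hA] at h2
    have h3 : Real.exp (-A) * Real.exp A = 1 := by rw [← Real.exp_add]; simp
    have h4 := Real.add_one_le_exp A
    have h5 : (1 - z ^ 2 / 2 * V) * Real.exp A ≤ 1 := by
      calc _ ≤ Real.exp (-A) * Real.exp A := by gcongr; exact h1.trans h2
        _ = 1 := h3
    have hA0 : 0 ≤ A := integral_nonneg fun x => by
      simpa using Real.cos_le_one (z * x)
    have h6 : 0 ≤ z ^ 2 * V := by positivity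
    nlinarith
  have hcov : AECover ν atTop fun n : ℕ => Set.Icc (-(n : ℝ)) n :=
    aecover_Icc (tendsto_neg_atTop_atBot.comp tendsto_natCast_atTop_atTop)
      tendsto_natCast_atTop_atTop
  refine hcov.integrable_of_lintegral_enorm_bounded (V * Real.pi ^ 2 / 2)
    (by fun_prop) ?_
  have hev : ∀ᶠ n : ℕ in atTop, 1 ≤ n ∧ Real.pi ^ 2 * V ≤ n := by
    exact (eventually_ge_atTop 1).and
      (tendsto_natCast_atTop_atTop.eventually_ge_atTop (Real.pi ^ 2 * V))
  filter_upwards [hev] with n hn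
  have hn0 : (1 : ℝ) ≤ n := by exact_mod_cast hn.1
  -- The choice `z = π/n` keeps `|zx| ≤ π` for `|x| ≤ n`, where `1 - cos(zx) ≥ (2/π²)(zx)²`. The
  -- factor `z²` then cancels against `key`, leaving a bound independent of `n`.
  set z : ℝ := Real.pi / n with hz
  have hzV : z ^ 2 * V ≤ 1 := by
    rw [hz, div_pow, div_mul_eq_mul_div, div_le_one (by positivity)]
    nlinarith [hn.2]
  have hi := h.integrable_one_sub_cos z
  have hz0 : 0 < z := by positivity
  calc ∫⁻ x in Set.Icc (-(n : ℝ)) n, ‖x ^ 2‖ₑ ∂ν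
      ≤ ∫⁻ x in Set.Icc (-(n : ℝ)) n,
          ENNReal.ofReal (Real.pi ^ 2 / 2 / z ^ 2 * (1 - Real.cos (z * x))) ∂ν := by
        refine setLIntegral_mono (by fun_prop) fun x hx => ?_
        rw [Real.enorm_eq_ofReal (sq_nonneg x)]
        apply ENNReal.ofReal_le_ofReal
        have habs : |z * x| ≤ Real.pi := by
          rw [abs_mul, abs_of_pos hz0, hz, div_mul_eq_mul_div, div_le_iff₀ (by positivity)]
          exact mul_le_mul_of_nonneg_left (abs_le.2 hx) Real.pi_pos.le
        have := Real.cos_le_one_sub_mul_cos_sq habs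
        have h7 : Real.pi ^ 2 / 2 / z ^ 2 * (2 / Real.pi ^ 2 * (z * x) ^ 2) = x ^ 2 := by
          field_simp
        rw [← h7]
        gcongr
        linarith
    _ ≤ ∫⁻ x, ENNReal.ofReal (Real.pi ^ 2 / 2 / z ^ 2 * (1 - Real.cos (z * x))) ∂ν :=
        setLIntegral_le_lintegral _ _
    _ = ENNReal.ofReal (∫ x, Real.pi ^ 2 / 2 / z ^ 2 * (1 - Real.cos (z * x)) ∂ν) := by
        rw [ofReal_integral_eq_lintegral_ofReal (hi.const_mul _) (ae_of_all _ fun x => ?_)]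
        have := Real.cos_le_one (z * x)
        have : 0 ≤ 1 - Real.cos (z * x) := by linarith
        positivity
    _ ≤ ENNReal.ofReal (V * Real.pi ^ 2 / 2) := by
        apply ENNReal.ofReal_le_ofReal
        rw [integral_const_mul]
        calc _ ≤ Real.pi ^ 2 / 2 / z ^ 2 * (z ^ 2 * V) := by gcongr; exact key z hzV
          _ = _ := by field_simp

/-- If the variance vanished, the characteristic function at `1` would have modulus at least one, so
`∫ (1 - cos x) ρ(x) dx = 0`; but the integrand is positive on `(0, 1)`. -/
lemma HasGeneratingTriple.variance_pos {ρ : ℝ → ℝ} (hρ : IsPositiveLevyDensity ρ)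
    (h : HasGeneratingTriple P X (fun _ => c) b 0 (densityMeasure ρ))
    (hX : MemLp (X 1) 2 P) (hmean : ∫ ω, X 1 ω ∂P = 0) : 0 < Var[X 1; P] := by
  refine lt_of_le_of_ne (ProbabilityTheory.variance_nonneg _ _) fun h0 => ?_
  have hXm := hX.aestronglyMeasurable.aemeasurable
  have hE : ∫ ω, X 1 ω ^ 2 ∂P = 0 := by
    rw [variance_of_integral_eq_zero hXm hmean] at h0
    exact h0.symm
  have h1 := one_sub_re_charFun_le hX 1
  have h2 := Complex.re_le_norm (charFun (P.map (X 1)) 1)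
  rw [h.norm_charFun 1] at h2
  rw [hE] at h1
  have h3 : ∫ x, (1 - Real.cos (1 * x)) ∂densityMeasure ρ ≤ 0 := by
    have h3 := h1.trans h2
    rw [mul_zero, sub_zero, Real.one_le_exp_iff] at h3
    linarith
  have hnn : 0 ≤ fun x => 1 - Real.cos (1 * x) := fun x => by
    simpa using Real.cos_le_one x
  have h4 := (integral_eq_zero_iff_of_nonneg hnn (h.integrable_one_sub_cos 1)).1
    (le_antisymm h3 (integral_nonneg hnn))
  have hm : Measurable fun x => ENNReal.ofReal (ρ x) := hρ.measurable.ennreal_ofReal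
  have h5 := (ae_withDensity_iff hm).1 h4
  have h6 : ∀ᵐ x ∂(volume : Measure ℝ), x ∉ Set.Ioo (0 : ℝ) 1 := by
    filter_upwards [h5] with x hx hx'
    have hc := hx (by simpa using hρ.pos x hx'.1)
    have hlt := Real.cos_lt_cos_of_nonneg_of_le_pi le_rfl
      (by linarith [Real.pi_gt_three, hx'.2]) hx'.1
    rw [Real.cos_zero] at hlt
    simp at hc
    linarith
  have h7 : (volume : Measure ℝ) (Set.Ioo (0 : ℝ) 1) = 0 := by
    have := measure_eq_zero_iff_ae_notMem.2 h6
    exact this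
  simp at h7

end Levy

/-! ### Riemann sums along right end points -/

/-- The mesh width `T / (n + 1)`. -/
noncomputable def mesh (T : ℝ) (n : ℕ) : ℝ := T / (n + 1)

/-- The right end point of the cell of the grid of mesh `T / (n + 1)` that contains `t`. -/
noncomputable def rightGrid (T : ℝ) (n : ℕ) (t : ℝ) : ℝ := ⌈t / mesh T n⌉₊ * mesh T n

lemma mesh_pos {T : ℝ} (hT : 0 < T) (n : ℕ) : 0 < mesh T n := by
  unfold mesh; positivity

lemma succ_mul_mesh (T : ℝ) (n : ℕ) : ((n + 1 : ℕ) : ℝ) * mesh T n = T := by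
  unfold mesh; push_cast; field_simp

lemma tendsto_mesh (T : ℝ) : Tendsto (mesh T) atTop (𝓝 0) :=
  tendsto_const_div_atTop_nhds_zero_nat T |>.comp (tendsto_add_atTop_nat 1) |>.congr fun n => by
    simp [mesh]

lemma le_rightGrid {T : ℝ} (hT : 0 < T) (n : ℕ) (t : ℝ) : t ≤ rightGrid T n t := by
  unfold rightGrid
  rw [← div_le_iff₀ (mesh_pos hT n)]
  exact Nat.le_ceil _

lemma rightGrid_le_add {T : ℝ} (hT : 0 < T) (n : ℕ) {t : ℝ} (ht : 0 ≤ t) :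
    rightGrid T n t ≤ t + mesh T n := by
  have h := (Nat.ceil_lt_add_one (div_nonneg ht (mesh_pos hT n).le)).le
  have := mul_le_mul_of_nonneg_right h (mesh_pos hT n).le
  rwa [add_mul, one_mul, div_mul_cancel₀ _ (mesh_pos hT n).ne'] at this

lemma rightGrid_le {T : ℝ} (hT : 0 < T) (n : ℕ) {t : ℝ} (ht : t ≤ T) : rightGrid T n t ≤ T := by
  have h : ⌈t / mesh T n⌉₊ ≤ n + 1 := by
    rw [Nat.ceil_le, div_le_iff₀ (mesh_pos hT n), succ_mul_mesh]; exact ht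
  calc rightGrid T n t ≤ ((n + 1 : ℕ) : ℝ) * mesh T n := by
        unfold rightGrid
        have := (mesh_pos hT n).le
        gcongr
    _ = T := succ_mul_mesh T n

lemma rightGrid_eq {T : ℝ} (hT : 0 < T) (n j : ℕ) {t : ℝ}
    (ht : t ∈ Set.Ioc (j * mesh T n) ((j + 1 : ℕ) * mesh T n)) :
    rightGrid T n t = (j + 1 : ℕ) * mesh T n := by
  unfold rightGrid
  rw [(Nat.ceil_eq_iff (Nat.succ_ne_zero j)).2]
  refine ⟨?_, ?_⟩
  · rw [lt_div_iff₀ (mesh_pos hT n)]; exact ht.1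
  · rw [div_le_iff₀ (mesh_pos hT n)]; exact ht.2

lemma tendsto_rightGrid {T : ℝ} (hT : 0 < T) {t : ℝ} (ht : 0 ≤ t) :
    Tendsto (fun n => rightGrid T n t) atTop (𝓝[≥] t) := by
  refine tendsto_nhdsWithin_iff.2 ⟨?_, Eventually.of_forall fun n => le_rightGrid hT n t⟩
  refine tendsto_of_tendsto_of_tendsto_of_le_of_le tendsto_const_nhds (?_ : Tendsto _ _ (𝓝 t))
    (fun n => le_rightGrid hT n t) (fun n => rightGrid_le_add hT n ht)
  simpa using (tendsto_mesh T).const_add t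

lemma integral_rightGrid {E : Type*} [NormedAddCommGroup E] [NormedSpace ℝ E] {T : ℝ}
    (hT : 0 < T) (n : ℕ) (F : ℝ → ℝ → E) (hF : ∀ s, Continuous (F s)) :
    ∫ t in 0..T, F (rightGrid T n t) t
      = ∑ j ∈ Finset.range (n + 1), ∫ t in (j * mesh T n)..((j + 1 : ℕ) * mesh T n),
          F ((j + 1 : ℕ) * mesh T n) t := by
  have hle : ∀ j : ℕ, j * mesh T n ≤ (j + 1 : ℕ) * mesh T n := fun j => by
    have := (mesh_pos hT n).le
    gcongr; omega
  have hcongr : ∀ j : ℕ, Set.EqOn (fun t => F ((j + 1 : ℕ) * mesh T n) t)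
      (fun t => F (rightGrid T n t) t)
      (Set.uIoc (j * mesh T n) ((j + 1 : ℕ) * mesh T n)) := by
    intro j t ht
    rw [Set.uIoc_of_le (hle j)] at ht
    simp only [rightGrid_eq hT n j ht]
  have h := intervalIntegral.sum_integral_adjacent_intervals (μ := volume)
    (f := fun t => F (rightGrid T n t) t) (a := fun j : ℕ => j * mesh T n) (n := n + 1)
    (fun j _ => ((hF _).intervalIntegrable _ _).congr (hcongr j))
  simp only [succ_mul_mesh, Nat.cast_zero, zero_mul] at h
  rw [← h]
  exact Finset.sum_congr rfl fun j _ =>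
    intervalIntegral.integral_congr_ae (ae_of_all _ fun t ht => (hcongr j ht).symm)

/-- `F` may be arbitrary, for instance a sample path, because the grid has only countably many
points. -/
lemma measurable_comp_rightGrid {E : Type*} [MeasurableSpace E] (T : ℝ) (n : ℕ) (F : ℝ → E) :
    Measurable fun t => F (rightGrid T n t) := by
  have : (fun t => F (rightGrid T n t))
      = (fun j : ℕ => F (j * mesh T n)) ∘ (fun t => ⌈t / mesh T n⌉₊) := rfl
  rw [this]
  exact (measurable_from_nat).comp (Nat.measurable_ceil.comp (by fun_prop))

/-- Left Riemann sums of continuous functions converge. -/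
lemma tendsto_riemannSum {T : ℝ} (hT : 0 < T) {G : ℝ → ℂ} (hG : Continuous G) :
    Tendsto (fun n : ℕ => (mesh T n : ℂ) * ∑ j ∈ Finset.range (n + 1), G (j * mesh T n)) atTop
      (𝓝 (∫ t in 0..T, G t)) := by
  -- Left end points are right end points shifted back by one mesh width.
  have e : ∀ n : ℕ, (mesh T n : ℂ) * ∑ j ∈ Finset.range (n + 1), G (j * mesh T n)
      = ∫ t in 0..T, G (rightGrid T n t - mesh T n) := by
    intro n
    rw [integral_rightGrid hT n (fun s _ => G (s - mesh T n)) (fun s => continuous_const),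
      Finset.mul_sum]
    refine Finset.sum_congr rfl fun j _ => ?_
    rw [intervalIntegral.integral_const]
    push_cast
    rw [show (j + 1) * mesh T n - mesh T n = j * mesh T n by ring,
      show (j + 1) * mesh T n - j * mesh T n = mesh T n by ring, Complex.real_smul]
  simp_rw [e]
  obtain ⟨C, hC⟩ := (isCompact_Icc (a := -T) (b := T)).exists_bound_of_continuousOn hG.continuousOn
  refine intervalIntegral.tendsto_integral_filter_of_dominated_convergence (fun _ => C) ?_ ?_ ?_ ?_
  · exact Eventually.of_forall fun n =>
      (measurable_comp_rightGrid T n fun s => G (s - mesh T n)).aestronglyMeasurable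
  · refine Eventually.of_forall fun n => ae_of_all _ fun t ht => ?_
    rw [Set.uIoc_of_le hT.le] at ht
    refine hC _ ⟨?_, ?_⟩
    · have h1 := le_rightGrid hT n t
      have h2 : mesh T n ≤ T := by
        unfold mesh
        exact div_le_self hT.le (by have : (0:ℝ) ≤ n := n.cast_nonneg
                                    linarith)
      linarith [ht.1]
    · have := rightGrid_le hT n ht.2
      linarith [mesh_pos hT n]
  · simp
  · refine ae_of_all _ fun t ht => ?_
    rw [Set.uIoc_of_le hT.le] at ht
    have h1 := (tendsto_rightGrid hT ht.1.le).mono_right nhdsWithin_le_nhds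
    have h2 := h1.sub (tendsto_mesh T)
    rw [sub_zero] at h2
    exact (hG.tendsto t).comp h2

/-! ### Integrals of càdlàg paths -/

/-- The right and left limits at `t` bound the path on a neighbourhood of `t`; compactness does the
rest. -/
lemma exists_bound_of_cadlag {x : ℝ≥0 → ℝ}
    (hx : ∀ t, ContinuousWithinAt x (Set.Ici t) t ∧ ∃ l : ℝ, Tendsto x (𝓝[<] t) (𝓝 l)) (T : ℝ≥0) :
    ∃ C, ∀ t ≤ T, ‖x t‖ ≤ C := by
  have hb : Bornology.IsBounded (x '' Set.Icc 0 T) := by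
    refine isCompact_Icc.induction_on (p := fun s => Bornology.IsBounded (x '' s)) (by simp)
      (fun s t hst ht => ht.subset (Set.image_mono hst))
      (fun s t hs ht => by rw [Set.image_union]; exact hs.union ht) (fun t _ => ?_)
    obtain ⟨h1, l, h2⟩ := hx t
    have h3 := h1 (Metric.ball_mem_nhds (x t) one_pos)
    have h4 := h2 (Metric.ball_mem_nhds l one_pos)
    have h5 : x ⁻¹' (Metric.ball l 1) ∪ x ⁻¹' (Metric.ball (x t) 1) ∈ 𝓝 t := by
      rw [← nhdsLT_sup_nhdsGE]
      exact Filter.union_mem_sup h4 h3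
    refine ⟨_, mem_nhdsWithin_of_mem_nhds h5, ?_⟩
    refine (Metric.isBounded_ball.union Metric.isBounded_ball).subset
      (t := Metric.ball l 1 ∪ Metric.ball (x t) 1) ?_
    rintro _ ⟨s, hs, rfl⟩
    exact hs
  obtain ⟨C, hC⟩ := hb.exists_norm_le
  exact ⟨C, fun t ht => hC _ ⟨t, ⟨zero_le, ht⟩, rfl⟩⟩

/-- Right end points approach `t` from the right, where the path is continuous; the bound on `[0,
T]` gives domination. -/
lemma tendsto_integral_cadlag {x : ℝ≥0 → ℝ}
    (hx : ∀ t, ContinuousWithinAt x (Set.Ici t) t ∧ ∃ l : ℝ, Tendsto x (𝓝[<] t) (𝓝 l))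
    {T : ℝ} (hT : 0 < T) {φ : ℝ → ℝ} (hφ : Continuous φ) :
    Tendsto (fun n => ∫ t in 0..T, x (rightGrid T n t).toNNReal * φ t) atTop
      (𝓝 (∫ t in 0..T, x t.toNNReal * φ t)) := by
  obtain ⟨C, hC⟩ := exists_bound_of_cadlag hx T.toNNReal
  refine intervalIntegral.tendsto_integral_filter_of_dominated_convergence
    (fun t => C * ‖φ t‖) ?_ ?_ ?_ ?_
  · exact Eventually.of_forall fun n =>
      ((measurable_comp_rightGrid T n fun s => x s.toNNReal).mul
        hφ.measurable).aestronglyMeasurable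
  · refine Eventually.of_forall fun n => ae_of_all _ fun t ht => ?_
    rw [Set.uIoc_of_le hT.le] at ht
    rw [norm_mul]
    gcongr
    exact hC _ (Real.toNNReal_le_toNNReal (rightGrid_le hT n ht.2))
  · exact (by fun_prop : Continuous fun t => C * ‖φ t‖).intervalIntegrable _ _
  · refine ae_of_all _ fun t ht => ?_
    rw [Set.uIoc_of_le hT.le] at ht
    refine Tendsto.mul_const _ ?_
    have h1 : Tendsto (fun n => (rightGrid T n t).toNNReal) atTop (𝓝[≥] t.toNNReal) := by
      refine tendsto_nhdsWithin_iff.2 ⟨?_, Eventually.of_forall fun n =>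
        Real.toNNReal_le_toNNReal (le_rightGrid hT n t)⟩
      exact (continuous_real_toNNReal.tendsto t).comp
        ((tendsto_rightGrid hT ht.1.le).mono_right nhdsWithin_le_nhds)
    exact (hx t.toNNReal).1.tendsto.comp h1

/-- Summation by parts: it trades values of the path for its increments, which are independent. -/
lemma Finset.sum_range_mul_sub_eq {x Φ : ℕ → ℝ} (N : ℕ) :
    ∑ j ∈ Finset.range N, x (j + 1) * (Φ j - Φ (j + 1))
      = ∑ j ∈ Finset.range N, Φ j * (x (j + 1) - x j) + x 0 * Φ 0 - x N * Φ N := by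
  induction N with
  | zero => simp
  | succ N ih => rw [Finset.sum_range_succ, Finset.sum_range_succ, ih]; ring

lemma integral_rightGrid_path {Ω : Type*} {X : ℝ≥0 → Ω → ℝ} {T : ℝ} (hT : 0 < T) {φ : ℝ → ℝ} (hφ : Continuous φ) (n : ℕ)
    (ω : Ω) :
    ∫ t in 0..T, X (rightGrid T n t).toNNReal ω * φ t
      = ∑ j ∈ Finset.range (n + 1), X ((j + 1 : ℕ) * mesh T n).toNNReal ω
          * ∫ t in (j * mesh T n)..((j + 1 : ℕ) * mesh T n), φ t := by
  rw [integral_rightGrid hT n (fun s t => X s.toNNReal ω * φ t) (fun s => by fun_prop)]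
  simp_rw [intervalIntegral.integral_const_mul]

section Levy

variable {Ω : Type*} [MeasurableSpace Ω] {P : Measure Ω}
  {X : ℝ≥0 → Ω → ℝ}

lemma IsLevyProcess.tendsto_integral_rightGrid (hX : IsLevyProcess P X) {T : ℝ} (hT : 0 < T)
    {φ : ℝ → ℝ} (hφ : Continuous φ) :
    ∀ᵐ ω ∂P, Tendsto (fun n => ∫ t in 0..T, X (rightGrid T n t).toNNReal ω * φ t) atTop
      (𝓝 (∫ t in 0..T, X t.toNNReal ω * φ t)) := by
  filter_upwards [hX.cadlag] with ω hω
  exact tendsto_integral_cadlag (x := fun t => X t ω) hω hT hφ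

lemma IsLevyProcess.measurable_integral_rightGrid (hX : IsLevyProcess P X) {T : ℝ} (hT : 0 < T)
    {φ : ℝ → ℝ} (hφ : Continuous φ) (n : ℕ) :
    Measurable fun ω => ∫ t in 0..T, X (rightGrid T n t).toNNReal ω * φ t := by
  simp_rw [integral_rightGrid_path hT hφ n]
  exact Finset.measurable_fun_sum _ fun j _ => (hX.measurable _).mul_const _

lemma IsLevyProcess.aemeasurable_integral (hX : IsLevyProcess P X) {T : ℝ} (hT : 0 < T)
    {φ : ℝ → ℝ} (hφ : Continuous φ) :
    AEMeasurable (fun ω => ∫ t in 0..T, X t.toNNReal ω * φ t) P :=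
  aemeasurable_of_tendsto_metrizable_ae atTop
    (fun n => (hX.measurable_integral_rightGrid hT hφ n).aemeasurable)
    (hX.tendsto_integral_rightGrid hT hφ)

variable {Ψ : ℝ → ℂ}

lemma IsLevyProcess.integral_exp_sum_increments (hX : IsLevyProcess P X)
    (hΨ : ∀ (t : ℝ≥0) (z : ℝ), charFun (P.map (X t)) z = Complex.exp (-((t : ℝ) : ℂ) * Ψ z))
    (δ : ℝ≥0) (c : ℕ → ℝ) (N : ℕ) :
    ∫ ω, Complex.exp (((∑ j ∈ Finset.range N, c j * (X ((j + 1 : ℕ) * δ) ω - X (j * δ) ω) : ℝ) : ℂ)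
        * Complex.I) ∂P
      = Complex.exp (-((δ : ℝ) : ℂ) * ∑ j ∈ Finset.range N, Ψ (c j)) := by
  have hmono : Monotone fun j : ℕ => (j : ℝ≥0) * δ := fun a b hab => by
    simp only; gcongr
  have hind := (hX.indep.nat hmono).comp (fun j x => c j * x) (fun j => by fun_prop)
  have hm : ∀ j, Measurable ((fun x => c j * x) ∘ fun ω => X ((j + 1 : ℕ) * δ) ω - X (j * δ) ω) :=
    fun j => ((hX.measurable _).sub (hX.measurable _)).const_mul _
  have h := congrFun (iIndepFun.charFun_map_fun_finsetSum_eq_prod (s := Finset.range N)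
    (X := fun j => (fun x => c j * x) ∘ fun ω => X ((j + 1 : ℕ) * δ) ω - X (j * δ) ω)
    (fun j _ => (hm j).aemeasurable) (hind.restrict _)) 1
  rw [charFun_apply_real, integral_map
    (Finset.measurable_fun_sum _ fun j _ => hm j).aemeasurable (by fun_prop)] at h
  simp only [Complex.ofReal_one, one_mul, Function.comp_apply] at h
  rw [h, Finset.prod_apply, Finset.mul_sum, Complex.exp_sum]
  refine Finset.prod_congr rfl fun j _ => ?_
  rw [← hΨ]
  have hst := (hX.stationary (j * δ) δ).map_eq
  have e : (j : ℝ≥0) * δ + δ = (j + 1 : ℕ) * δ := by push_cast; ring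
  rw [e] at hst
  rw [← hst]
  change charFun (P.map (fun ω => c j * (X ((j + 1 : ℕ) * δ) ω - X (j * δ) ω))) 1 = _
  have hY : AEMeasurable (fun ω => X ((j + 1 : ℕ) * δ) ω - X (j * δ) ω) P :=
    ((hX.measurable _).sub (hX.measurable _)).aemeasurable
  rw [charFun_map_mul_comp hY, mul_one]

/-- The characteristic function of the path integral of a Lévy process against a continuous
weight with vanishing primitive at the end point. -/
lemma IsLevyProcess.integral_exp_integral [IsProbabilityMeasure P] (hX : IsLevyProcess P X)
    (hΨ : ∀ (t : ℝ≥0) (z : ℝ), charFun (P.map (X t)) z = Complex.exp (-((t : ℝ) : ℂ) * Ψ z))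
    (hΨc : Continuous Ψ) {T : ℝ} (hT : 0 < T) {φ Φ : ℝ → ℝ} (hφ : Continuous φ)
    (hΦ : ∀ t, HasDerivAt Φ (-φ t) t) (hΦT : Φ T = 0) :
    ∫ ω, Complex.exp (((∫ t in 0..T, X t.toNNReal ω * φ t : ℝ) : ℂ) * Complex.I) ∂P
      = Complex.exp (-∫ t in 0..T, Ψ (Φ t)) := by
  have hΦc : Continuous Φ := continuous_iff_continuousAt.2 fun t => (hΦ t).continuousAt
  have hlim : Tendsto (fun n => ∫ ω, Complex.exp (((∫ t in 0..T,
      X (rightGrid T n t).toNNReal ω * φ t : ℝ) : ℂ) * Complex.I) ∂P) atTop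
      (𝓝 (∫ ω, Complex.exp (((∫ t in 0..T, X t.toNNReal ω * φ t : ℝ) : ℂ) * Complex.I) ∂P)) := by
    refine tendsto_integral_of_dominated_convergence (fun _ => 1) (fun n => ?_)
      (integrable_const _) (fun n => ae_of_all _ fun ω => ?_) ?_
    · exact (by fun_prop : Measurable fun y : ℝ => Complex.exp (y * Complex.I)).comp
        (hX.measurable_integral_rightGrid hT hφ n) |>.aestronglyMeasurable
    · rw [Complex.norm_exp_ofReal_mul_I]
    · filter_upwards [hX.tendsto_integral_rightGrid hT hφ] with ω hω
      exact ((by fun_prop : Continuous fun y : ℝ => Complex.exp (y * Complex.I)).tendsto _).comp hω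
  refine tendsto_nhds_unique hlim ?_
  have hpath : ∀ n, ∀ᵐ ω ∂P, ∫ t in 0..T, X (rightGrid T n t).toNNReal ω * φ t
      = ∑ j ∈ Finset.range (n + 1), Φ (j * mesh T n)
        * (X ((j + 1 : ℕ) * (mesh T n).toNNReal) ω - X (j * (mesh T n).toNNReal) ω) := by
    intro n
    filter_upwards [hX.zero] with ω hω
    rw [integral_rightGrid_path hT hφ]
    have hint : ∀ a b, ∫ t in a..b, φ t = Φ a - Φ b := by
      intro a b
      have := intervalIntegral.integral_eq_sub_of_hasDerivAt (a := a) (b := b)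
        (f := fun t => -Φ t) (f' := φ) (fun t _ => by simpa using (hΦ t).fun_neg)
        (hφ.intervalIntegrable _ _)
      rw [this]; ring
    have hcast : ∀ j : ℕ, (j * mesh T n).toNNReal = j * (mesh T n).toNNReal := fun j => by
      rw [Real.toNNReal_mul (Nat.cast_nonneg j), Real.toNNReal_natCast]
    simp_rw [hint, hcast]
    have := Finset.sum_range_mul_sub_eq (x := fun j => X (j * (mesh T n).toNNReal) ω)
      (Φ := fun j => Φ (j * mesh T n)) (n + 1)
    -- Both boundary terms vanish: `Φ(T) = 0` at the end, and `X_0 = 0` almost surely at the start.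
    rw [this, succ_mul_mesh, hΦT]
    simp [hω]
  have e : ∀ n, ∫ ω, Complex.exp (((∫ t in 0..T,
      X (rightGrid T n t).toNNReal ω * φ t : ℝ) : ℂ) * Complex.I) ∂P
      = Complex.exp (-((mesh T n : ℂ)
        * ∑ j ∈ Finset.range (n + 1), Ψ (Φ (j * mesh T n)))) := by
    intro n
    rw [integral_congr_ae (g := fun ω => Complex.exp (((∑ j ∈ Finset.range (n + 1),
      Φ (j * mesh T n) * (X ((j + 1 : ℕ) * (mesh T n).toNNReal) ω
        - X (j * (mesh T n).toNNReal) ω) : ℝ) : ℂ) * Complex.I))]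
    · rw [hX.integral_exp_sum_increments hΨ, Real.coe_toNNReal _ (mesh_pos hT n).le, neg_mul]
    · filter_upwards [hpath n] with ω hω
      rw [hω]
  simp_rw [e]
  exact (Complex.continuous_exp.tendsto _).comp
    (tendsto_riemannSum hT (G := fun t => Ψ (Φ t)) (hΨc.comp hΦc)).neg

end Levy

/-! ### The tail integral and its inverse -/

section Tail

variable {ρ : ℝ → ℝ}

lemma densityMeasure_Ioi (ρ : ℝ → ℝ) (x : ℝ) :
    densityMeasure ρ (Set.Ioi x) = tailIntegral ρ x := by
  unfold densityMeasure tailIntegral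
  exact withDensity_apply _ measurableSet_Ioi

lemma densityMeasure_Ici (ρ : ℝ → ℝ) (x : ℝ) :
    densityMeasure ρ (Set.Ici x) = tailIntegral ρ x := by
  unfold densityMeasure tailIntegral
  rw [withDensity_apply _ measurableSet_Ici, setLIntegral_congr Ioi_ae_eq_Ici]

lemma IsPositiveLevyDensity.tailIntegral_lt_top (hρ : IsPositiveLevyDensity ρ) {x : ℝ}
    (hx : 0 < x) : tailIntegral ρ x < ∞ := by
  rw [← densityMeasure_Ioi]
  have hpos : 0 < min 1 (x ^ 2) := lt_min one_pos (by positivity)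
  refine (measure_mono fun y hy => ?_).trans_lt (meas_ge_le_lintegral_div
    (f := fun x => ENNReal.ofReal (min 1 (x ^ 2))) (by fun_prop)
    (ε := ENNReal.ofReal (min 1 (x ^ 2))) (by simpa using hx.ne') ENNReal.ofReal_ne_top
      |>.trans_lt ?_)
  · have : x < y := hy
    change ENNReal.ofReal (min 1 (x ^ 2)) ≤ ENNReal.ofReal (min 1 (y ^ 2))
    gcongr
  · exact ENNReal.div_lt_top hρ.levyMeasure.lintegral_lt_top.ne (by simpa using hx.ne')

lemma tailIntegral_antitone (ρ : ℝ → ℝ) : Antitone (tailIntegral ρ) := fun _ _ h =>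
  lintegral_mono_set (Set.Ioi_subset_Ioi h)

/-- The mass on `(x, x']` is positive and the tail beyond `x'` is finite. The case `x = 0` is
included even if `g(0) = ∞`, since only the smaller value must be finite. -/
lemma IsPositiveLevyDensity.tailIntegral_lt (hρ : IsPositiveLevyDensity ρ) {x x' : ℝ}
    (hx : 0 ≤ x) (hxx : x < x') : tailIntegral ρ x' < tailIntegral ρ x := by
  have h1 : tailIntegral ρ x = (∫⁻ s in Set.Ioc x x', ENNReal.ofReal (ρ s)) + tailIntegral ρ x' := by
    unfold tailIntegral
    rw [← lintegral_union measurableSet_Ioi (Set.Ioc_disjoint_Ioi le_rfl),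
      Set.Ioc_union_Ioi_eq_Ioi hxx.le]
  have h2 : 0 < ∫⁻ s in Set.Ioc x x', ENNReal.ofReal (ρ s) := by
    rw [setLIntegral_pos_iff hρ.measurable.ennreal_ofReal]
    have : (Function.support fun s => ENNReal.ofReal (ρ s)) ∩ Set.Ioc x x' = Set.Ioc x x' :=
      Set.inter_eq_right.2 fun s hs => by simpa using hρ.pos s (hx.trans_lt hs.1)
    rw [this]
    simpa using hxx
  rw [h1, add_comm]
  exact ENNReal.lt_add_right (hρ.tailIntegral_lt_top (hx.trans_lt hxx)).ne h2.ne'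

lemma tendsto_tailIntegral_nhdsGT (ρ : ℝ → ℝ) :
    Tendsto (fun n : ℕ => tailIntegral ρ (1 / ((n : ℝ) + 1))) atTop (𝓝 (tailIntegral ρ 0)) := by
  simp_rw [← densityMeasure_Ioi]
  have : Set.Ioi (0 : ℝ) = ⋃ n : ℕ, Set.Ioi (1 / ((n : ℝ) + 1)) := by
    ext x
    simp only [Set.mem_Ioi, Set.mem_iUnion]
    exact ⟨fun h => exists_nat_one_div_lt h, fun ⟨n, hn⟩ => lt_trans (by positivity) hn⟩
  rw [this]
  refine tendsto_measure_iUnion_atTop fun m n hmn => Set.Ioi_subset_Ioi ?_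
  gcongr

lemma IsPositiveLevyDensity.tendsto_tailIntegral_atTop (hρ : IsPositiveLevyDensity ρ) :
    Tendsto (fun n : ℕ => tailIntegral ρ ((n : ℝ) + 1)) atTop (𝓝 0) := by
  simp_rw [← densityMeasure_Ioi]
  have : (∅ : Set ℝ) = ⋂ n : ℕ, Set.Ioi ((n : ℝ) + 1) := by
    ext x
    simp only [Set.mem_empty_iff_false, Set.mem_iInter, Set.mem_Ioi, false_iff, not_forall, not_lt]
    obtain ⟨n, hn⟩ := exists_nat_ge x
    exact ⟨n, by linarith⟩
  rw [← measure_empty (μ := densityMeasure ρ), this]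
  refine tendsto_measure_iInter_atTop (fun n => measurableSet_Ioi.nullMeasurableSet)
    (fun m n hmn => Set.Ioi_subset_Ioi ?_) ⟨0, ?_⟩
  · gcongr
  · rw [densityMeasure_Ioi]
    exact (hρ.tailIntegral_lt_top (by positivity)).ne

/-- Intermediate value theorem between a point near `0`, where the tail exceeds `q`, and a remote
point, where it is below `q`. On this interval the tail is finite and continuous, being a constant
minus a primitive. -/
lemma IsPositiveLevyDensity.exists_tailIntegral_eq (hρ : IsPositiveLevyDensity ρ) {q : ℝ}
    (hq : 0 < q) (hq' : ENNReal.ofReal q < tailIntegral ρ 0) :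
    ∃ x ∈ Set.Ioi (0 : ℝ), tailIntegral ρ x = ENNReal.ofReal q := by
  obtain ⟨n, hn⟩ := ((tendsto_tailIntegral_nhdsGT ρ).eventually (lt_mem_nhds hq')).exists
  obtain ⟨m, hm⟩ := (hρ.tendsto_tailIntegral_atTop.eventually
    (gt_mem_nhds (ENNReal.ofReal_pos.2 hq))).exists
  set a : ℝ := 1 / ((n : ℝ) + 1) with ha
  set b : ℝ := (m : ℝ) + 1 with hb
  have ha0 : 0 < a := by positivity
  have hab : a ≤ b := by
    by_contra h
    exact absurd (hm.trans hn) (not_lt.2 (tailIntegral_antitone ρ (not_le.1 h).le))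
  have hint : IntegrableOn ρ (Set.Ioi a) := by
    refine ⟨hρ.measurable.aestronglyMeasurable, ?_⟩
    refine lt_of_eq_of_lt ?_ (hρ.tailIntegral_lt_top ha0)
    refine setLIntegral_congr_fun measurableSet_Ioi fun s hs => ?_
    exact Real.enorm_eq_ofReal (hρ.pos s (ha0.trans hs)).le
  have hF : ∀ x ∈ Set.Icc a b, (tailIntegral ρ x).toReal
      = (tailIntegral ρ a).toReal - ∫ s in a..x, ρ s := by
    intro x hx
    have h1 : ∀ z, a ≤ z → (tailIntegral ρ z).toReal = ∫ s in Set.Ioi z, ρ s := by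
      intro z hz
      rw [integral_eq_lintegral_of_nonneg_ae]
      · rfl
      · filter_upwards [ae_restrict_mem measurableSet_Ioi] with s hs
        exact (hρ.pos s (ha0.trans_le (hz.trans (le_of_lt hs)))).le
      · exact hρ.measurable.aestronglyMeasurable
    rw [h1 a le_rfl, h1 x hx.1, ← intervalIntegral.integral_Ioi_sub_Ioi hint hx.1]
    ring
  have hcont : ContinuousOn (fun x => (tailIntegral ρ x).toReal) (Set.Icc a b) := by
    refine ContinuousOn.congr ?_ hF
    refine continuousOn_const.sub ?_
    have := intervalIntegral.continuousOn_primitive_interval (μ := volume) (a := a) (b := b)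
      (f := ρ) ((integrableOn_Icc_iff_integrableOn_Ioc).2 (hint.mono_set Set.Ioc_subset_Ioi_self)
        |>.mono_set (by rw [Set.uIcc_of_le hab]))
    rwa [Set.uIcc_of_le hab] at this
  have hfin : ∀ x, a ≤ x → tailIntegral ρ x ≠ ∞ := fun x hx =>
    (hρ.tailIntegral_lt_top (ha0.trans_le hx)).ne
  have hmem : q ∈ Set.Icc (tailIntegral ρ b).toReal (tailIntegral ρ a).toReal := by
    constructor
    · exact ENNReal.toReal_le_of_le_ofReal hq.le hm.le
    · exact (ENNReal.ofReal_le_iff_le_toReal (hfin a le_rfl)).1 hn.le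
  obtain ⟨x, hx, hxq⟩ := intermediate_value_Icc' hab hcont hmem
  refine ⟨x, ha0.trans_le hx.1, ?_⟩
  rw [← hxq, ENNReal.ofReal_toReal (hfin x hx.1)]

end Tail

/-! ### The jump sizes as a function of the arrival times -/

open Classical in
/-- The jump size `g⁻¹(r / T) 𝟙(0 < r < T g(0))`. -/
noncomputable def jumpSize (ρ : ℝ → ℝ) (T r : ℝ) : ℝ :=
  if 0 < r ∧ ENNReal.ofReal r < ENNReal.ofReal T * tailIntegral ρ 0
    then tailInverse ρ (r / T) else 0

section JumpSize

variable {ρ : ℝ → ℝ} {T : ℝ}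

lemma jumpSize_of_nonpos (ρ : ℝ → ℝ) (T : ℝ) {r : ℝ} (hr : r ≤ 0) : jumpSize ρ T r = 0 :=
  if_neg fun h => absurd h.1 (not_lt.2 hr)

/-- The working description of the inverse: either the equation `T g(x) = r` is solved, or `r` has
passed `T g(0)` and the jump is zero. -/
lemma jumpSize_spec (hρ : IsPositiveLevyDensity ρ) (hT : 0 < T) {r : ℝ} (hr : 0 < r) :
    (0 < jumpSize ρ T r ∧ ENNReal.ofReal T * tailIntegral ρ (jumpSize ρ T r) = ENNReal.ofReal r)
    ∨ (jumpSize ρ T r = 0 ∧ ENNReal.ofReal T * tailIntegral ρ 0 ≤ ENNReal.ofReal r) := by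
  have hT0 : ENNReal.ofReal T ≠ 0 := by simpa using hT
  by_cases h : ENNReal.ofReal r < ENNReal.ofReal T * tailIntegral ρ 0
  · left
    have h1 : ENNReal.ofReal T * ENNReal.ofReal (r / T) = ENNReal.ofReal r := by
      rw [← ENNReal.ofReal_mul hT.le, mul_div_cancel₀ _ hT.ne']
    have h2 : ENNReal.ofReal (r / T) < tailIntegral ρ 0 := by
      rw [← h1] at h
      exact lt_of_mul_lt_mul_left' h
    have h3 := hρ.exists_tailIntegral_eq (div_pos hr hT) h2
    have h4 : jumpSize ρ T r = tailInverse ρ (r / T) := if_pos ⟨hr, h⟩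
    rw [h4]
    unfold tailInverse
    exact ⟨Function.invFunOn_mem h3, by rw [Function.invFunOn_eq h3, h1]⟩
  · exact Or.inr ⟨if_neg fun h' => h h'.2, not_lt.1 h⟩

lemma ofReal_mul_tailIntegral_lt (hρ : IsPositiveLevyDensity ρ) (hT : 0 < T) {x x' : ℝ}
    (hx : 0 ≤ x) (hxx : x < x') :
    ENNReal.ofReal T * tailIntegral ρ x' < ENNReal.ofReal T * tailIntegral ρ x :=
  ENNReal.mul_lt_mul_right (by simpa using hT) ENNReal.ofReal_ne_top (hρ.tailIntegral_lt hx hxx)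

lemma jumpSize_nonneg (hρ : IsPositiveLevyDensity ρ) (hT : 0 < T) (r : ℝ) :
    0 ≤ jumpSize ρ T r := by
  rcases le_or_gt r 0 with hr | hr
  · rw [jumpSize_of_nonpos ρ T hr]
  · rcases jumpSize_spec hρ hT hr with h | h
    exacts [h.1.le, h.1.ge]

/-- This and `lt_jumpSize_iff` express that the jump size is inverse to the decreasing function `x ↦
T g(x)`. They yield monotonicity, and continuity even at `r = T g(0)`, where the size reaches zero.
-/
lemma jumpSize_lt_iff (hρ : IsPositiveLevyDensity ρ) (hT : 0 < T) {r x : ℝ} (hr : 0 < r)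
    (hx : 0 < x) :
    jumpSize ρ T r < x ↔ ENNReal.ofReal T * tailIntegral ρ x < ENNReal.ofReal r := by
  rcases jumpSize_spec hρ hT hr with ⟨h1, h2⟩ | ⟨h1, h2⟩
  · rw [← h2]
    refine ⟨ofReal_mul_tailIntegral_lt hρ hT h1.le, fun h => ?_⟩
    by_contra h'
    exact absurd h (not_lt.2 (mul_le_mul_right (tailIntegral_antitone ρ (not_lt.1 h')) _))
  · rw [h1]
    exact iff_of_true hx ((ofReal_mul_tailIntegral_lt hρ hT le_rfl hx).trans_le h2)

lemma lt_jumpSize_iff (hρ : IsPositiveLevyDensity ρ) (hT : 0 < T) {r x : ℝ} (hr : 0 < r)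
    (hx : 0 < x) :
    x < jumpSize ρ T r ↔ ENNReal.ofReal r < ENNReal.ofReal T * tailIntegral ρ x := by
  rcases jumpSize_spec hρ hT hr with ⟨h1, h2⟩ | ⟨h1, h2⟩
  · rw [← h2]
    refine ⟨ofReal_mul_tailIntegral_lt hρ hT hx.le, fun h => ?_⟩
    by_contra h'
    exact absurd h (not_lt.2 (mul_le_mul_right (tailIntegral_antitone ρ (not_lt.1 h')) _))
  · rw [h1]
    exact iff_of_false hx.not_gt
      ((ofReal_mul_tailIntegral_lt hρ hT le_rfl hx).trans_le h2).not_gt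

lemma jumpSize_antitoneOn (hρ : IsPositiveLevyDensity ρ) (hT : 0 < T) :
    AntitoneOn (jumpSize ρ T) (Set.Ioi 0) := by
  intro r hr r' hr' hrr
  refine le_of_forall_gt fun x hx => ?_
  have hx0 : 0 < x := (jumpSize_nonneg hρ hT r).trans_lt hx
  rw [jumpSize_lt_iff hρ hT hr' hx0]
  rw [jumpSize_lt_iff hρ hT hr hx0] at hx
  exact hx.trans_le (ENNReal.ofReal_le_ofReal hrr)

lemma jumpSize_continuousAt (hρ : IsPositiveLevyDensity ρ) (hT : 0 < T) {r : ℝ} (hr : 0 < r) :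
    ContinuousAt (jumpSize ρ T) r := by
  have hpos : ∀ᶠ s in 𝓝 r, 0 < s := lt_mem_nhds hr
  have hof : ContinuousAt ENNReal.ofReal r := ENNReal.continuous_ofReal.continuousAt
  refine tendsto_order.2 ⟨fun x hx => ?_, fun x hx => ?_⟩
  · rcases lt_or_ge x 0 with h | h
    · exact Eventually.of_forall fun s => h.trans_le (jumpSize_nonneg hρ hT s)
    -- The intermediate level is needed because `x` may be `0`, while `lt_jumpSize_iff` requires a
    -- positive level.
    · obtain ⟨x', h1, h2⟩ := exists_between hx
      have hx' := h.trans_lt h1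
      have := (lt_jumpSize_iff hρ hT hr hx').1 h2
      filter_upwards [hpos, hof.eventually (gt_mem_nhds this)] with s hs hs'
      exact h1.trans ((lt_jumpSize_iff hρ hT hs hx').2 hs')
  · have hx' := (jumpSize_nonneg hρ hT r).trans_lt hx
    have := (jumpSize_lt_iff hρ hT hr hx').1 hx
    filter_upwards [hpos, hof.eventually (lt_mem_nhds this)] with s hs hs'
    exact (jumpSize_lt_iff hρ hT hs hx').2 hs'

lemma measurable_jumpSize (hρ : IsPositiveLevyDensity ρ) (hT : 0 < T) :
    Measurable (jumpSize ρ T) := by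
  classical
  have h : ContinuousOn (jumpSize ρ T) (Set.Ioi 0) := fun r hr =>
    (jumpSize_continuousAt hρ hT hr).continuousWithinAt
  have := h.measurable_piecewise (g := fun _ => 0) continuousOn_const measurableSet_Ioi
  convert! this using 1
  ext r
  by_cases hr : r ∈ Set.Ioi 0
  · simp [Set.piecewise_eq_of_mem _ _ _ hr]
  · rw [Set.piecewise_eq_of_notMem _ _ _ hr, jumpSize_of_nonpos ρ T (not_lt.1 hr)]

/-- The Lévy measure, scaled by `T`, is the image of Lebesgue measure under the jump sizes. -/
lemma measurePreserving_jumpSize (hρ : IsPositiveLevyDensity ρ) (hT : 0 < T) :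
    MeasurePreserving (jumpSize ρ T) (volume.restrict (jumpSize ρ T ⁻¹' Set.Ioi 0))
      (ENNReal.ofReal T • densityMeasure ρ) := by
  have hm := measurable_jumpSize hρ hT
  refine ⟨hm, ?_⟩
  set μ₁ := Measure.map (jumpSize ρ T) (volume.restrict (jumpSize ρ T ⁻¹' Set.Ioi 0)) with h1
  set μ₂ := ENNReal.ofReal T • densityMeasure ρ with h2
  have hIci : ∀ x, 0 < x → μ₁ (Set.Ici x) = μ₂ (Set.Ici x) := by
    intro x hx
    rw [h1, Measure.map_apply hm measurableSet_Ici, Measure.restrict_apply (hm measurableSet_Ici),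
      h2, Measure.smul_apply, densityMeasure_Ici, smul_eq_mul]
    have hfin : ENNReal.ofReal T * tailIntegral ρ x ≠ ∞ :=
      ENNReal.mul_ne_top ENNReal.ofReal_ne_top (hρ.tailIntegral_lt_top hx).ne
    -- A jump has size at least `x` exactly for the arrival times in `(0, T g(x)]`.
    have : jumpSize ρ T ⁻¹' Set.Ici x ∩ jumpSize ρ T ⁻¹' Set.Ioi 0
        = Set.Ioc 0 (ENNReal.ofReal T * tailIntegral ρ x).toReal := by
      ext r
      simp only [Set.mem_inter_iff, Set.mem_preimage, Set.mem_Ici, Set.mem_Ioi, Set.mem_Ioc]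
      rcases le_or_gt r 0 with hr | hr
      · rw [jumpSize_of_nonpos ρ T hr]
        simp [hr.not_gt]
      · rw [← ENNReal.ofReal_le_iff_le_toReal hfin, ← not_lt, jumpSize_lt_iff hρ hT hr hx, not_lt]
        refine ⟨fun h => ⟨hr, h.1⟩, fun h => ⟨h.2, ?_⟩⟩
        have h3 := h.2
        rw [← not_lt, ← jumpSize_lt_iff hρ hT hr hx, not_lt] at h3
        exact hx.trans_le h3
    rw [this, Real.volume_Ioc, sub_zero, ENNReal.ofReal_toReal hfin]
  -- The total mass may be infinite, so agreement on half-lines is used only away from the origin,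
  -- where the measures are finite; `(0, ∞)` is then exhausted.
  have hres : ∀ n : ℕ, μ₁.restrict (Set.Ici (1 / ((n : ℝ) + 1)))
      = μ₂.restrict (Set.Ici (1 / ((n : ℝ) + 1))) := by
    intro n
    have hn : (0 : ℝ) < 1 / ((n : ℝ) + 1) := by positivity
    have : IsFiniteMeasure (μ₁.restrict (Set.Ici (1 / ((n : ℝ) + 1)))) := by
      refine ⟨?_⟩
      rw [Measure.restrict_apply_univ, hIci _ hn, h2, Measure.smul_apply, densityMeasure_Ici,
        smul_eq_mul]
      exact ENNReal.mul_lt_top ENNReal.ofReal_lt_top (hρ.tailIntegral_lt_top hn)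
    refine Measure.ext_of_Ici _ _ fun a => ?_
    rw [Measure.restrict_apply measurableSet_Ici, Measure.restrict_apply measurableSet_Ici,
      Set.Ici_inter_Ici]
    exact hIci _ (lt_sup_of_lt_right hn)
  have hU : ⋃ n : ℕ, Set.Ici (1 / ((n : ℝ) + 1)) = Set.Ioi 0 := by
    ext x
    simp only [Set.mem_Ici, Set.mem_iUnion, Set.mem_Ioi]
    exact ⟨fun ⟨n, hn⟩ => lt_of_lt_of_le (by positivity) hn,
      fun h => (exists_nat_one_div_lt h).imp fun _ => le_of_lt⟩
  have hall := Measure.restrict_iUnion_congr.2 hres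
  rw [hU] at hall
  have e1 : μ₁.restrict (Set.Ioi 0) = μ₁ := by
    rw [h1, Measure.restrict_map hm measurableSet_Ioi, Measure.restrict_restrict
      (hm measurableSet_Ioi), Set.inter_self]
  have e2 : μ₂.restrict (Set.Ioi 0) = μ₂ := by
    rw [h2, Measure.restrict_smul]
    congr 1
    unfold densityMeasure
    rw [restrict_withDensity measurableSet_Ioi, ← withDensity_indicator measurableSet_Ioi]
    congr 1
    ext x
    by_cases hx : 0 < x
    · rw [Set.indicator_of_mem (by exact hx)]
    · rw [Set.indicator_of_notMem (by exact hx), hρ.eq_zero x (not_lt.1 hx), ENNReal.ofReal_zero]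
  rw [← e1, hall, e2]

lemma preimage_jumpSize_subset (ρ : ℝ → ℝ) (T : ℝ) :
    jumpSize ρ T ⁻¹' Set.Ioi 0 ⊆ Set.Ioi 0 := by
  intro r hr
  by_contra h
  rw [Set.mem_preimage, jumpSize_of_nonpos ρ T (not_lt.1 h)] at hr
  exact lt_irrefl (0 : ℝ) hr

lemma jumpSize_eq_zero (hρ : IsPositiveLevyDensity ρ) (hT : 0 < T) {r : ℝ}
    (hr : r ∈ Set.Ioi 0 \ (jumpSize ρ T ⁻¹' Set.Ioi 0)) : jumpSize ρ T r = 0 :=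
  le_antisymm (not_lt.1 hr.2) (jumpSize_nonneg hρ hT r)

variable {E : Type*} [NormedAddCommGroup E]

/-- The image measure only sees times with a positive jump; `F 0 = 0` removes the times `r ≥ T
g(0)`. -/
lemma integrableOn_comp_jumpSize (hρ : IsPositiveLevyDensity ρ) (hT : 0 < T) {F : ℝ → E}
    (hF0 : F 0 = 0) (hF : Integrable F (densityMeasure ρ)) :
    IntegrableOn (fun r => F (jumpSize ρ T r)) (Set.Ioi 0) := by
  have h1 : Integrable F (ENNReal.ofReal T • densityMeasure ρ) :=
    hF.smul_measure ENNReal.ofReal_ne_top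
  have h2 : IntegrableOn (fun r => F (jumpSize ρ T r)) (jumpSize ρ T ⁻¹' Set.Ioi 0) :=
    (measurePreserving_jumpSize hρ hT).integrable_comp_of_integrable h1
  refine h2.of_forall_sdiff_eq_zero measurableSet_Ioi fun r hr => ?_
  rw [jumpSize_eq_zero hρ hT hr, hF0]

lemma integral_comp_jumpSize [NormedSpace ℝ E] (hρ : IsPositiveLevyDensity ρ) (hT : 0 < T)
    {F : ℝ → E} (hF0 : F 0 = 0) (hF : AEStronglyMeasurable F (densityMeasure ρ)) :
    ∫ r in Set.Ioi 0, F (jumpSize ρ T r) = T • ∫ x, F x ∂densityMeasure ρ := by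
  have hp := measurePreserving_jumpSize hρ hT
  rw [setIntegral_eq_of_subset_of_forall_sdiff_eq_zero measurableSet_Ioi
    (preimage_jumpSize_subset ρ T) (fun r hr => by rw [jumpSize_eq_zero hρ hT hr, hF0])]
  have h1 : ∫ y, F y ∂(ENNReal.ofReal T • densityMeasure ρ) = T • ∫ x, F x ∂densityMeasure ρ := by
    rw [integral_smul_measure, ENNReal.toReal_ofReal hT.le]
  rw [← h1, ← hp.map_eq, integral_map hp.measurable.aemeasurable]
  rw [hp.map_eq]
  exact hF.smul_measure _

end JumpSize

/-! ### Marked renewal sequences -/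

lemma isProbabilityMeasure_uniform :
    IsProbabilityMeasure (volume.restrict (Set.Icc (0 : ℝ) 1)) := ⟨by simp⟩

/-- Two independent i.i.d. sequences form an i.i.d. sequence of pairs. -/
lemma iIndepFun_prodMk_of_indepFun {Ω : Type*} [MeasurableSpace Ω] {P : Measure Ω}
    {τ U : ℕ → Ω → ℝ} (hτm : ∀ i, Measurable (τ i)) (hUm : ∀ i, Measurable (U i))
    (hτ : iIndepFun τ P) (hU : iIndepFun U P)
    (hτU : IndepFun (fun ω i => τ i ω) (fun ω i => U i ω) P) :
    iIndepFun (fun n ω => (τ n ω, U n ω)) P := by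
  rw [iIndepFun_iff_iIndep]
  -- It suffices to test on rectangles, a π-system generating the σ-algebra of each pair. There the
  -- probability factors first between the two sequences and then within each.
  refine iIndepSets.iIndep (fun i => ((hτm i).prodMk (hUm i)).comap_le)
    (fun i => {s | ∃ t ∈ Set.image2 (· ×ˢ ·) {s : Set ℝ | MeasurableSet s}
      {t : Set ℝ | MeasurableSet t}, (fun ω => (τ i ω, U i ω)) ⁻¹' t = s})
    (fun i => isPiSystem_prod.comap _) (fun i => ?_) ?_
  · rw [← generateFrom_prod, MeasurableSpace.comap_generateFrom]
    rfl
  · rw [iIndepSets_iff]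
    intro S f hf
    have hf' : ∀ i ∈ S, ∃ A B : Set ℝ, MeasurableSet A ∧ MeasurableSet B ∧
        f i = τ i ⁻¹' A ∩ U i ⁻¹' B := by
      intro i hi
      obtain ⟨t, ⟨A, hA, B, hB, rfl⟩, ht⟩ := hf i hi
      exact ⟨A, B, hA, hB, by rw [← ht]; rfl⟩
    choose! A B hA hB hAB using hf'
    have hm : ∀ (V : ℕ → Ω → ℝ) (C : ℕ → Set ℝ),
        ⋂ i ∈ S, V i ⁻¹' C i = (fun ω i => V i ω) ⁻¹' (⋂ i ∈ S, (fun x : ℕ → ℝ => x i) ⁻¹' C i) := by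
      intro V C; ext ω; simp
    have hms : ∀ C : ℕ → Set ℝ, (∀ i ∈ S, MeasurableSet (C i)) →
        MeasurableSet (⋂ i ∈ S, (fun x : ℕ → ℝ => x i) ⁻¹' C i) := fun C hC =>
      Finset.measurableSet_biInter S fun i hi => (measurable_pi_apply i) (hC i hi)
    have h1 : ∀ i ∈ S, P (f i) = P (τ i ⁻¹' A i) * P (U i ⁻¹' B i) := by
      intro i hi
      rw [hAB i hi]
      exact (hτU.comp (measurable_pi_apply i) (measurable_pi_apply i)).measure_inter_preimage_eq_mul
        _ _ (hA i hi) (hB i hi)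
    have h2 : ⋂ i ∈ S, f i = (⋂ i ∈ S, τ i ⁻¹' A i) ∩ (⋂ i ∈ S, U i ⁻¹' B i) := by
      rw [Set.iInter₂_congr hAB]
      ext ω
      simp only [Set.mem_iInter, Set.mem_inter_iff]
      exact ⟨fun h => ⟨fun i hi => (h i hi).1, fun i hi => (h i hi).2⟩,
        fun h i hi => ⟨h.1 i hi, h.2 i hi⟩⟩
    rw [h2, Finset.prod_congr rfl h1, Finset.prod_mul_distrib,
      ← (iIndepFun_iff_measure_inter_preimage_eq_mul.1 hτ) S hA,
      ← (iIndepFun_iff_measure_inter_preimage_eq_mul.1 hU) S hB, hm, hm]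
    exact hτU.measure_inter_preimage_eq_mul _ _ (hms A hA) (hms B hB)

/-- An i.i.d. sequence of interarrival times with standard exponential law, with independent
marks that are uniform on `[0, 1]`. -/
structure IsMarkedPoisson {Ω : Type*} [MeasurableSpace Ω] (P : Measure Ω) (τ U : ℕ → Ω → ℝ) :
    Prop where
  measurable_time : ∀ i, Measurable (τ i)
  measurable_mark : ∀ i, Measurable (U i)
  indep : iIndepFun (fun n ω => (τ n ω, U n ω)) P
  law : ∀ n, P.map (fun ω => (τ n ω, U n ω))
    = (expMeasure 1).prod (volume.restrict (Set.Icc (0 : ℝ) 1))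

/-- The `n`-th arrival time, where the `0`-th arrival takes place at time `0`. -/
def arrival {Ω : Type*} (τ : ℕ → Ω → ℝ) (n : ℕ) (ω : Ω) : ℝ := ∑ i ∈ Finset.range n, τ i ω

lemma arrival_succ {Ω : Type*} (τ : ℕ → Ω → ℝ) (n : ℕ) (ω : Ω) :
    arrival τ (n + 1) ω = arrival τ n ω + τ n ω := Finset.sum_range_succ _ _

/-- The σ-algebras generated by the first `n` interarrival times and marks. -/
def strictPast {Ω : Type*} {m : MeasurableSpace Ω} (τ U : ℕ → Ω → ℝ)
    (hτ : ∀ i, Measurable (τ i)) (hU : ∀ i, Measurable (U i)) : Filtration ℕ m where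
  seq n := ⨆ i ∈ {i | i < n}, MeasurableSpace.comap (fun ω => (τ i ω, U i ω)) inferInstance
  mono' _ _ h := biSup_mono fun _ hi => lt_of_lt_of_le hi h
  le' _ := iSup₂_le fun i _ => ((hτ i).prodMk (hU i)).comap_le

/-- Integration of a function of two independent variables by freezing the first one. -/
lemma ProbabilityTheory.IndepFun.integral_eq_integral_integral {Ω α β E : Type*}
    [MeasurableSpace Ω] [MeasurableSpace α] [MeasurableSpace β] [NormedAddCommGroup E]
    [NormedSpace ℝ E] [MeasurableSpace E] [BorelSpace E] [SecondCountableTopology E]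
    {P : Measure Ω} [IsProbabilityMeasure P] {Y : Ω → α}
    {V : Ω → β} (h : IndepFun Y V P) (hY : Measurable Y) (hV : Measurable V) {f : α × β → E}
    (hf : Measurable f) (hi : Integrable (fun ω => f (Y ω, V ω)) P) :
    ∫ ω, f (Y ω, V ω) ∂P = ∫ ω, ∫ v, f (Y ω, v) ∂(P.map V) ∂P := by
  have hmap := (indepFun_iff_map_prod_eq_prod_map_map hY.aemeasurable hV.aemeasurable).1 h
  have : IsProbabilityMeasure (P.map Y) := Measure.isProbabilityMeasure_map hY.aemeasurable
  have : IsProbabilityMeasure (P.map V) := Measure.isProbabilityMeasure_map hV.aemeasurable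
  have hp : Measurable fun ω => (Y ω, V ω) := hY.prodMk hV
  have hi' : Integrable f ((P.map Y).prod (P.map V)) := by
    rw [← hmap, integrable_map_measure hf.aestronglyMeasurable hp.aemeasurable]
    exact hi
  rw [← integral_map (f := f) hp.aemeasurable hf.aestronglyMeasurable, hmap, integral_prod _ hi',
    integral_map hY.aemeasurable hi'.integral_prod_left.aestronglyMeasurable]

section MarkedPoisson

variable {Ω : Type*} [MeasurableSpace Ω] {P : Measure Ω} {τ U : ℕ → Ω → ℝ}

lemma IsMarkedPoisson.measurable_arrival (h : IsMarkedPoisson P τ U) (n : ℕ) :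
    Measurable (arrival τ n) :=
  Finset.measurable_fun_sum _ fun i _ => h.measurable_time i

/-- The filtration of the strict past of a marked Poisson sequence. -/
def IsMarkedPoisson.past (h : IsMarkedPoisson P τ U) : Filtration ℕ ‹MeasurableSpace Ω› :=
  strictPast τ U h.measurable_time h.measurable_mark

lemma IsMarkedPoisson.measurable_past_pair (h : IsMarkedPoisson P τ U) {i n : ℕ} (hi : i < n) :
    Measurable[h.past n] fun ω => (τ i ω, U i ω) :=
  (comap_measurable _).mono (le_biSup (fun i =>
    MeasurableSpace.comap (fun ω => (τ i ω, U i ω)) inferInstance) (by exact hi)) le_rfl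

lemma IsMarkedPoisson.measurable_past_time (h : IsMarkedPoisson P τ U) {i n : ℕ} (hi : i < n) :
    Measurable[h.past n] (τ i) :=
  measurable_fst.comp (h.measurable_past_pair hi)

lemma IsMarkedPoisson.measurable_past_mark (h : IsMarkedPoisson P τ U) {i n : ℕ} (hi : i < n) :
    Measurable[h.past n] (U i) :=
  measurable_snd.comp (h.measurable_past_pair hi)

lemma IsMarkedPoisson.measurable_past_arrival (h : IsMarkedPoisson P τ U) {i n : ℕ} (hi : i ≤ n) :
    Measurable[h.past n] (arrival τ i) :=
  Finset.measurable_fun_sum _ fun _ hj =>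
    h.measurable_past_time ((Finset.mem_range.1 hj).trans_le hi)

lemma IsMarkedPoisson.indepFun_past (h : IsMarkedPoisson P τ U) {n : ℕ} {α : Type*}
    [MeasurableSpace α] {Y : Ω → α} (hY : Measurable[h.past n] Y) :
    IndepFun Y (fun ω => (τ n ω, U n ω)) P := by
  rw [IndepFun_iff_Indep]
  have h1 : Indep (⨆ i ∈ {i | i < n}, MeasurableSpace.comap (fun ω => (τ i ω, U i ω)) inferInstance)
      (⨆ i ∈ ({n} : Set ℕ), MeasurableSpace.comap (fun ω => (τ i ω, U i ω)) inferInstance) P :=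
    indep_iSup_of_disjoint (fun i => ((h.measurable_time i).prodMk (h.measurable_mark i)).comap_le)
      ((iIndepFun_iff_iIndep _ _ _).1 h.indep) (by simp)
  rw [iSup_singleton] at h1
  exact indep_of_indep_of_le_left h1 hY.comap_le

/-- A function of the past and the next pair has zero conditional mean if it has zero mean with
the past frozen. -/
lemma IsMarkedPoisson.condExp_eq_zero [IsProbabilityMeasure P] (h : IsMarkedPoisson P τ U) {n : ℕ}
    {R : ℝ × (ℝ × ℝ) → ℝ} (hR : Measurable R)
    (hi : Integrable (fun ω => R (arrival τ n ω, (τ n ω, U n ω))) P)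
    (h0 : ∀ s, ∫ p, R (s, p) ∂((expMeasure 1).prod (volume.restrict (Set.Icc (0 : ℝ) 1))) = 0) :
    P[fun ω => R (arrival τ n ω, (τ n ω, U n ω)) | h.past n] =ᵐ[P] 0 := by
  symm
  refine ae_eq_condExp_of_forall_setIntegral_eq (h.past.le n) hi (fun s _ _ => integrableOn_zero)
    (fun A hA _ => ?_) aestronglyMeasurable_zero
  have hA' := h.past.le n A hA
  -- The indicator of the past event is frozen together with the arrival time, so that it becomes a
  -- constant factor in the inner integral.
  have hYp : Measurable[h.past n] fun ω => (A.indicator (fun _ => (1 : ℝ)) ω, arrival τ n ω) :=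
    (measurable_const.indicator hA).prodMk (h.measurable_past_arrival le_rfl)
  have hY := hYp.mono (h.past.le n) le_rfl
  have hV := (h.measurable_time n).prodMk (h.measurable_mark n)
  have e : ∀ ω, A.indicator (fun ω => R (arrival τ n ω, (τ n ω, U n ω))) ω
      = A.indicator (fun _ => (1 : ℝ)) ω * R (arrival τ n ω, (τ n ω, U n ω)) := by
    intro ω
    by_cases hω : ω ∈ A <;> simp [hω]
  rw [← integral_indicator (f := fun ω => R (arrival τ n ω, (τ n ω, U n ω))) hA',
    integral_congr_ae (ae_of_all _ e)]
  have := (h.indepFun_past hYp).integral_eq_integral_integral hY hV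
    (f := fun q : (ℝ × ℝ) × (ℝ × ℝ) => q.1.1 * R (q.1.2, q.2)) (by fun_prop) (by
      refine (hi.indicator hA').congr (ae_of_all _ e))
  rw [this, h.law n]
  simp [integral_const_mul, h0]

end MarkedPoisson

/-! ### Square integrable martingale differences -/

/-- A series of martingale differences with summable second moments converges almost surely. -/
lemma ae_exists_tendsto_sum_of_condExp_eq_zero {Ω : Type*} {m0 : MeasurableSpace Ω} {P : Measure Ω}
    [IsProbabilityMeasure P] {𝓕 : Filtration ℕ m0} {D : ℕ → Ω → ℝ}
    (hD : ∀ n, StronglyMeasurable[𝓕 (n + 1)] (D n)) (hD2 : ∀ n, MemLp (D n) 2 P)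
    (h0 : ∀ n, P[D n | 𝓕 n] =ᵐ[P] 0) {b : ℕ → ℝ} (hb : Summable b)
    (hDb : ∀ n, ∫ ω, D n ω ^ 2 ∂P ≤ b n) :
    ∀ᵐ ω ∂P, ∃ l, Tendsto (fun n => ∑ i ∈ Finset.range n, D i ω) atTop (𝓝 l) := by
  set f : ℕ → Ω → ℝ := fun n ω => ∑ i ∈ Finset.range n, D i ω with hf
  have hadp : StronglyAdapted 𝓕 f := fun n => by
    refine Finset.stronglyMeasurable_fun_sum _ fun i hi => ?_
    exact (hD i).mono (𝓕.mono (Finset.mem_range.1 hi))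
  have hf2 : ∀ n, MemLp (f n) 2 P := fun n => memLp_finsetSum _ fun i _ => hD2 i
  have hsucc : ∀ n, f (n + 1) = f n + D n := fun n => by
    ext ω; simp [hf, Finset.sum_range_succ]
  have hmart : Martingale f 𝓕 P := by
    refine martingale_of_condExp_sub_eq_zero_nat hadp
      (fun n => (hf2 n).integrable (by norm_num)) fun n => ?_
    rw [hsucc, add_sub_cancel_left]
    exact h0 n
  -- Each partial sum is orthogonal to the next difference, so second moments add up.
  have horth : ∀ n, ∫ ω, f n ω * D n ω ∂P = 0 := by
    intro n
    have hint : Integrable (f n * D n) P := (hf2 n).integrable_mul (hD2 n)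
    have h1 := condExp_mul_of_stronglyMeasurable_left (hadp n) hint
      ((hD2 n).integrable (by norm_num))
    have h2 : P[f n * D n | 𝓕 n] =ᵐ[P] 0 := by
      filter_upwards [h1, h0 n] with ω hω1 hω2
      rw [hω1, Pi.mul_apply, hω2]; simp
    have h3 := integral_condExp (μ := P) (𝓕.le n) (f := f n * D n)
    rw [integral_congr_ae h2] at h3
    simpa using h3.symm
  have hsq : ∀ n, ∫ ω, f n ω ^ 2 ∂P ≤ ∑ i ∈ Finset.range n, b i := by
    intro n
    induction n with
    | zero => simp [hf]
    | succ n ih =>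
      have e : ∀ ω, f (n + 1) ω ^ 2 = f n ω ^ 2 + 2 * (f n ω * D n ω) + D n ω ^ 2 := by
        intro ω; rw [hsucc, Pi.add_apply]; ring
      have hint : Integrable (fun ω => f n ω * D n ω) P := (hf2 n).integrable_mul (hD2 n)
      simp_rw [e]
      have h2 : Integrable (fun ω => f n ω ^ 2 + 2 * (f n ω * D n ω)) P :=
        (hf2 n).integrable_sq.add (hint.const_mul 2)
      rw [integral_add h2 (hD2 n).integrable_sq, integral_add (hf2 n).integrable_sq (hint.const_mul 2), integral_const_mul, horth,
        Finset.sum_range_succ]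
      linarith [hDb n]
  have hb0 : ∀ n, 0 ≤ b n := fun n => (integral_nonneg fun ω => sq_nonneg _).trans (hDb n)
  set B : ℝ := ∑' i, b i + 1 with hB
  -- The bound in `L²` becomes a bound in `L¹` through `|f| ≤ f² + 1`, whence the summand `1` in
  -- `B`, as the martingale convergence theorem requires.
  have hbdd : ∀ n, eLpNorm (f n) 1 P ≤ (B.toNNReal : ℝ≥0∞) := by
    intro n
    rw [eLpNorm_one_eq_lintegral_enorm, ← ofReal_integral_norm_eq_lintegral_enorm
      ((hf2 n).integrable (by norm_num))]
    refine ENNReal.ofReal_le_ofReal ?_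
    calc ∫ ω, ‖f n ω‖ ∂P ≤ ∫ ω, (f n ω ^ 2 + 1) ∂P := by
          refine integral_mono ((hf2 n).integrable (by norm_num)).norm
            ((hf2 n).integrable_sq.add (integrable_const _)) fun ω => ?_
          simp only [Real.norm_eq_abs]
          nlinarith [sq_nonneg (|f n ω| - 1), sq_abs (f n ω), abs_nonneg (f n ω)]
      _ = ∫ ω, f n ω ^ 2 ∂P + 1 := by
          rw [integral_add (hf2 n).integrable_sq (integrable_const _)]; simp
      _ ≤ B := by
          have := (hsq n).trans (hb.sum_le_tsum _ fun i _ => hb0 i)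
          linarith
  exact hmart.submartingale.exists_ae_tendsto_of_bdd hbdd

/-- Kronecker's lemma. -/
lemma tendsto_mul_sum_zero_of_tendsto_sum_mul {b x : ℕ → ℝ} (hb : Antitone b)
    (hb0 : Tendsto b atTop (𝓝 0)) {l : ℝ}
    (h : Tendsto (fun n => ∑ i ∈ Finset.range n, b i * x i) atTop (𝓝 l)) :
    Tendsto (fun n => b n * ∑ i ∈ Finset.range n, x i) atTop (𝓝 0) := by
  have hbn : ∀ n, 0 ≤ b n := hb.le_of_tendsto hb0
  set s : ℕ → ℝ := fun n => ∑ i ∈ Finset.range n, b i * x i with hs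
  set S : ℕ → ℝ := fun n => ∑ i ∈ Finset.range n, x i with hS
  rw [Metric.tendsto_atTop]
  intro ε hε
  obtain ⟨N, hN⟩ := Metric.tendsto_atTop.1 h (ε / 8) (by positivity)
  obtain ⟨K, hK⟩ := Metric.tendsto_atTop.1
    (show Tendsto (fun n => b n * S N) atTop (𝓝 0) by simpa using hb0.mul_const (S N))
    (ε / 2) (by positivity)
  have ht : ∀ n ≥ N, |s n - s N| ≤ ε / 4 := by
    intro n hn
    have h1 := hN n hn
    have h2 := hN N le_rfl
    rw [Real.dist_eq, abs_lt] at h1 h2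
    rw [abs_le]; constructor <;> linarith
  -- the remainder is, step by step, a convex combination of the previous ones
  have hR : ∀ n ≥ N, |(s n - s N) - b n * (S n - S N)| ≤ ε / 4 := by
    intro n hn
    induction n, hn using Nat.le_induction with
    | base => simp; positivity
    | succ n hn ih =>
      have hs1 : s (n + 1) = s n + b n * x n := Finset.sum_range_succ _ _
      have hS1 : S (n + 1) = S n + x n := Finset.sum_range_succ _ _
      set R := (s (n + 1) - s N) - b (n + 1) * (S (n + 1) - S N) with hRdef
      have ht1 := ht (n + 1) (by omega)
      rcases (hbn n).eq_or_lt with h0 | h0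
      · have : b (n + 1) = 0 := le_antisymm (h0 ▸ hb n.le_succ) (hbn _)
        rw [hRdef, this, zero_mul, sub_zero]
        exact ht1
      · have e : b n * R = b (n + 1) * ((s n - s N) - b n * (S n - S N))
            + (b n - b (n + 1)) * (s (n + 1) - s N) := by
          rw [hRdef, hs1, hS1]; ring
        have h1 : b n * |R| ≤ b n * (ε / 4) := by
          rw [← abs_of_pos h0, ← abs_mul, e, abs_of_pos h0]
          refine (abs_add_le _ _).trans ?_
          rw [abs_mul, abs_mul, abs_of_nonneg (hbn _), abs_of_nonneg (sub_nonneg.2 (hb n.le_succ))]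
          have h2 := mul_le_mul_of_nonneg_left ih (hbn (n + 1))
          have h3 := mul_le_mul_of_nonneg_left ht1 (sub_nonneg.2 (hb n.le_succ))
          linarith
        exact le_of_mul_le_mul_left h1 h0
  refine ⟨max N K, fun n hn => ?_⟩
  have hnN := (le_max_left N K).trans hn
  have h1 := ht n hnN
  have h2 := hR n hnN
  have h3 := hK n ((le_max_right N K).trans hn)
  rw [Real.dist_eq, sub_zero] at h3 ⊢
  rw [abs_le] at h1 h2
  rw [abs_lt] at h3 ⊢
  have e : b n * S n = b n * (S n - S N) + b n * S N := by ring
  rw [e]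
  constructor <;> linarith

/-! ### The standard exponential law -/

lemma expMeasure_one_eq : expMeasure 1
    = (volume.restrict (Set.Ioi 0)).withDensity fun t => ENNReal.ofReal (Real.exp (-t)) := by
  rw [Measure.restrict_congr_set Ioi_ae_eq_Ici, ← withDensity_indicator measurableSet_Ici]
  change volume.withDensity (exponentialPDF 1) = _
  congr 1
  ext t
  rw [exponentialPDF_eq]
  by_cases ht : 0 ≤ t
  · rw [if_pos ht, Set.indicator_of_mem (by exact ht)]; simp
  · rw [if_neg ht, Set.indicator_of_notMem (by exact ht)]; simp

lemma integral_expMeasure_one {E : Type*} [NormedAddCommGroup E] [NormedSpace ℝ E] (f : ℝ → E) :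
    ∫ t, f t ∂expMeasure 1 = ∫ t in Set.Ioi 0, Real.exp (-t) • f t := by
  rw [expMeasure_one_eq, integral_withDensity_eq_integral_toReal_smul (by fun_prop)
    (ae_of_all _ fun _ => ENNReal.ofReal_lt_top)]
  simp_rw [ENNReal.toReal_ofReal (Real.exp_pos _).le]

lemma integrable_expMeasure_one_iff {E : Type*} [NormedAddCommGroup E] [NormedSpace ℝ E]
    {f : ℝ → E} :
    Integrable f (expMeasure 1) ↔ IntegrableOn (fun t => Real.exp (-t) • f t) (Set.Ioi 0) := by
  rw [expMeasure_one_eq, integrable_withDensity_iff_integrable_smul' (by fun_prop)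
    (ae_of_all _ fun _ => ENNReal.ofReal_lt_top)]
  simp_rw [ENNReal.toReal_ofReal (Real.exp_pos _).le]
  rfl

lemma ae_expMeasure_one_pos : ∀ᵐ t ∂expMeasure 1, 0 < t := by
  rw [expMeasure_one_eq]
  exact (withDensity_absolutelyContinuous _ _).ae_le (ae_restrict_mem measurableSet_Ioi)

lemma integrable_pow_expMeasure_one (n : ℕ) : Integrable (fun t => t ^ n) (expMeasure 1) := by
  rw [integrable_expMeasure_one_iff]
  have := Real.GammaIntegral_convergent (s := n + 1) (by positivity)
  simpa using this

/-- The derivative of `e^{-t} (Y(s + t) - Y(s))` integrates to zero. -/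
lemma integral_expMeasure_one_sub_primitive {Y y : ℝ → ℝ} {s b : ℝ}
    (hY : ∀ t, 0 ≤ t → HasDerivAt Y (y (s + t)) (s + t))
    (hy : Measurable y) (hb : ∀ t, 0 ≤ t → |y (s + t)| ≤ b)
    (hYb : ∀ t, 0 ≤ t → |Y (s + t) - Y s| ≤ b * t) :
    ∫ t, y (s + t) ∂expMeasure 1 = ∫ t, (Y (s + t) - Y s) ∂expMeasure 1 := by
  have hY' : ∀ t, 0 ≤ t → HasDerivAt (fun t => Y (s + t) - Y s) (y (s + t)) t := fun t ht =>
    ((hY t ht).comp_const_add s t).sub_const _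
  have hYc : ContinuousOn (fun t => Y (s + t) - Y s) (Set.Ioi 0) := fun t ht =>
    (hY' t (le_of_lt ht)).continuousAt.continuousWithinAt
  have h1 : IntegrableOn (fun t => Real.exp (-t) • y (s + t)) (Set.Ioi 0) := by
    have := integrable_expMeasure_one_iff.1 ((integrable_pow_expMeasure_one 0).const_mul b)
    refine this.mono' (by fun_prop) ?_
    filter_upwards [ae_restrict_mem measurableSet_Ioi] with t ht
    rw [norm_smul, Real.norm_of_nonneg (Real.exp_pos _).le, Real.norm_eq_abs, smul_eq_mul]
    gcongr
    simpa using hb t (le_of_lt ht)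
  have h2 : IntegrableOn (fun t => Real.exp (-t) • (Y (s + t) - Y s)) (Set.Ioi 0) := by
    have := integrable_expMeasure_one_iff.1 ((integrable_pow_expMeasure_one 1).const_mul b)
    refine this.mono' ?_ ?_
    · exact ((by fun_prop : Continuous fun t : ℝ => Real.exp (-t)).continuousOn.smul
        hYc).aestronglyMeasurable measurableSet_Ioi
    filter_upwards [ae_restrict_mem measurableSet_Ioi] with t ht
    rw [norm_smul, Real.norm_of_nonneg (Real.exp_pos _).le, Real.norm_eq_abs, smul_eq_mul]
    gcongr
    simpa using hYb t (le_of_lt ht)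
  have hexp : ∀ t : ℝ, HasDerivAt (fun t : ℝ => Real.exp (-t)) (-Real.exp (-t)) t := fun t => by
    simpa using (hasDerivAt_neg t).exp
  rw [integral_expMeasure_one, integral_expMeasure_one, ← sub_eq_zero, ← integral_sub h1 h2]
  have := integral_Ioi_of_hasDerivAt_of_tendsto (a := 0) (m := (0 : ℝ))
    (f := fun t => Real.exp (-t) * (Y (s + t) - Y s))
    (f' := fun t => Real.exp (-t) • y (s + t) - Real.exp (-t) • (Y (s + t) - Y s))
    ((hexp 0).continuousAt.mul (hY' 0 le_rfl).continuousAt).continuousWithinAt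
    (fun t ht => by
      refine ((hexp t).mul (hY' t (le_of_lt ht))).congr_deriv ?_
      simp only [smul_eq_mul]; ring)
    (h1.sub h2) ?_
  · rw [this]; simp
  · have h0 : Tendsto (fun t : ℝ => b * (t ^ 1 * Real.exp (-t))) atTop (𝓝 0) := by
      simpa using (Real.tendsto_pow_mul_exp_neg_atTop_nhds_zero 1).const_mul b
    refine squeeze_zero_norm' ?_ h0
    filter_upwards [eventually_ge_atTop 0] with t ht
    rw [norm_mul, Real.norm_of_nonneg (Real.exp_pos _).le, Real.norm_eq_abs]
    calc _ ≤ Real.exp (-t) * (b * t) := by gcongr; exact hYb t ht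
      _ = _ := by ring

lemma integral_id_expMeasure_one : ∫ t, t ∂expMeasure 1 = 1 := by
  have := integral_expMeasure_one_sub_primitive (Y := fun t => t) (y := fun _ => 1) (s := 0)
    (b := 1) (fun t _ => hasDerivAt_id _) measurable_const (fun t _ => by simp)
    (fun t ht => by simp [abs_of_nonneg ht])
  have hp := isProbabilityMeasure_expMeasure (r := 1) one_pos
  simpa using this.symm

/-! ### Arrival times -/

section MarkedPoisson

variable {Ω : Type*} [MeasurableSpace Ω] {P : Measure Ω}
  {τ U : ℕ → Ω → ℝ}

lemma IsMarkedPoisson.map_time (h : IsMarkedPoisson P τ U) (n : ℕ) :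
    P.map (τ n) = expMeasure 1 := by
  have := isProbabilityMeasure_uniform
  have hp := (h.measurable_time n).prodMk (h.measurable_mark n)
  have h1 := congrArg Measure.fst (h.law n)
  rwa [Measure.fst_map_prodMk (h.measurable_mark n), Measure.fst_prod] at h1

lemma IsMarkedPoisson.ae_time_pos (h : IsMarkedPoisson P τ U) : ∀ᵐ ω ∂P, ∀ n, 0 < τ n ω := by
  refine ae_all_iff.2 fun n => ?_
  have := ae_expMeasure_one_pos
  rw [← h.map_time n] at this
  exact ae_of_ae_map (h.measurable_time n).aemeasurable this

lemma IsMarkedPoisson.ae_arrival_nonneg (h : IsMarkedPoisson P τ U) :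
    ∀ᵐ ω ∂P, ∀ n, 0 ≤ arrival τ n ω := by
  filter_upwards [h.ae_time_pos] with ω hω n
  exact Finset.sum_nonneg fun i _ => (hω i).le

lemma IsMarkedPoisson.integrable_pow_time (h : IsMarkedPoisson P τ U) (n k : ℕ) :
    Integrable (fun ω => τ n ω ^ k) P := by
  have := integrable_pow_expMeasure_one k
  rw [← h.map_time n] at this
  exact this.comp_measurable (h.measurable_time n)

lemma IsMarkedPoisson.integral_pow_time (h : IsMarkedPoisson P τ U) (n k : ℕ) :
    ∫ ω, τ n ω ^ k ∂P = ∫ t, t ^ k ∂expMeasure 1 := by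
  rw [← h.map_time n, integral_map (h.measurable_time n).aemeasurable (by fun_prop)]

lemma IsMarkedPoisson.memLp_time (h : IsMarkedPoisson P τ U) (n : ℕ) : MemLp (τ n) 2 P :=
  (memLp_two_iff_integrable_sq (h.measurable_time n).aestronglyMeasurable).2
    (h.integrable_pow_time n 2)

/-- The strong law of large numbers for the arrival times. -/
lemma IsMarkedPoisson.ae_tendsto_arrival_div (h : IsMarkedPoisson P τ U) :
    ∀ᵐ ω ∂P, Tendsto (fun n : ℕ => arrival τ n ω / n) atTop (𝓝 1) := by
  have h1 := strong_law_ae_real τ (by simpa using h.integrable_pow_time 0 1)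
    (fun i j hij => (h.indep.indepFun hij).comp measurable_fst measurable_fst)
    (fun i => ⟨(h.measurable_time i).aemeasurable, (h.measurable_time 0).aemeasurable, by
      rw [h.map_time, h.map_time]⟩)
  have h2 := h.integral_pow_time 0 1
  simp only [pow_one] at h2
  rw [h2, integral_id_expMeasure_one] at h1
  exact h1

lemma IsMarkedPoisson.ae_tendsto_arrival (h : IsMarkedPoisson P τ U) :
    ∀ᵐ ω ∂P, Tendsto (fun n : ℕ => arrival τ n ω) atTop atTop := by
  filter_upwards [h.ae_tendsto_arrival_div] with ω hω
  refine (hω.pos_mul_atTop one_pos tendsto_natCast_atTop_atTop).congr' ?_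
  filter_upwards [eventually_ne_atTop 0] with n hn
  field_simp

lemma IsMarkedPoisson.ae_eventually_half_le_arrival (h : IsMarkedPoisson P τ U) :
    ∀ᵐ ω ∂P, ∀ᶠ n : ℕ in atTop, ((n : ℝ) + 1) / 2 ≤ arrival τ n ω := by
  filter_upwards [h.ae_tendsto_arrival_div] with ω hω
  -- For `n ≥ 2` one has `(n + 1)/2 ≤ 3n/4`, so any constant from `3/4` up to below the limit `1`
  -- would do.
  filter_upwards [hω.eventually (lt_mem_nhds (show (3 / 4 : ℝ) < 1 by norm_num)),
    eventually_ge_atTop 2] with n hn hn2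
  have hn0 : (2 : ℝ) ≤ n := by exact_mod_cast hn2
  rw [lt_div_iff₀ (by linarith)] at hn
  linarith

end MarkedPoisson

/-! ### Jump profiles -/

/-- A nonincreasing continuous square integrable function on `(0, ∞)`, extended by zero. -/
structure IsJumpProfile (y : ℝ → ℝ) : Prop where
  nonneg : ∀ r, 0 ≤ y r
  eq_zero : ∀ r ≤ 0, y r = 0
  antitoneOn : AntitoneOn y (Set.Ioi 0)
  continuousAt : ∀ r, 0 < r → ContinuousAt y r
  measurable : Measurable y
  integrableOn_sq : IntegrableOn (fun r => y r ^ 2) (Set.Ioi 0)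

namespace IsJumpProfile

variable {y : ℝ → ℝ}

lemma intervalIntegrable (hy : IsJumpProfile y) (a b : ℝ) : IntervalIntegrable y volume a b := by
  have h1 : ∀ c, IntegrableOn y (Set.Iic c) := by
    intro c
    have hl : IntegrableOn y (Set.Iic 0) :=
      integrableOn_zero.congr_fun (fun r hr => (hy.eq_zero r hr).symm) measurableSet_Iic
    have hr : IntegrableOn y (Set.Ioc 0 c) := by
      have h2 : MemLp y 2 (volume.restrict (Set.Ioc 0 c)) :=
        (memLp_two_iff_integrable_sq hy.measurable.aestronglyMeasurable).2
          (hy.integrableOn_sq.mono_set Set.Ioc_subset_Ioi_self)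
      exact h2.integrable (by norm_num)
    exact (hl.union hr).mono_set fun x hx => by
      rcases le_or_gt x 0 with h | h
      exacts [Or.inl h, Or.inr ⟨h, hx⟩]
  exact ⟨(h1 b).mono_set Set.Ioc_subset_Iic_self, (h1 a).mono_set Set.Ioc_subset_Iic_self⟩

lemma continuous_primitive (hy : IsJumpProfile y) : Continuous fun x => ∫ r in 0..x, y r :=
  intervalIntegral.continuous_primitive (fun a b => hy.intervalIntegrable a b) 0

lemma hasDerivAt_primitive (hy : IsJumpProfile y) {x : ℝ} (hx : 0 < x) :
    HasDerivAt (fun x => ∫ r in 0..x, y r) (y x) x :=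
  intervalIntegral.integral_hasDerivAt_right (hy.intervalIntegrable 0 x)
    hy.measurable.stronglyMeasurable.stronglyMeasurableAtFilter (hy.continuousAt x hx)

lemma le_of_le (hy : IsJumpProfile y) {a r : ℝ} (ha : 0 < a) (hr : a ≤ r) : y r ≤ y a :=
  hy.antitoneOn ha (ha.trans_le hr) hr

lemma abs_integral_le (hy : IsJumpProfile y) {a x z : ℝ} (ha : 0 < a) (hx : a ≤ x) (hz : a ≤ z) :
    |∫ r in x..z, y r| ≤ y a * |z - x| := by
  rw [← Real.norm_eq_abs]
  refine intervalIntegral.norm_integral_le_of_norm_le_const fun r hr => ?_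
  rw [Real.norm_of_nonneg (hy.nonneg r)]
  have h1 : a < r := (le_min hx hz).trans_lt hr.1
  exact hy.le_of_le ha h1.le

lemma summable_sq (hy : IsJumpProfile y) : Summable fun n : ℕ => y (((n : ℝ) + 1) / 2) ^ 2 := by
  -- The first term is dropped because `y` may be unbounded at `0`: the comparison with the integral
  -- then starts at `1`, away from the singularity.
  rw [← summable_nat_add_iff 1]
  have hint : IntegrableOn (fun x => y (1 / 2 * x) ^ 2) (Set.Ioi 0) := by
    have := integrableOn_Ioi_comp_mul_left_iff (fun x => y x ^ 2) 0 (a := 1 / 2) (by norm_num)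
    rw [mul_zero] at this
    exact this.2 hy.integrableOn_sq
  refine summable_of_sum_range_le (c := ∫ x in Set.Ioi 0, y (1 / 2 * x) ^ 2)
    (fun n => sq_nonneg _) fun n => ?_
  have hanti : AntitoneOn (fun x => y (1 / 2 * x) ^ 2) (Set.Icc 1 (1 + n)) := by
    intro a ha b hb hab
    have : y (1 / 2 * b) ≤ y (1 / 2 * a) := hy.le_of_le (by linarith [ha.1]) (by linarith)
    exact pow_le_pow_left₀ (hy.nonneg _) this 2
  have h1 := hanti.sum_le_integral
  calc _ = ∑ i ∈ Finset.range n, y (1 / 2 * (1 + ((i + 1 : ℕ) : ℝ))) ^ 2 := by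
        refine Finset.sum_congr rfl fun i _ => ?_
        congr 2; push_cast; ring
    _ ≤ _ := h1
    _ ≤ _ := by
        rw [intervalIntegral.integral_of_le (by linarith [Nat.cast_nonneg (α := ℝ) n])]
        exact setIntegral_mono_set hint (ae_of_all _ fun x => sq_nonneg _)
          (Set.Ioc_subset_Ioi_self.trans (Set.Ioi_subset_Ioi zero_le_one)).eventuallyLE

lemma antitone_half (hy : IsJumpProfile y) : Antitone fun n : ℕ => y (((n : ℝ) + 1) / 2) := by
  intro m n hmn
  refine hy.le_of_le (by positivity) ?_
  gcongr

lemma tendsto_half (hy : IsJumpProfile y) :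
    Tendsto (fun n : ℕ => y (((n : ℝ) + 1) / 2)) atTop (𝓝 0) := by
  have := (Real.continuous_sqrt.tendsto 0).comp hy.summable_sq.tendsto_atTop_zero
  rw [Real.sqrt_zero] at this
  exact this.congr fun n => Real.sqrt_sq (hy.nonneg _)

end IsJumpProfile

/-! ### Almost sure convergence of the centred shot-noise series -/

section Convergence

variable {Ω : Type*} [MeasurableSpace Ω] {P : Measure Ω} [IsProbabilityMeasure P]
  {τ U : ℕ → Ω → ℝ} {y w : ℝ → ℝ} {C : ℝ}

/-- This moves the compensator from the random time `Γ_n` to `n`. Eventually `Γ_n ≥ (n + 1)/2`, and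
the integral is at most `b_n |Γ_n - n|` with `b_n = y((n + 1)/2)`. As `∑ b_n² < ∞`, the martingale
series `∑ b_i (τ_i - 1)` converges, and Kronecker's lemma gives `b_n (Γ_n - n) → 0`. -/
lemma IsMarkedPoisson.ae_tendsto_integral_arrival (h : IsMarkedPoisson P τ U)
    (hy : IsJumpProfile y) :
    ∀ᵐ ω ∂P, Tendsto (fun n : ℕ => ∫ r in (n : ℝ)..arrival τ n ω, y r) atTop (𝓝 0) := by
  have hexp := isProbabilityMeasure_expMeasure (r := 1) one_pos
  have huni := isProbabilityMeasure_uniform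
  set b : ℕ → ℝ := fun n => y (((n : ℝ) + 1) / 2) with hb
  have hMem : ∀ n, MemLp (fun ω => b n * (τ n ω - 1)) 2 P := fun n =>
    ((h.memLp_time n).sub (memLp_const 1)).const_mul _
  have hDm : ∀ n, StronglyMeasurable[h.past (n + 1)] fun ω => b n * (τ n ω - 1) := fun n =>
    (((h.measurable_past_time n.lt_succ_self).sub_const 1).const_mul _).stronglyMeasurable
  have hD0 : ∀ n, P[fun ω => b n * (τ n ω - 1) | h.past n] =ᵐ[P] 0 := by
    intro n
    refine h.condExp_eq_zero (R := fun p => b n * (p.2.1 - 1)) (by fun_prop)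
      ((hMem n).integrable (by norm_num)) fun s => ?_
    have := integral_fun_fst (μ := expMeasure 1) (ν := volume.restrict (Set.Icc (0 : ℝ) 1))
      (fun t => b n * (t - 1))
    rw [this, integral_const_mul, integral_sub
      (by simpa using integrable_pow_expMeasure_one 1) (integrable_const _),
      integral_id_expMeasure_one]
    simp
  have hDb : ∀ n, ∫ ω, (b n * (τ n ω - 1)) ^ 2 ∂P
      ≤ (∫ t, (t - 1) ^ 2 ∂expMeasure 1) * b n ^ 2 := by
    intro n
    simp_rw [mul_pow]
    rw [integral_const_mul, ← h.map_time n, integral_map (h.measurable_time n).aemeasurable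
      (by fun_prop), mul_comm]
  have hconv := ae_exists_tendsto_sum_of_condExp_eq_zero hDm hMem hD0
    (hy.summable_sq.mul_left (∫ t, (t - 1) ^ 2 ∂expMeasure 1)) hDb
  filter_upwards [hconv, h.ae_eventually_half_le_arrival] with ω ⟨l, hl⟩ hev
  have hK := tendsto_mul_sum_zero_of_tendsto_sum_mul hy.antitone_half hy.tendsto_half hl
  have hK0 := hK.norm
  rw [norm_zero] at hK0
  refine squeeze_zero_norm' ?_ hK0
  filter_upwards [hev, eventually_ge_atTop 1] with n hn hn1
  have hn1' : (1 : ℝ) ≤ n := by exact_mod_cast hn1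
  refine (hy.abs_integral_le (a := ((n : ℝ) + 1) / 2) (by positivity) (by linarith) hn).trans_eq ?_
  rw [norm_mul, Real.norm_of_nonneg (hy.nonneg _), Finset.sum_sub_distrib, Real.norm_eq_abs]
  simp [arrival]

/-- The compensated increment of the shot-noise sum over an interarrival period, discarded when
the arrival time `s` is exceptionally early. -/
noncomputable def compensatedIncrement (y w : ℝ → ℝ) (c : ℝ) (n : ℕ) (p : ℝ × (ℝ × ℝ)) : ℝ :=
  Set.indicator {p : ℝ × (ℝ × ℝ) | ((n : ℝ) + 1) / 2 ≤ p.1}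
    (fun p => y (p.1 + p.2.1) * w p.2.2
      - c * ((∫ r in 0..p.1 + p.2.1, y r) - ∫ r in 0..p.1, y r)) p

lemma measurable_compensatedIncrement (hy : IsJumpProfile y) (hw : Measurable w) (c : ℝ) (n : ℕ) :
    Measurable (compensatedIncrement y w c n) := by
  have hY := hy.continuous_primitive.measurable
  refine Measurable.indicator ?_ (measurableSet_le measurable_const measurable_fst)
  have h1 : Measurable fun p : ℝ × (ℝ × ℝ) => p.1 + p.2.1 := by fun_prop
  exact ((hy.measurable.comp h1).mul (hw.comp (by fun_prop))).sub
    (((hY.comp h1).sub (hY.comp measurable_fst)).const_mul c)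

lemma abs_primitive_sub_le (hy : IsJumpProfile y) {a s t : ℝ} (ha : 0 < a) (hs : a ≤ s)
    (ht : 0 ≤ t) : |(∫ r in 0..s + t, y r) - ∫ r in 0..s, y r| ≤ y a * t := by
  rw [intervalIntegral.integral_interval_sub_left (hy.intervalIntegrable _ _)
    (hy.intervalIntegrable _ _)]
  have := hy.abs_integral_le ha hs (z := s + t) (by linarith)
  rwa [add_sub_cancel_left, abs_of_nonneg ht] at this

/-- Discarding early arrivals replaces the random level `y(s)` by the deterministic `y((n + 1)/2)`,
whose squares are summable. -/
lemma abs_compensatedIncrement_le (hy : IsJumpProfile y) (hwC : ∀ v, |w v| ≤ C) (c : ℝ) (n : ℕ)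
    {s t : ℝ} (ht : 0 ≤ t) (u : ℝ) :
    |compensatedIncrement y w c n (s, (t, u))| ≤ y (((n : ℝ) + 1) / 2) * (C + |c| * t) := by
  have hC : 0 ≤ C := (abs_nonneg _).trans (hwC 0)
  have hb := hy.nonneg (((n : ℝ) + 1) / 2)
  unfold compensatedIncrement
  by_cases hs : ((n : ℝ) + 1) / 2 ≤ s
  · rw [Set.indicator_of_mem (by exact hs)]
    have hpos : 0 < ((n : ℝ) + 1) / 2 := by positivity
    refine (abs_sub _ _).trans ?_
    rw [abs_mul, abs_mul, abs_of_nonneg (hy.nonneg _), mul_add]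
    refine add_le_add ?_ ?_
    · exact mul_le_mul (hy.le_of_le hpos (by linarith)) (hwC _) (abs_nonneg _) hb
    · have := mul_le_mul_of_nonneg_left (abs_primitive_sub_le hy hpos hs ht) (abs_nonneg c)
      linarith
  · rw [Set.indicator_of_notMem (by exact hs), abs_zero]
    positivity

/-- The mark contributes its mean as a factor, and integration by parts against `e^{-t}` equates the
expected jump with the expected compensator. -/
lemma integral_compensatedIncrement (hy : IsJumpProfile y) (hw : Measurable w)
    (hwC : ∀ v, |w v| ≤ C) (n : ℕ) (s : ℝ) :
    ∫ p, compensatedIncrement y w (∫ v in Set.Icc (0 : ℝ) 1, w v) n (s, p)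
      ∂((expMeasure 1).prod (volume.restrict (Set.Icc (0 : ℝ) 1))) = 0 := by
  have hexp := isProbabilityMeasure_expMeasure (r := 1) one_pos
  have huni := isProbabilityMeasure_uniform
  set c := ∫ v in Set.Icc (0 : ℝ) 1, w v with hc
  unfold compensatedIncrement
  by_cases hs : ((n : ℝ) + 1) / 2 ≤ s
  · have hpos : 0 < s := lt_of_lt_of_le (by positivity) hs
    have hind : ∀ p : ℝ × ℝ, ((s, p) : ℝ × (ℝ × ℝ)) ∈ {p : ℝ × (ℝ × ℝ) | ((n : ℝ) + 1) / 2 ≤ p.1} :=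
      fun p => hs
    simp_rw [Set.indicator_of_mem (hind _)]
    have hwi : Integrable w (volume.restrict (Set.Icc (0 : ℝ) 1)) :=
      Integrable.of_bound hw.aestronglyMeasurable C (ae_of_all _ hwC)
    have hyi : Integrable (fun t => y (s + t)) (expMeasure 1) := by
      refine Integrable.of_bound (hy.measurable.comp (by fun_prop)).aestronglyMeasurable (y s) ?_
      filter_upwards [ae_expMeasure_one_pos] with t ht
      rw [Real.norm_of_nonneg (hy.nonneg _)]
      exact hy.le_of_le hpos (by linarith)
    have hYi : Integrable (fun t => (∫ r in 0..s + t, y r) - ∫ r in 0..s, y r) (expMeasure 1) := by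
      refine ((integrable_pow_expMeasure_one 1).const_mul (y s)).mono' ?_ ?_
      · exact ((hy.continuous_primitive.comp (by fun_prop)).sub
          continuous_const).aestronglyMeasurable
      · filter_upwards [ae_expMeasure_one_pos] with t ht
        rw [pow_one]
        exact abs_primitive_sub_le hy hpos le_rfl ht.le
    have hY0 : ∫ p : ℝ × ℝ, c * ((∫ r in 0..s + p.1, y r) - ∫ r in 0..s, y r)
        ∂((expMeasure 1).prod (volume.restrict (Set.Icc (0 : ℝ) 1)))
        = c * ∫ t, ((∫ r in 0..s + t, y r) - ∫ r in 0..s, y r) ∂expMeasure 1 := by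
      rw [integral_fun_fst (fun t => c * ((∫ r in 0..s + t, y r) - ∫ r in 0..s, y r)),
        integral_const_mul]
      simp
    rw [integral_sub (hyi.mul_prod hwi) ((hYi.comp_fst _).const_mul c), hY0,
      integral_prod_mul (fun t => y (s + t)) w,
      integral_expMeasure_one_sub_primitive (Y := fun x => ∫ r in 0..x, y r) (y := y) (s := s)
        (b := y s)
        (fun t ht => hy.hasDerivAt_primitive (by linarith)) hy.measurable
        (fun t ht => by
          rw [abs_of_nonneg (hy.nonneg _)]; exact hy.le_of_le hpos (by linarith))
        (fun t ht => abs_primitive_sub_le hy hpos le_rfl ht), ← hc]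
    ring
  · have hind : ∀ p : ℝ × ℝ, ((s, p) : ℝ × (ℝ × ℝ)) ∉ {p : ℝ × (ℝ × ℝ) | ((n : ℝ) + 1) / 2 ≤ p.1} :=
      fun p => hs
    simp_rw [Set.indicator_of_notMem (hind _)]
    simp

/-- Almost sure convergence of the centred shot-noise series. -/
lemma IsMarkedPoisson.ae_exists_tendsto_shotNoise (h : IsMarkedPoisson P τ U)
    (hy : IsJumpProfile y) (hw : Measurable w) (hwC : ∀ v, |w v| ≤ C) :
    ∀ᵐ ω ∂P, ∃ l, Tendsto (fun n : ℕ => ∑ i ∈ Finset.range n, y (arrival τ (i + 1) ω) * w (U i ω)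
      - (∫ v in Set.Icc (0 : ℝ) 1, w v) * ∫ r in 0..(n : ℝ), y r) atTop (𝓝 l) := by
  set c := ∫ v in Set.Icc (0 : ℝ) 1, w v with hc
  set D : ℕ → Ω → ℝ := fun n ω =>
    compensatedIncrement y w c n (arrival τ n ω, (τ n ω, U n ω)) with hD
  have hDm : ∀ n, StronglyMeasurable[h.past (n + 1)] (D n) := fun n =>
    ((measurable_compensatedIncrement hy hw c n).comp
      ((h.measurable_past_arrival n.le_succ).prodMk
        (h.measurable_past_pair n.lt_succ_self))).stronglyMeasurable
  have hbound : ∀ n : ℕ, ∀ᵐ ω ∂P, ‖D n ω‖ ≤ y (((n : ℝ) + 1) / 2) * (C + |c| * τ n ω) := by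
    intro n
    filter_upwards [h.ae_time_pos] with ω hω
    exact abs_compensatedIncrement_le hy hwC c n (hω n).le _
  have hdom : ∀ n : ℕ, MemLp (fun ω => y (((n : ℝ) + 1) / 2) * (C + |c| * τ n ω)) 2 P := fun n =>
    ((memLp_const C).add ((h.memLp_time n).const_mul _)).const_mul _
  have hD2 : ∀ n, MemLp (D n) 2 P := fun n =>
    (hdom n).mono' ((hDm n).mono (h.past.le _)).aestronglyMeasurable (hbound n)
  have hD0 : ∀ n, P[D n | h.past n] =ᵐ[P] 0 := fun n =>
    h.condExp_eq_zero (measurable_compensatedIncrement hy hw c n)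
      ((hD2 n).integrable (by norm_num)) (integral_compensatedIncrement hy hw hwC n)
  have hDb : ∀ n : ℕ, ∫ ω, D n ω ^ 2 ∂P
      ≤ (∫ t, (C + |c| * t) ^ 2 ∂expMeasure 1) * y (((n : ℝ) + 1) / 2) ^ 2 := by
    intro n
    calc ∫ ω, D n ω ^ 2 ∂P
        ≤ ∫ ω, (y (((n : ℝ) + 1) / 2) * (C + |c| * τ n ω)) ^ 2 ∂P := by
          refine integral_mono_ae (hD2 n).integrable_sq (hdom n).integrable_sq ?_
          filter_upwards [hbound n] with ω hω
          rw [← sq_abs (D n ω)]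
          exact pow_le_pow_left₀ (abs_nonneg _) hω 2
      _ = _ := by
          simp_rw [mul_pow]
          rw [integral_const_mul, ← h.map_time n,
            integral_map (h.measurable_time n).aemeasurable (by fun_prop), mul_comm]
  have hconv := ae_exists_tendsto_sum_of_condExp_eq_zero hDm hD2 hD0
    (hy.summable_sq.mul_left (∫ t, (C + |c| * t) ^ 2 ∂expMeasure 1)) hDb
  filter_upwards [hconv, h.ae_eventually_half_le_arrival, h.ae_tendsto_integral_arrival hy]
    with ω ⟨l, hl⟩ hev hlim
  obtain ⟨N, hN⟩ := eventually_atTop.1 hev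
  -- With the compensator taken at `Γ_n`, the increments of the centred sum are exactly `D n` once
  -- the truncation is no longer active.
  set V : ℕ → ℝ := fun n => ∑ i ∈ Finset.range n, y (arrival τ (i + 1) ω) * w (U i ω)
    - c * ∫ r in 0..arrival τ n ω, y r with hV
  have hstep : ∀ n ≥ N, V (n + 1) - V n = D n ω := by
    intro n hn
    have : D n ω = y (arrival τ n ω + τ n ω) * w (U n ω)
        - c * ((∫ r in 0..arrival τ n ω + τ n ω, y r) - ∫ r in 0..arrival τ n ω, y r) :=
      Set.indicator_of_mem (by exact hN n hn) _
    rw [this, hV]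
    simp only [Finset.sum_range_succ, arrival_succ]
    ring
  have hVeq : ∀ n ≥ N, V n = ∑ i ∈ Finset.range n, D i ω
      + (V N - ∑ i ∈ Finset.range N, D i ω) := by
    intro n hn
    induction n, hn using Nat.le_induction with
    | base => ring
    | succ n hn ih => rw [Finset.sum_range_succ, ← hstep n hn]; linarith
  have hVlim : Tendsto V atTop (𝓝 (l + (V N - ∑ i ∈ Finset.range N, D i ω))) := by
    refine (hl.add_const _).congr' ?_
    filter_upwards [eventually_ge_atTop N] with n hn
    exact (hVeq n hn).symm
  refine ⟨_, (hVlim.add (hlim.const_mul c)).congr fun n => ?_⟩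
  rw [← intervalIntegral.integral_interval_sub_left (hy.intervalIntegrable 0 _)
    (hy.intervalIntegrable 0 _), hV]
  ring

end Convergence

/-! ### The exponential martingale of a shot-noise series -/

/-- The characteristic function of a mark, at the level given by the jump profile. -/
noncomputable def markCharFun (y W : ℝ → ℝ) (r : ℝ) : ℂ :=
  ∫ v in Set.Icc (0 : ℝ) 1, Complex.exp (((y r * W v : ℝ) : ℂ) * Complex.I)

/-- The compensated exponent of a shot-noise series at time `r`. -/
noncomputable def markExponent (y W : ℝ → ℝ) (r : ℝ) : ℂ :=
  ∫ v in Set.Icc (0 : ℝ) 1, levyIntegrand (fun _ => 1) (W v) (y r)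

/-- The primitive of `markCharFun - 1` that vanishes at the origin. -/
noncomputable def markPrimitive (y W : ℝ → ℝ) (x : ℝ) : ℂ :=
  ∫ r in 0..x, (markCharFun y W r - 1)

section MarkExponent

variable {y W : ℝ → ℝ} {C : ℝ}

lemma measurable_exp_ofReal_mul_I {α : Type*} [MeasurableSpace α] {f : α → ℝ} (hf : Measurable f) :
    Measurable fun a => Complex.exp ((f a : ℂ) * Complex.I) :=
  (by fun_prop : Measurable fun x : ℝ => Complex.exp ((x : ℂ) * Complex.I)).comp hf

lemma integrable_exp_ofReal_mul_I {α : Type*} [MeasurableSpace α] {μ : Measure α}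
    [IsFiniteMeasure μ] {f : α → ℝ} (hf : Measurable f) :
    Integrable (fun a => Complex.exp ((f a : ℂ) * Complex.I)) μ :=
  Integrable.of_bound (measurable_exp_ofReal_mul_I hf).aestronglyMeasurable 1
    (ae_of_all _ fun _ => (Complex.norm_exp_ofReal_mul_I _).le)

lemma norm_markCharFun_le (y W : ℝ → ℝ) (r : ℝ) : ‖markCharFun y W r‖ ≤ 1 := by
  have := isProbabilityMeasure_uniform
  unfold markCharFun
  refine (norm_integral_le_of_norm_le_const (C := 1)
    (ae_of_all _ fun v => (Complex.norm_exp_ofReal_mul_I _).le)).trans ?_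
  simp

lemma measurable_markCharFun (hy : Measurable y) (hW : Measurable W) :
    Measurable (markCharFun y W) := by
  have h : StronglyMeasurable (Function.uncurry fun r v : ℝ =>
      Complex.exp (((y r * W v : ℝ) : ℂ) * Complex.I)) :=
    (measurable_exp_ofReal_mul_I (f := fun p : ℝ × ℝ => y p.1 * W p.2)
      (by fun_prop)).stronglyMeasurable
  exact (h.integral_prod_right (ν := volume.restrict (Set.Icc (0 : ℝ) 1))).measurable

lemma continuousAt_markCharFun (hW : Measurable W) {r : ℝ} (hr : ContinuousAt y r) :
    ContinuousAt (markCharFun y W) r := by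
  refine continuousAt_of_dominated (bound := fun _ => 1) ?_ ?_ (integrable_const _) ?_
  · exact Eventually.of_forall fun s =>
      (measurable_exp_ofReal_mul_I (f := fun v => y s * W v) (by fun_prop)).aestronglyMeasurable
  · exact Eventually.of_forall fun s => ae_of_all _ fun v => (Complex.norm_exp_ofReal_mul_I _).le
  · refine ae_of_all _ fun v => ?_
    exact ContinuousAt.comp (g := fun x : ℝ => Complex.exp (((x * W v : ℝ) : ℂ) * Complex.I))
      (by fun_prop : Continuous _).continuousAt hr

lemma intervalIntegrable_markCharFun_sub_one (hy : Measurable y) (hW : Measurable W) (a b : ℝ) :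
    IntervalIntegrable (fun r => markCharFun y W r - 1) volume a b := by
  have h : ∀ s : Set ℝ, volume s < ∞ → IntegrableOn (fun r => markCharFun y W r - 1) s := by
    intro s hs
    have : IsFiniteMeasure (volume.restrict s) := ⟨by simpa using hs⟩
    refine Integrable.of_bound ((measurable_markCharFun hy hW).sub_const 1).aestronglyMeasurable 2
      (ae_of_all _ fun r => (norm_sub_le _ _).trans ?_)
    rw [norm_one]
    linarith [norm_markCharFun_le y W r]
  exact ⟨h _ measure_Ioc_lt_top, h _ measure_Ioc_lt_top⟩

lemma continuous_markPrimitive (hy : Measurable y) (hW : Measurable W) :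
    Continuous (markPrimitive y W) :=
  intervalIntegral.continuous_primitive (intervalIntegrable_markCharFun_sub_one hy hW) 0

lemma markPrimitive_sub (hy : Measurable y) (hW : Measurable W) (a b : ℝ) :
    markPrimitive y W b - markPrimitive y W a = ∫ r in a..b, (markCharFun y W r - 1) :=
  intervalIntegral.integral_interval_sub_left (intervalIntegrable_markCharFun_sub_one hy hW _ _)
    (intervalIntegrable_markCharFun_sub_one hy hW _ _)

lemma hasDerivAt_markPrimitive (hy : IsJumpProfile y) (hW : Measurable W) {x : ℝ} (hx : 0 < x) :
    HasDerivAt (markPrimitive y W) (markCharFun y W x - 1) x :=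
  intervalIntegral.integral_hasDerivAt_right
    (intervalIntegrable_markCharFun_sub_one hy.measurable hW _ _)
    ((measurable_markCharFun hy.measurable hW).sub_const
      1).stronglyMeasurable.stronglyMeasurableAtFilter
    ((continuousAt_markCharFun hW (hy.continuousAt x hx)).sub_const 1)

lemma neg_le_re_markCharFun_sub_one (hW : Measurable W) (hWC : ∀ v, |W v| ≤ C) (r : ℝ) :
    -(C ^ 2 / 2 * y r ^ 2) ≤ (markCharFun y W r - 1).re := by
  have hu := isProbabilityMeasure_uniform
  have hi : Integrable (fun v => Complex.exp (((y r * W v : ℝ) : ℂ) * Complex.I))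
      (volume.restrict (Set.Icc (0 : ℝ) 1)) :=
    integrable_exp_ofReal_mul_I (f := fun v => y r * W v) (by fun_prop)
  have h1 : (markCharFun y W r).re = ∫ v in Set.Icc (0 : ℝ) 1, Real.cos (y r * W v) := by
    have := integral_re hi
    simp only [RCLike.re_to_complex, Complex.exp_ofReal_mul_I_re] at this
    exact this.symm
  have h2 : ∫ v in Set.Icc (0 : ℝ) 1, (1 - C ^ 2 / 2 * y r ^ 2)
      ≤ ∫ v in Set.Icc (0 : ℝ) 1, Real.cos (y r * W v) := by
    refine integral_mono (integrable_const _) ?_ fun v => ?_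
    · exact (hi.re).congr (ae_of_all _ fun v => by
        simp only [RCLike.re_to_complex, Complex.exp_ofReal_mul_I_re])
    · have h3 := Real.one_sub_sq_div_two_le_cos (x := y r * W v)
      have h4 : W v ^ 2 ≤ C ^ 2 := by rw [← sq_abs]; exact pow_le_pow_left₀ (abs_nonneg _) (hWC v) 2
      have h5 := mul_le_mul_of_nonneg_left h4 (sq_nonneg (y r))
      simp only
      nlinarith
  rw [Complex.sub_re, Complex.one_re, h1]
  simp only [integral_const, probReal_univ, one_smul] at h2
  linarith

/-- From `1 - cos θ ≤ θ²/2` and the square integrability of `y`. The bound does not depend on `a`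
and `b`; it makes the exponential martingale uniformly bounded. -/
lemma neg_re_markPrimitive_sub_le (hy : IsJumpProfile y) (hW : Measurable W)
    (hWC : ∀ v, |W v| ≤ C) {a b : ℝ} (ha : 0 ≤ a) (hab : a ≤ b) :
    -(markPrimitive y W b - markPrimitive y W a).re ≤ C ^ 2 / 2 * ∫ r in Set.Ioi 0, y r ^ 2 := by
  have hint := intervalIntegrable_markCharFun_sub_one hy.measurable hW a b
  have hsq : IntegrableOn (fun r => C ^ 2 / 2 * y r ^ 2) (Set.Ioi 0) :=
    hy.integrableOn_sq.const_mul _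
  have hsub : Set.Ioc a b ⊆ Set.Ioi 0 := Set.Ioc_subset_Ioi_self.trans (Set.Ioi_subset_Ioi ha)
  rw [markPrimitive_sub hy.measurable hW]
  have h1 : (∫ r in a..b, (markCharFun y W r - 1)).re
      = ∫ r in Set.Ioc a b, (markCharFun y W r - 1).re := by
    rw [intervalIntegral.integral_of_le hab]
    exact (integral_re hint.1).symm
  rw [h1, ← integral_neg, ← integral_const_mul]
  calc ∫ r in Set.Ioc a b, -(markCharFun y W r - 1).re
      ≤ ∫ r in Set.Ioc a b, C ^ 2 / 2 * y r ^ 2 := by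
        refine integral_mono hint.1.re.neg (hsq.mono_set hsub) fun r => ?_
        simp only
        linarith [neg_le_re_markCharFun_sub_one (y := y) hW hWC r]
    _ ≤ _ := setIntegral_mono_set hsq (ae_of_all _ fun r => by positivity) hsub.eventuallyLE

lemma norm_exp_sub_markPrimitive_le (hy : IsJumpProfile y) (hW : Measurable W)
    (hWC : ∀ v, |W v| ≤ C) {a b : ℝ} (ha : 0 ≤ a) (hab : a ≤ b) (x : ℝ) :
    ‖Complex.exp ((x : ℂ) * Complex.I - (markPrimitive y W b - markPrimitive y W a))‖
      ≤ Real.exp (C ^ 2 / 2 * ∫ r in Set.Ioi 0, y r ^ 2) := by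
  rw [Complex.norm_exp, Complex.sub_re]
  refine Real.exp_le_exp.2 ?_
  have := neg_re_markPrimitive_sub_le hy hW hWC ha hab
  have h0 : ((x : ℂ) * Complex.I).re = 0 := by simp
  rw [h0]
  linarith

/-- The exponential martingale has mean-one factors. -/
lemma integral_exp_sub_markPrimitive (hy : IsJumpProfile y) (hW : Measurable W)
    (hWC : ∀ v, |W v| ≤ C) {s : ℝ} (hs : 0 ≤ s) :
    ∫ p, Complex.exp (((y (s + p.1) * W p.2 : ℝ) : ℂ) * Complex.I
        - (markPrimitive y W (s + p.1) - markPrimitive y W s))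
      ∂((expMeasure 1).prod (volume.restrict (Set.Icc (0 : ℝ) 1))) = 1 := by
  have hexp := isProbabilityMeasure_expMeasure (r := 1) one_pos
  have huni := isProbabilityMeasure_uniform
  set K := Real.exp (C ^ 2 / 2 * ∫ r in Set.Ioi 0, y r ^ 2) with hK
  have hQ := (continuous_markPrimitive hy.measurable hW).measurable
  have hym := hy.measurable
  have hint : Integrable (fun p : ℝ × ℝ => Complex.exp (((y (s + p.1) * W p.2 : ℝ) : ℂ) * Complex.I
      - (markPrimitive y W (s + p.1) - markPrimitive y W s)))
      ((expMeasure 1).prod (volume.restrict (Set.Icc (0 : ℝ) 1))) := by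
    refine Integrable.of_bound (by fun_prop) K ?_
    have := Measure.quasiMeasurePreserving_fst (μ := expMeasure 1)
      (ν := volume.restrict (Set.Icc (0 : ℝ) 1)) |>.ae ae_expMeasure_one_pos
    filter_upwards [this] with p hp
    exact norm_exp_sub_markPrimitive_le hy hW hWC hs (by linarith) _
  rw [integral_prod _ hint]
  set F : ℝ → ℂ := fun t =>
    Complex.exp (-(t : ℂ) - (markPrimitive y W (s + t) - markPrimitive y W s)) with hF
  have e : ∀ t : ℝ, Real.exp (-t) • ∫ v in Set.Icc (0 : ℝ) 1,
      Complex.exp (((y (s + t) * W v : ℝ) : ℂ) * Complex.I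
        - (markPrimitive y W (s + t) - markPrimitive y W s)) = markCharFun y W (s + t) * F t := by
    intro t
    simp_rw [sub_eq_add_neg (((y (s + t) * W _ : ℝ) : ℂ) * Complex.I), Complex.exp_add]
    rw [integral_mul_const, hF, Complex.real_smul]
    simp only
    rw [sub_eq_add_neg (-(t : ℂ)), Complex.exp_add, Complex.ofReal_exp, Complex.ofReal_neg]
    unfold markCharFun
    ring
  have hFn : ∀ t, 0 ≤ t → ‖F t‖ ≤ K * Real.exp (-t) := by
    intro t ht
    have h1 := norm_exp_sub_markPrimitive_le hy hW hWC hs (show s ≤ s + t by linarith) 0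
    rw [hF]
    simp only
    rw [sub_eq_add_neg (-(t : ℂ)), Complex.exp_add, norm_mul, mul_comm]
    have h2 : ‖Complex.exp (-(t : ℂ))‖ = Real.exp (-t) := by
      rw [Complex.norm_exp]; simp
    rw [h2]
    gcongr
    simpa using h1
  have hFc : Continuous F := by
    have := continuous_markPrimitive (y := y) hy.measurable hW
    fun_prop
  -- The integrand is an exact derivative: the factor `e^{-t}` cancels the `-1` in `markCharFun -
  -- 1`. The integral is therefore `F(0) - F(∞) = 1`.
  have hF' : ∀ t ∈ Set.Ioi (0 : ℝ), HasDerivAt (fun t => -F t) (markCharFun y W (s + t) * F t) t := by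
    intro t ht
    have ht' : 0 < s + t := by have : 0 < t := ht
                               linarith
    have h1 := ((hasDerivAt_markPrimitive hy hW ht').comp_const_add s t).sub_const
      (markPrimitive y W s)
    have h2 : HasDerivAt (fun t : ℝ => -(t : ℂ)) (-1) t := by
      simpa using (hasDerivAt_id t).ofReal_comp.fun_neg
    refine (h2.sub h1).cexp.neg.congr_deriv ?_
    simp only [hF, Pi.sub_apply]
    ring
  have hFi : IntegrableOn (fun t => markCharFun y W (s + t) * F t) (Set.Ioi 0) := by
    have h1 : IntegrableOn (fun t : ℝ => K * Real.exp (-t)) (Set.Ioi 0) :=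
      (integrableOn_exp_neg_Ioi 0).const_mul K
    have h2 := measurable_markCharFun hy.measurable hW
    have h3 := hFc.measurable
    refine h1.mono' (by fun_prop) ?_
    filter_upwards [ae_restrict_mem measurableSet_Ioi] with t ht
    rw [norm_mul]
    exact (mul_le_of_le_one_left (norm_nonneg _) (norm_markCharFun_le y W _)).trans
      (hFn t (le_of_lt ht))
  rw [integral_expMeasure_one]
  simp_rw [e]
  rw [integral_Ioi_of_hasDerivAt_of_tendsto hFc.neg.continuousWithinAt hF' hFi (m := 0)]
  · simp [hF]
  · have h0 : Tendsto (fun t : ℝ => K * Real.exp (-t)) atTop (𝓝 0) := by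
      simpa using (Real.tendsto_exp_neg_atTop_nhds_zero).const_mul K
    refine squeeze_zero_norm' ?_ h0
    filter_upwards [eventually_ge_atTop 0] with t ht
    change ‖-F t‖ ≤ _
    rw [norm_neg]
    exact hFn t ht

lemma norm_markExponent_le (hWC : ∀ v, |W v| ≤ C) (r : ℝ) :
    ‖markExponent y W r‖ ≤ 2 * C ^ 2 * y r ^ 2 := by
  have := isProbabilityMeasure_uniform
  refine (norm_integral_le_of_norm_le_const (C := 2 * C ^ 2 * y r ^ 2)
    (ae_of_all _ fun v => (norm_levyIntegrand_one_le _ _).trans ?_)).trans (by simp)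
  have h4 : W v ^ 2 ≤ C ^ 2 := by rw [← sq_abs]; exact pow_le_pow_left₀ (abs_nonneg _) (hWC v) 2
  gcongr

/-- `y` need not be integrable at infinity, so the first-order term is split off; the remainder
`markExponent` is of order `y²` and integrable. -/
lemma markCharFun_sub_one_eq (hW : Measurable W) (hWC : ∀ v, |W v| ≤ C) (r : ℝ) :
    markCharFun y W r - 1 = markExponent y W r
      + ((∫ v in Set.Icc (0 : ℝ) 1, W v : ℝ) : ℂ) * Complex.I * (y r : ℂ) := by
  have hu := isProbabilityMeasure_uniform
  have hi : Integrable (fun v => Complex.exp (((y r * W v : ℝ) : ℂ) * Complex.I))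
      (volume.restrict (Set.Icc (0 : ℝ) 1)) :=
    integrable_exp_ofReal_mul_I (f := fun v => y r * W v) (by fun_prop)
  have hWi : Integrable (fun v => (W v : ℂ)) (volume.restrict (Set.Icc (0 : ℝ) 1)) :=
    (Integrable.of_bound hW.aestronglyMeasurable C (ae_of_all _ hWC)).ofReal
  have e : ∀ v, levyIntegrand (fun _ => 1) (W v) (y r)
      = Complex.exp (((y r * W v : ℝ) : ℂ) * Complex.I) - 1 - (W v : ℂ) * (Complex.I * y r) := by
    intro v
    unfold levyIntegrand; push_cast; ring_nf
  unfold markExponent markCharFun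
  simp_rw [e]
  have hi1 : Integrable (fun v => Complex.exp (((y r * W v : ℝ) : ℂ) * Complex.I) - 1)
      (volume.restrict (Set.Icc (0 : ℝ) 1)) := hi.sub (integrable_const _)
  rw [integral_sub hi1 (hWi.mul_const _),
    integral_sub hi (integrable_const _), integral_mul_const, integral_complex_ofReal]
  simp
  ring

lemma integrableOn_markExponent (hy : IsJumpProfile y) (hW : Measurable W)
    (hWC : ∀ v, |W v| ≤ C) : IntegrableOn (markExponent y W) (Set.Ioi 0) := by
  have hm : Measurable (markExponent y W) := by
    have h : markExponent y W = fun r => markCharFun y W r - 1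
        - ((∫ v in Set.Icc (0 : ℝ) 1, W v : ℝ) : ℂ) * Complex.I * (y r : ℂ) := by
      ext r; rw [markCharFun_sub_one_eq hW hWC]; ring
    rw [h]
    have := measurable_markCharFun hy.measurable hW
    have := hy.measurable
    fun_prop
  exact (hy.integrableOn_sq.const_mul (2 * C ^ 2)).mono' hm.aestronglyMeasurable
    (ae_of_all _ fun r => norm_markExponent_le hWC r)

lemma markPrimitive_eq (hy : IsJumpProfile y) (hW : Measurable W) (hWC : ∀ v, |W v| ≤ C) {x : ℝ}
    (hx : 0 ≤ x) :
    markPrimitive y W x = (∫ r in 0..x, markExponent y W r)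
      + (((∫ v in Set.Icc (0 : ℝ) 1, W v) * ∫ r in 0..x, y r : ℝ) : ℂ) * Complex.I := by
  have h1 : IntervalIntegrable (markExponent y W) volume 0 x :=
    (intervalIntegrable_iff_integrableOn_Ioc_of_le hx).2
      ((integrableOn_markExponent hy hW hWC).mono_set Set.Ioc_subset_Ioi_self)
  have h2 : IntervalIntegrable (fun r => (y r : ℂ)) volume 0 x :=
    ⟨(hy.intervalIntegrable 0 x).1.ofReal, (hy.intervalIntegrable 0 x).2.ofReal⟩
  unfold markPrimitive
  simp_rw [markCharFun_sub_one_eq hW hWC]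
  rw [intervalIntegral.integral_add h1 (h2.const_mul _), intervalIntegral.integral_const_mul,
    intervalIntegral.integral_ofReal]
  push_cast
  ring

end MarkExponent

section ExponentialMartingale

variable {Ω : Type*} [MeasurableSpace Ω] {P : Measure Ω}
  {τ U : ℕ → Ω → ℝ} {y W : ℝ → ℝ} {C : ℝ}

/-- The exponential martingale of a shot-noise series. -/
noncomputable def expMartingale {Ω : Type*} (τ U : ℕ → Ω → ℝ) (y W : ℝ → ℝ) (n : ℕ) (ω : Ω) : ℂ :=
  Complex.exp (((∑ i ∈ Finset.range n, y (arrival τ (i + 1) ω) * W (U i ω) : ℝ) : ℂ) * Complex.I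
    - markPrimitive y W (arrival τ n ω))

lemma IsMarkedPoisson.measurable_expMartingale (h : IsMarkedPoisson P τ U) (hy : IsJumpProfile y)
    (hW : Measurable W) (n : ℕ) : Measurable[h.past n] (expMartingale τ U y W n) := by
  have h1 : Measurable[h.past n]
      fun ω => ∑ i ∈ Finset.range n, y (arrival τ (i + 1) ω) * W (U i ω) := by
    refine Finset.measurable_fun_sum _ fun i hi => ?_
    have hi' := Finset.mem_range.1 hi
    exact (hy.measurable.comp (h.measurable_past_arrival hi')).mul
      (hW.comp (h.measurable_past_mark hi'))
  have h2 := (continuous_markPrimitive hy.measurable hW).measurable.comp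
    (h.measurable_past_arrival (le_refl n))
  exact Complex.measurable_exp.comp
    (((Complex.measurable_ofReal.comp h1).mul_const _).sub h2)

lemma IsMarkedPoisson.ae_norm_expMartingale_le (h : IsMarkedPoisson P τ U) (hy : IsJumpProfile y)
    (hW : Measurable W) (hWC : ∀ v, |W v| ≤ C) :
    ∀ᵐ ω ∂P, ∀ n, ‖expMartingale τ U y W n ω‖
      ≤ Real.exp (C ^ 2 / 2 * ∫ r in Set.Ioi 0, y r ^ 2) := by
  filter_upwards [h.ae_arrival_nonneg] with ω hω n
  have h1 := norm_exp_sub_markPrimitive_le hy hW hWC le_rfl (hω n)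
    (∑ i ∈ Finset.range n, y (arrival τ (i + 1) ω) * W (U i ω))
  have h0 : markPrimitive y W 0 = 0 := intervalIntegral.integral_same
  rwa [h0, sub_zero] at h1

lemma IsMarkedPoisson.integral_expMartingale [IsProbabilityMeasure P]
    (h : IsMarkedPoisson P τ U) (hy : IsJumpProfile y)
    (hW : Measurable W) (hWC : ∀ v, |W v| ≤ C) (n : ℕ) :
    ∫ ω, expMartingale τ U y W n ω ∂P = 1 := by
  have h0 : markPrimitive y W 0 = 0 := intervalIntegral.integral_same
  induction n with
  | zero => simp [expMartingale, arrival, h0]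
  | succ n ih =>
    have hQ := (continuous_markPrimitive hy.measurable hW).measurable
    have hym := hy.measurable
    have hYp : Measurable[h.past n] fun ω => (expMartingale τ U y W n ω, arrival τ n ω) :=
      (h.measurable_expMartingale hy hW n).prodMk (h.measurable_past_arrival le_rfl)
    have hY := hYp.mono (h.past.le n) le_rfl
    have hV := (h.measurable_time n).prodMk (h.measurable_mark n)
    set f : (ℂ × ℝ) × (ℝ × ℝ) → ℂ := fun q => q.1.1 * Complex.exp
      (((y (q.1.2 + q.2.1) * W q.2.2 : ℝ) : ℂ) * Complex.I
        - (markPrimitive y W (q.1.2 + q.2.1) - markPrimitive y W q.1.2)) with hf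
    have hfm : Measurable f := by fun_prop
    have e : ∀ ω, expMartingale τ U y W (n + 1) ω
        = f ((expMartingale τ U y W n ω, arrival τ n ω), (τ n ω, U n ω)) := by
      intro ω
      simp only [hf, expMartingale]
      rw [← Complex.exp_add, Finset.sum_range_succ, arrival_succ]
      congr 1
      push_cast
      ring
    have hi : Integrable (fun ω => expMartingale τ U y W (n + 1) ω) P := by
      refine Integrable.of_bound ((h.measurable_expMartingale hy hW (n + 1)).mono
        (h.past.le _) le_rfl).aestronglyMeasurable
          (Real.exp (C ^ 2 / 2 * ∫ r in Set.Ioi 0, y r ^ 2)) ?_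
      filter_upwards [h.ae_norm_expMartingale_le hy hW hWC] with ω hω
      exact hω (n + 1)
    simp_rw [e] at hi ⊢
    rw [(h.indepFun_past hYp).integral_eq_integral_integral hY hV hfm hi, h.law n, ← ih]
    refine integral_congr_ae ?_
    filter_upwards [h.ae_arrival_nonneg] with ω hω
    simp only [hf]
    rw [integral_const_mul, integral_exp_sub_markPrimitive hy hW hWC (hω n), mul_one]

/-- The characteristic function of the limit of a centred shot-noise series. -/
lemma IsMarkedPoisson.integral_exp_limit [IsProbabilityMeasure P]
    (h : IsMarkedPoisson P τ U) (hy : IsJumpProfile y)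
    (hW : Measurable W) (hWC : ∀ v, |W v| ≤ C) {L : Ω → ℝ}
    (hL : ∀ᵐ ω ∂P, Tendsto (fun n : ℕ => ∑ i ∈ Finset.range n,
      y (arrival τ (i + 1) ω) * W (U i ω)
        - (∫ v in Set.Icc (0 : ℝ) 1, W v) * ∫ r in 0..(n : ℝ), y r) atTop (𝓝 (L ω))) :
    ∫ ω, Complex.exp ((L ω : ℂ) * Complex.I) ∂P
      = Complex.exp (∫ r in Set.Ioi 0, markExponent y W r) := by
  set c := ∫ v in Set.Icc (0 : ℝ) 1, W v with hc
  set θ := ∫ r in Set.Ioi 0, markExponent y W r with hθ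
  -- The first-order part of `markPrimitive` joins the sum to form the centred series with
  -- compensator at `Γ_n`, which tends to `L`; the remaining part tends to `θ` because `Γ_n → ∞`.
  have hlim : Tendsto (fun n => ∫ ω, expMartingale τ U y W n ω ∂P) atTop
      (𝓝 (∫ ω, Complex.exp ((L ω : ℂ) * Complex.I - θ) ∂P)) := by
    refine tendsto_integral_of_dominated_convergence
      (fun _ => Real.exp (C ^ 2 / 2 * ∫ r in Set.Ioi 0, y r ^ 2))
      (fun n => ((h.measurable_expMartingale hy hW n).mono
        (h.past.le _) le_rfl).aestronglyMeasurable) (integrable_const _) (fun n => ?_) ?_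
    · filter_upwards [h.ae_norm_expMartingale_le hy hW hWC] with ω hω
      exact hω n
    · filter_upwards [hL, h.ae_tendsto_integral_arrival hy, h.ae_tendsto_arrival,
        h.ae_arrival_nonneg] with ω h1 h2 h3 h4
      have h5 : Tendsto (fun n : ℕ => ∑ i ∈ Finset.range n, y (arrival τ (i + 1) ω) * W (U i ω)
          - c * ∫ r in 0..arrival τ n ω, y r) atTop (𝓝 (L ω)) := by
        have := h1.sub (h2.const_mul c)
        rw [mul_zero, sub_zero] at this
        refine this.congr fun n => ?_
        rw [← intervalIntegral.integral_interval_sub_left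
          (hy.intervalIntegrable 0 (arrival τ n ω)) (hy.intervalIntegrable 0 n)]
        ring
      have h6 := intervalIntegral_tendsto_integral_Ioi 0
        (integrableOn_markExponent hy hW hWC) h3
      have h7 := (Complex.continuous_exp.tendsto _).comp
        (((Complex.continuous_ofReal.tendsto _).comp h5).mul_const Complex.I |>.sub h6)
      refine h7.congr fun n => ?_
      simp only [Function.comp_apply, expMartingale]
      rw [markPrimitive_eq hy hW hWC (h4 n), ← hc]
      congr 1
      push_cast
      ring
  simp_rw [h.integral_expMartingale hy hW hWC] at hlim
  have h1 := tendsto_nhds_unique hlim tendsto_const_nhds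
  simp_rw [Complex.exp_sub] at h1
  rw [integral_div, div_eq_one_iff_eq (Complex.exp_ne_zero _)] at h1
  exact h1

end ExponentialMartingale

/-! ### The primitives of the Karhunen-Loève basis functions -/

/-- The primitive of `-e_k` that vanishes at `T`. -/
noncomputable def klPrimitive (T : ℝ) (k : ℕ) (t : ℝ) : ℝ :=
  √(2 * T) / Real.pi * (Real.cos (Real.pi / T * halfIndex k * t) / halfIndex k)

lemma continuous_klPrimitive (T : ℝ) (k : ℕ) : Continuous (klPrimitive T k) := by
  unfold klPrimitive; fun_prop

lemma abs_klPrimitive_le (T : ℝ) (k : ℕ) (t : ℝ) :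
    |klPrimitive T k t| ≤ √(2 * T) / Real.pi / halfIndex k := by
  have hk := halfIndex_pos k
  unfold klPrimitive
  rw [abs_mul, abs_div, abs_div, abs_of_pos hk, abs_of_nonneg (Real.sqrt_nonneg _),
    abs_of_pos Real.pi_pos, mul_div_assoc']
  gcongr
  exact mul_le_of_le_one_right (by positivity) (Real.abs_cos_le_one _)

lemma klPrimitive_end {T : ℝ} (hT : 0 < T) (k : ℕ) : klPrimitive T k T = 0 := by
  unfold klPrimitive; rw [cos_halfIndex_freq hT]; simp

lemma hasDerivAt_klPrimitive {T : ℝ} (hT : 0 < T) (k : ℕ) (t : ℝ) :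
    HasDerivAt (klPrimitive T k) (-klEigenfunction T k t) t := by
  have hk := halfIndex_pos k
  have hm : HasDerivAt (fun t => Real.pi / T * halfIndex k * t) (Real.pi / T * halfIndex k) t := by
    simpa using (hasDerivAt_id t).const_mul (Real.pi / T * halfIndex k)
  refine ((hm.cos.div_const (halfIndex k)).const_mul (√(2 * T) / Real.pi)).congr_deriv ?_
  have hs : √(2 / T) = √(2 * T) / T := by
    rw [show 2 / T = 2 * T / T ^ 2 by field_simp, Real.sqrt_div (by positivity),
      Real.sqrt_sq hT.le]
  unfold klEigenfunction
  rw [hs]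
  field_simp

lemma integral_klPrimitive {T : ℝ} (hT : 0 < T) (k : ℕ) :
    ∫ t in 0..T, klPrimitive T k t
      = (-1) ^ ((k + 1) + 1) * √2 * T ^ (3 / 2 : ℝ) / (Real.pi ^ 2 * halfIndex k ^ 2) := by
  have hk := halfIndex_pos k
  have hc : Real.pi / T * halfIndex k ≠ 0 := by positivity
  unfold klPrimitive
  rw [intervalIntegral.integral_const_mul, intervalIntegral.integral_div,
    intervalIntegral.integral_comp_mul_left (fun x => Real.cos x) hc, integral_cos,
    sin_halfIndex_freq hT, mul_zero, Real.sin_zero, sub_zero, smul_eq_mul]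
  have h1 : T ^ (3 / 2 : ℝ) = T * √T := by
    rw [show (3 / 2 : ℝ) = 1 + 1 / 2 by norm_num, Real.rpow_add hT, Real.rpow_one,
      Real.sqrt_eq_rpow]
  have h2 : √(2 * T) = √2 * √T := Real.sqrt_mul (by norm_num) T
  rw [h1, h2]
  field_simp
  ring

lemma klDrift_apply {T : ℝ} (hT : 0 < T) (a : ℝ) (d : ℕ) (k : Fin d) :
    klDrift a T d k = a * ∫ t in 0..T, klPrimitive T k t := by
  rw [integral_klPrimitive hT]; rfl

lemma klJump_apply (T : ℝ) (d : ℕ) (x t : ℝ) (k : Fin d) :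
    klJump T d x t k = x * klPrimitive T k t := by
  unfold klJump klPrimitive
  simp only
  ring

/-- Jump size and mark separate, so each coordinate, and each linear combination of coordinates, is
a scalar series with the common profile `jumpSize ρ T`. -/
lemma shotNoiseKernel_apply (ρ : ℝ → ℝ) (T : ℝ) (d : ℕ) (r v : ℝ) (k : Fin d) :
    shotNoiseKernel ρ T d r v k = jumpSize ρ T r * klPrimitive T k (T * v) := by
  unfold shotNoiseKernel
  rw [klJump_apply]
  rfl

lemma integral_comp_mul_unit {E : Type*} [NormedAddCommGroup E] [NormedSpace ℝ E] {T : ℝ}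
    (hT : 0 < T) (f : ℝ → E) :
    T • ∫ v in Set.Icc (0 : ℝ) 1, f (T * v) = ∫ t in 0..T, f t := by
  rw [integral_Icc_eq_integral_Ioc, ← intervalIntegral.integral_of_le zero_le_one,
    intervalIntegral.integral_comp_mul_left f hT.ne', smul_inv_smul₀ hT.ne', mul_zero, mul_one]

lemma shotNoiseCompensator_apply (ρ : ℝ → ℝ) (T : ℝ) (d : ℕ) (s : ℝ) (k : Fin d) :
    shotNoiseCompensator ρ T d s k
      = (∫ v in Set.Icc (0 : ℝ) 1, klPrimitive T k (T * v)) * ∫ r in 0..s, jumpSize ρ T r := by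
  unfold shotNoiseCompensator
  simp only [shotNoiseKernel_apply]
  simp_rw [intervalIntegral.integral_const_mul]
  rw [intervalIntegral.integral_mul_const, mul_comm, integral_Icc_eq_integral_Ioc,
    intervalIntegral.integral_of_le zero_le_one]

lemma isJumpProfile_jumpSize {ρ : ℝ → ℝ} (hρ : IsPositiveLevyDensity ρ) {T : ℝ} (hT : 0 < T)
    (hν : Integrable (fun x => x ^ 2) (densityMeasure ρ)) : IsJumpProfile (jumpSize ρ T) where
  nonneg := jumpSize_nonneg hρ hT
  eq_zero _ hr := jumpSize_of_nonpos ρ T hr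
  antitoneOn := jumpSize_antitoneOn hρ hT
  continuousAt _ hr := jumpSize_continuousAt hρ hT hr
  measurable := measurable_jumpSize hρ hT
  integrableOn_sq := integrableOn_comp_jumpSize hρ hT (F := fun x => x ^ 2) (by simp) hν

lemma integrableOn_shotNoiseKernel {ρ : ℝ → ℝ} {T : ℝ} (hy : IsJumpProfile (jumpSize ρ T))
    (d : ℕ) (s : ℝ) :
    IntegrableOn (fun p : ℝ × ℝ => shotNoiseKernel ρ T d p.1 p.2)
      (Set.Ioc (0 : ℝ) s ×ˢ Set.Icc (0 : ℝ) 1) := by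
  have hcont : Continuous fun v => klJump T d 1 (T * v) := by
    unfold klJump
    fun_prop
  have e : (fun p : ℝ × ℝ => shotNoiseKernel ρ T d p.1 p.2)
      = fun p => jumpSize ρ T p.1 • klJump T d 1 (T * p.2) := by
    ext p k
    rw [shotNoiseKernel_apply, PiLp.smul_apply, klJump_apply, smul_eq_mul, one_mul]
  rw [e, IntegrableOn, Measure.volume_eq_prod, ← Measure.prod_restrict]
  exact (hy.intervalIntegrable 0 s).1.smul_prod (hcont.integrableOn_Icc)

/-! ### The Poisson sequence of the theorem -/

lemma IsUnitPoissonArrivals.exists_isMarkedPoisson {Ω : Type*} [MeasurableSpace Ω] {P : Measure Ω}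
    [IsProbabilityMeasure P] {Γ U : ℕ → Ω → ℝ} (hΓ : IsUnitPoissonArrivals P Γ)
    (hU : IsIIDUniform P U) (hΓU : IndepFun (fun ω i => Γ i ω) (fun ω i => U i ω) P) :
    ∃ τ : ℕ → Ω → ℝ, IsMarkedPoisson P τ U ∧ ∀ n ω, Γ n ω = arrival τ (n + 1) ω := by
  obtain ⟨τ, hτm, hτi, hτl, hτ⟩ := hΓ
  have hseq : IndepFun (fun ω i => τ i ω) (fun ω i => U i ω) P := by
    -- The interarrival times are recovered as differences of the arrival times, so independence
    -- from the marks carries over.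
    let g : (ℕ → ℝ) → (ℕ → ℝ) := fun x n => x n - if n = 0 then 0 else x (n - 1)
    have hg : Measurable g := by
      refine measurable_pi_lambda _ fun n => ?_
      rcases n with _ | n
      · simpa [g] using measurable_pi_apply 0
      · simpa [g] using (measurable_pi_apply (n + 1)).fun_sub (measurable_pi_apply n)
    have e : (fun ω i => τ i ω) = g ∘ fun ω i => Γ i ω := by
      ext ω n
      rcases n with _ | n
      · simp [g, hτ]
      · simp [g, hτ, Finset.sum_range_succ _ (n + 1)]
    rw [e]
    exact hΓU.comp hg measurable_id
  refine ⟨τ, ⟨hτm, hU.measurable, iIndepFun_prodMk_of_indepFun hτm hU.measurable hτi hU.indep hseq,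
    fun n => ?_⟩, hτ⟩
  have hn := hseq.comp (measurable_pi_apply n) (measurable_pi_apply n)
  have := (indepFun_iff_map_prod_eq_prod_map_map (hτm n).aemeasurable
    (hU.measurable n).aemeasurable).1 hn
  rw [this, (hτl n).map_eq, (hU.law n).map_eq]

/-! ### Change of the cut-off function -/

lemma integrable_id_of_smallJumps {ν : Measure ℝ} (h1 : HasIntegrableSmallJumps ν)
    (h2 : Integrable (fun x => x ^ 2) ν) : Integrable (fun x => x) ν := by
  have hm : MeasurableSet {x : ℝ | |x| ≤ 1} := measurableSet_le (by fun_prop) measurable_const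
  rw [← integrableOn_univ, ← Set.union_compl_self {x : ℝ | |x| ≤ 1}]
  refine IntegrableOn.union ⟨by fun_prop, ?_⟩ ?_
  · refine lt_of_eq_of_lt (lintegral_congr fun x => ?_) h1
    exact Real.enorm_eq_ofReal_abs x
  · refine h2.integrableOn.mono' (by fun_prop) ?_
    filter_upwards [ae_restrict_mem hm.compl] with x hx
    have hx' : 1 < |x| := not_le.1 hx
    rw [Real.norm_eq_abs, ← sq_abs]
    nlinarith

/-- The first moment of `ν` moves into the drift, which reduces `h ≡ 0` to `h ≡ 1`. -/
lemma HasGeneratingTriple.compensate {Ω : Type*} [MeasurableSpace Ω] {P : Measure Ω}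
    {X : ℝ≥0 → Ω → ℝ} {a : ℝ} {ν : Measure ℝ} (h : HasGeneratingTriple P X (fun _ => 0) a 0 ν)
    (hν : Integrable (fun x => x) ν) :
    HasGeneratingTriple P X (fun _ => 1) (a + ∫ x, x ∂ν) 0 ν := by
  have e : ∀ z x, levyIntegrand (fun _ => 1) z x
      = levyIntegrand (fun _ => 0) z x - Complex.I * z * (x : ℂ) := by
    intro z x; unfold levyIntegrand; push_cast; ring
  have hc : Integrable (fun x : ℝ => (x : ℂ)) ν := hν.ofReal
  refine ⟨le_rfl, h.levyMeasure, fun z => ?_, fun t z => ?_⟩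
  · exact ((h.integrable z).sub (hc.const_mul (Complex.I * z))).congr
      (ae_of_all _ fun x => (e z x).symm)
  · rw [h.charFun_eq]
    congr 2
    unfold levyExponent
    simp_rw [e]
    rw [integral_sub (h.integrable z) (hc.const_mul _), integral_const_mul,
      integral_complex_ofReal]
    push_cast
    ring

/-! ### The shot-noise representation -/

section Representation

variable {Ω : Type*} [MeasurableSpace Ω] {P : Measure Ω} {X : ℝ≥0 → Ω → ℝ} {T : ℝ} {d : ℕ}

/-- The linear combination of the primitives that belongs to a dual vector. -/
noncomputable def dualPrimitive (T : ℝ) {d : ℕ} (ξ : EuclideanSpace ℝ (Fin d)) (t : ℝ) : ℝ :=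
  ∑ k : Fin d, ξ k * klPrimitive T k t

lemma continuous_dualPrimitive (T : ℝ) (ξ : EuclideanSpace ℝ (Fin d)) :
    Continuous (dualPrimitive T ξ) :=
  continuous_finsetSum _ fun k _ => (continuous_klPrimitive T k).const_mul _

lemma exists_abs_dualPrimitive_le (T : ℝ) (ξ : EuclideanSpace ℝ (Fin d)) :
    ∃ C, ∀ t, |dualPrimitive T ξ t| ≤ C := by
  refine ⟨∑ k : Fin d, |ξ k| * (√(2 * T) / Real.pi / halfIndex k), fun t => ?_⟩
  refine (Finset.abs_sum_le_sum_abs _ _).trans (Finset.sum_le_sum fun k _ => ?_)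
  rw [abs_mul]
  gcongr
  exact abs_klPrimitive_le T k t

lemma inner_eq_sum_mul (x ξ : EuclideanSpace ℝ (Fin d)) : inner ℝ x ξ = ∑ k, ξ k * x k := by
  rw [PiLp.inner_apply]
  rfl

lemma IsLevyProcess.aemeasurable_klCoefficients (hX : IsLevyProcess P X) (hT : 0 < T) (d : ℕ) :
    AEMeasurable (klCoefficients X T d) P := by
  unfold klCoefficients
  refine (WithLp.measurable_toLp 2 _).comp_aemeasurable (aemeasurable_pi_iff.2 fun k => ?_)
  exact hX.aemeasurable_integral hT (continuous_klEigenfunction T k)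

/-- Linear combinations of the stochastic coefficients are path integrals. -/
lemma IsLevyProcess.ae_inner_klCoefficients (hX : IsLevyProcess P X) (hT : 0 < T)
    (ξ : EuclideanSpace ℝ (Fin d)) :
    ∀ᵐ ω ∂P, inner ℝ (klCoefficients X T d ω) ξ
      = ∫ t in 0..T, X t.toNNReal ω * ∑ k : Fin d, ξ k * klEigenfunction T k t := by
  have hφ : Continuous fun t => ∑ k : Fin d, ξ k * klEigenfunction T k t :=
    continuous_finsetSum _ fun k _ => (continuous_klEigenfunction T k).const_mul _
  have hall : ∀ᵐ ω ∂P, ∀ k : Fin d, Tendsto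
      (fun n => ∫ t in 0..T, X (rightGrid T n t).toNNReal ω * klEigenfunction T k t) atTop
      (𝓝 (∫ t in 0..T, X t.toNNReal ω * klEigenfunction T k t)) :=
    ae_all_iff.2 fun k => hX.tendsto_integral_rightGrid hT (continuous_klEigenfunction T k)
  filter_upwards [hall, hX.tendsto_integral_rightGrid hT hφ] with ω h1 h2
  rw [inner_eq_sum_mul]
  -- Linearity is checked on the Riemann sums, where it is a finite computation, and passed to the
  -- limit.
  refine tendsto_nhds_unique (tendsto_finsetSum _ fun k _ => (h1 k).const_mul (ξ k)) ?_
  refine h2.congr fun n => ?_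
  rw [integral_rightGrid_path hT hφ]
  simp_rw [integral_rightGrid_path hT (continuous_klEigenfunction T _), Finset.mul_sum]
  rw [Finset.sum_comm]
  refine Finset.sum_congr rfl fun j _ => ?_
  rw [intervalIntegral.integral_finsetSum fun (k : Fin d) _ =>
    ((continuous_klEigenfunction T k).const_mul (ξ k)).intervalIntegrable _ _, Finset.mul_sum]
  refine Finset.sum_congr rfl fun k _ => ?_
  rw [intervalIntegral.integral_const_mul]
  ring

/-- The characteristic function of the stochastic coefficients. -/
lemma IsLevyProcess.charFun_klCoefficients [IsProbabilityMeasure P] (hX : IsLevyProcess P X)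
    (hT : 0 < T) {Ψ : ℝ → ℂ}
    (hΨ : ∀ (t : ℝ≥0) (z : ℝ), charFun (P.map (X t)) z = Complex.exp (-((t : ℝ) : ℂ) * Ψ z))
    (hΨc : Continuous Ψ) (ξ : EuclideanSpace ℝ (Fin d)) :
    charFun (P.map (klCoefficients X T d)) ξ
      = Complex.exp (-∫ t in 0..T, Ψ (dualPrimitive T ξ t)) := by
  have hφ : Continuous fun t => ∑ k : Fin d, ξ k * klEigenfunction T k t :=
    continuous_finsetSum _ fun k _ => (continuous_klEigenfunction T k).const_mul _
  rw [charFun_apply, integral_map (hX.aemeasurable_klCoefficients hT d)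
    (by fun_prop : Continuous _).aestronglyMeasurable]
  rw [← hX.integral_exp_integral hΨ hΨc hT hφ (Φ := dualPrimitive T ξ)]
  · refine integral_congr_ae ?_
    filter_upwards [hX.ae_inner_klCoefficients hT ξ] with ω hω
    rw [hω]
  · intro t
    have := HasDerivAt.fun_sum (u := Finset.univ) fun (k : Fin d) _ =>
      (hasDerivAt_klPrimitive hT k t).const_mul (ξ k)
    refine this.congr_deriv ?_
    simp [Finset.sum_neg_distrib]
  · unfold dualPrimitive
    simp [klPrimitive_end hT]

/-- The Lévy exponent along the dual primitive, as an exponent of the shot-noise series. -/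
lemma neg_integral_levyExponent {ρ : ℝ → ℝ} (hρ : IsPositiveLevyDensity ρ) (hT : 0 < T)
    (hν : Integrable (fun x => x ^ 2) (densityMeasure ρ)) (b : ℝ)
    (ξ : EuclideanSpace ℝ (Fin d)) :
    -∫ t in 0..T, levyExponent (fun _ => 1) b 0 (densityMeasure ρ) (dualPrimitive T ξ t)
      = ((inner ℝ (klDrift b T d) ξ : ℝ) : ℂ) * Complex.I
        + ∫ r in Set.Ioi 0, markExponent (jumpSize ρ T) (fun v => dualPrimitive T ξ (T * v)) r := by
  have huni := isProbabilityMeasure_uniform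
  have hΦ := continuous_dualPrimitive T ξ
  obtain ⟨C, hC⟩ := exists_abs_dualPrimitive_le T ξ
  have hψ := continuous_integral_levyIntegrand_one hν
  have hsf : SFinite (densityMeasure ρ) := by unfold densityMeasure; infer_instance
  have hdrift : ∫ t in 0..T, ((dualPrimitive T ξ t : ℝ) : ℂ) * (b * Complex.I)
      = ((inner ℝ (klDrift b T d) ξ : ℝ) : ℂ) * Complex.I := by
    rw [intervalIntegral.integral_mul_const, intervalIntegral.integral_ofReal, inner_eq_sum_mul]
    unfold dualPrimitive
    rw [intervalIntegral.integral_finsetSum fun (k : Fin d) _ =>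
      ((continuous_klPrimitive T k).const_mul (ξ k)).intervalIntegrable _ _]
    simp_rw [intervalIntegral.integral_const_mul, klDrift_apply hT]
    rw [← mul_assoc]
    congr 1
    rw [← Complex.ofReal_mul, Finset.sum_mul]
    congr 1
    exact Finset.sum_congr rfl fun k _ => by ring
  have hF : Integrable (Function.uncurry fun v x : ℝ =>
      levyIntegrand (fun _ => 1) (dualPrimitive T ξ (T * v)) x)
      ((volume.restrict (Set.Icc (0 : ℝ) 1)).prod (densityMeasure ρ)) := by
    refine Integrable.mono' ((hν.const_mul (2 * C ^ 2)).comp_snd _) ?_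
      (ae_of_all _ fun p => ?_)
    · exact (continuous_levyIntegrand_one.comp (by fun_prop :
        Continuous fun p : ℝ × ℝ => (dualPrimitive T ξ (T * p.1), p.2))).aestronglyMeasurable
    · refine (norm_levyIntegrand_one_le _ _).trans ?_
      have h4 : dualPrimitive T ξ (T * p.1) ^ 2 ≤ C ^ 2 := by
        rw [← sq_abs]; exact pow_le_pow_left₀ (abs_nonneg _) (hC _) 2
      gcongr
  -- The substitution `t = Tv` produces a factor `T`, and so does the passage from the Lévy measure
  -- to Lebesgue measure in `r`; after Fubini the two agree.
  have hshot : ∫ t in 0..T, ∫ x, levyIntegrand (fun _ => 1) (dualPrimitive T ξ t) x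
        ∂densityMeasure ρ
      = ∫ r in Set.Ioi 0, markExponent (jumpSize ρ T) (fun v => dualPrimitive T ξ (T * v)) r := by
    rw [← integral_comp_mul_unit hT (fun t => ∫ x, levyIntegrand (fun _ => 1)
      (dualPrimitive T ξ t) x ∂densityMeasure ρ), integral_integral_swap hF]
    exact (integral_comp_jumpSize hρ hT
      (F := fun x => ∫ v in Set.Icc (0 : ℝ) 1,
        levyIntegrand (fun _ => 1) (dualPrimitive T ξ (T * v)) x)
      (by simp [levyIntegrand]) hF.integral_prod_right.aestronglyMeasurable).symm
  have hi1 : IntervalIntegrable (fun t => ((dualPrimitive T ξ t : ℝ) : ℂ) * (b * Complex.I))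
      volume 0 T := Continuous.intervalIntegrable (by fun_prop) _ _
  have hi2 : IntervalIntegrable (fun t => ∫ x, levyIntegrand (fun _ => 1) (dualPrimitive T ξ t) x
      ∂densityMeasure ρ) volume 0 T := (hψ.comp hΦ).intervalIntegrable _ _
  rw [← hdrift, ← hshot, ← intervalIntegral.integral_neg, ← intervalIntegral.integral_add hi1 hi2]
  refine intervalIntegral.integral_congr fun t _ => ?_
  simp only [levyExponent, Complex.ofReal_zero]
  ring

lemma shotNoisePartialSum_sub_compensator_apply {Ω' : Type*} {Γ U : ℕ → Ω' → ℝ} (ρ : ℝ → ℝ)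
    (T : ℝ) (d : ℕ) {τ : ℕ → Ω' → ℝ} (hτ : ∀ n ω, Γ n ω = arrival τ (n + 1) ω) (n : ℕ) (ω : Ω') (k : Fin d) :
    (shotNoisePartialSum ρ T d Γ U n ω - shotNoiseCompensator ρ T d n) k
      = ∑ i ∈ Finset.range n, jumpSize ρ T (arrival τ (i + 1) ω) * klPrimitive T k (T * U i ω)
        - (∫ v in Set.Icc (0 : ℝ) 1, klPrimitive T k (T * v))
          * ∫ r in 0..(n : ℝ), jumpSize ρ T r := by
  rw [PiLp.sub_apply, shotNoiseCompensator_apply]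
  unfold shotNoisePartialSum
  rw [WithLp.ofLp_sum, Finset.sum_apply]
  simp_rw [shotNoiseKernel_apply, hτ]

variable {Ω' : Type*} [MeasurableSpace Ω'] {P' : Measure Ω'} [IsProbabilityMeasure P']
  {Γ U : ℕ → Ω' → ℝ} {ρ : ℝ → ℝ}

/-- The centred shot-noise series converges almost surely, to a random vector with explicit
characteristic function. -/
lemma exists_limit_shotNoise (hρ : IsPositiveLevyDensity ρ) (hT : 0 < T) (d : ℕ)
    (hν : Integrable (fun x => x ^ 2) (densityMeasure ρ))
    (hΓ : IsUnitPoissonArrivals P' Γ) (hU : IsIIDUniform P' U)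
    (hΓU : IndepFun (fun ω i => Γ i ω) (fun ω i => U i ω) P') :
    ∃ M : Ω' → EuclideanSpace ℝ (Fin d), Measurable M ∧
      (∀ᵐ ω ∂P', Tendsto
        (fun n : ℕ => shotNoisePartialSum ρ T d Γ U n ω - shotNoiseCompensator ρ T d n)
        atTop (𝓝 (M ω))) ∧
      ∀ ξ, ∫ ω, Complex.exp (((inner ℝ (M ω) ξ : ℝ) : ℂ) * Complex.I) ∂P' = Complex.exp
        (∫ r in Set.Ioi 0, markExponent (jumpSize ρ T) (fun v => dualPrimitive T ξ (T * v)) r) := by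
  obtain ⟨τ, h, hτ⟩ := hΓ.exists_isMarkedPoisson hU hΓU
  have hy := isJumpProfile_jumpSize hρ hT hν
  have hcoord : ∀ (n : ℕ) (k : Fin d), Measurable fun ω =>
      (shotNoisePartialSum ρ T d Γ U n ω - shotNoiseCompensator ρ T d n) k := by
    intro n k
    simp_rw [shotNoisePartialSum_sub_compensator_apply ρ T d hτ]
    refine (Finset.measurable_fun_sum _ fun i _ => ?_).sub_const _
    exact (hy.measurable.comp (h.measurable_arrival _)).mul
      ((continuous_klPrimitive T k).measurable.comp ((h.measurable_mark i).const_mul T))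
  have hmeas : ∀ n : ℕ, Measurable fun ω =>
      shotNoisePartialSum ρ T d Γ U n ω - shotNoiseCompensator ρ T d n := fun n =>
    (WithLp.measurable_toLp 2 (Fin d → ℝ)).comp (measurable_pi_lambda _ fun k => hcoord n k)
  have hconv : ∀ᵐ ω ∂P', ∃ l, Tendsto
      (fun n : ℕ => shotNoisePartialSum ρ T d Γ U n ω - shotNoiseCompensator ρ T d n)
      atTop (𝓝 l) := by
    have hall : ∀ᵐ ω ∂P', ∀ k : Fin d, ∃ l, Tendsto (fun n : ℕ =>
        (shotNoisePartialSum ρ T d Γ U n ω - shotNoiseCompensator ρ T d n) k) atTop (𝓝 l) := by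
      simp_rw [shotNoisePartialSum_sub_compensator_apply ρ T d hτ]
      exact ae_all_iff.2 fun k => h.ae_exists_tendsto_shotNoise hy
        (w := fun v => klPrimitive T k (T * v))
        ((continuous_klPrimitive T k).measurable.comp (measurable_const_mul T))
        (fun v => abs_klPrimitive_le T k (T * v))
    filter_upwards [hall] with ω hω
    choose l hl using hω
    exact ⟨WithLp.toLp 2 l, ((PiLp.continuous_toLp 2 fun _ : Fin d => ℝ).tendsto l).comp
      (tendsto_pi_nhds.2 hl)⟩
  obtain ⟨M, hM, hlim⟩ := measurable_limit_of_tendsto_metrizable_ae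
    (fun n => (hmeas n).aemeasurable) hconv
  refine ⟨M, hM, hlim, fun ξ => ?_⟩
  obtain ⟨C, hC⟩ := exists_abs_dualPrimitive_le T ξ
  have hW : Continuous fun v => dualPrimitive T ξ (T * v) :=
    (continuous_dualPrimitive T ξ).comp (continuous_const_mul T)
  -- Pairing with `ξ` reduces to the scalar series with mark function `v ↦ dualPrimitive T ξ (T *
  -- v)`.
  refine h.integral_exp_limit hy hW.measurable (fun v => hC (T * v)) ?_
  filter_upwards [hlim] with ω hω
  have h1 := ((continuous_id.inner continuous_const).tendsto (M ω) :
    Tendsto (fun x => inner ℝ x ξ) _ _).comp hω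
  refine h1.congr fun n => ?_
  simp only [Function.comp_apply, id_eq]
  rw [inner_eq_sum_mul]
  simp_rw [shotNoisePartialSum_sub_compensator_apply ρ T d hτ]
  have hc : ∫ v in Set.Icc (0 : ℝ) 1, dualPrimitive T ξ (T * v)
      = ∑ k : Fin d, ξ k * ∫ v in Set.Icc (0 : ℝ) 1, klPrimitive T k (T * v) := by
    unfold dualPrimitive
    rw [integral_finsetSum]
    · simp_rw [integral_const_mul]
    · intro k _
      exact (((continuous_klPrimitive T k).comp (continuous_const_mul T)).const_mul
        (ξ k)).integrableOn_Icc
  rw [hc]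
  unfold dualPrimitive
  simp_rw [mul_sub, Finset.sum_sub_distrib, Finset.mul_sum, Finset.sum_mul]
  rw [Finset.sum_comm]
  congr 1
  · exact Finset.sum_congr rfl fun i _ => Finset.sum_congr rfl fun k _ => by ring
  · exact Finset.sum_congr rfl fun k _ => by ring

/-- The shot-noise representation with compensation of all jumps. -/
lemma identDistrib_klCoefficients [IsProbabilityMeasure P]
    (hX : IsCenteredSquareIntegrableLevy P X) (hρ : IsPositiveLevyDensity ρ) (hT : 0 < T) {b : ℝ}
    (h : HasGeneratingTriple P X (fun _ => 1) b 0 (densityMeasure ρ))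
    (hν : Integrable (fun x => x ^ 2) (densityMeasure ρ)) {M : Ω' → EuclideanSpace ℝ (Fin d)}
    (hM : Measurable M)
    (hMc : ∀ ξ, ∫ ω, Complex.exp (((inner ℝ (M ω) ξ : ℝ) : ℂ) * Complex.I) ∂P' = Complex.exp
      (∫ r in Set.Ioi 0, markExponent (jumpSize ρ T) (fun v => dualPrimitive T ξ (T * v)) r)) :
    IdentDistrib (klCoefficients X T d) (fun ω => klDrift b T d + M ω) P P' := by
  have hZ := hX.levy.aemeasurable_klCoefficients hT d
  have hM' : Measurable fun ω => klDrift b T d + M ω := hM.const_add _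
  refine ⟨hZ, hM'.aemeasurable, ?_⟩
  have : IsProbabilityMeasure (P.map (klCoefficients X T d)) := Measure.isProbabilityMeasure_map hZ
  have : IsProbabilityMeasure (P'.map fun ω => klDrift b T d + M ω) :=
    Measure.isProbabilityMeasure_map hM'.aemeasurable
  refine Measure.ext_of_charFun (funext fun ξ => ?_)
  have hΨc : Continuous (levyExponent (fun _ => 1) b 0 (densityMeasure ρ)) := by
    have := continuous_integral_levyIntegrand_one hν
    unfold levyExponent
    fun_prop
  rw [hX.levy.charFun_klCoefficients hT h.charFun_eq hΨc, neg_integral_levyExponent hρ hT hν,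
    charFun_apply, integral_map hM'.aemeasurable
      (by fun_prop : Continuous _).aestronglyMeasurable, Complex.exp_add, ← hMc ξ,
    ← integral_const_mul]
  refine integral_congr_ae (ae_of_all _ fun ω => ?_)
  simp only
  rw [← Complex.exp_add, inner_add_left]
  push_cast
  ring_nf

end Representation

/-! ### The two shot-noise representations -/

theorem theorem4p2
    {Ω : Type*} [MeasurableSpace Ω] (P : Measure Ω) [IsProbabilityMeasure P]
    {Ω' : Type*} [MeasurableSpace Ω'] (P' : Measure Ω') [IsProbabilityMeasure P']
    (T : ℝ) (hT : 0 < T) (d : ℕ)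
    (ρ : ℝ → ℝ) (hρ : IsPositiveLevyDensity ρ)
    (X : ℝ≥0 → Ω → ℝ) (hX : IsCenteredSquareIntegrableLevy P X)
    (Γ U : ℕ → Ω' → ℝ) (hΓ : IsUnitPoissonArrivals P' Γ) (hU : IsIIDUniform P' U)
    (hΓU : IndepFun (fun ω i => Γ i ω) (fun ω i => U i ω) P') :
    (∀ a : ℝ, HasIntegrableSmallJumps (densityMeasure ρ) →
      HasGeneratingTriple P X (fun _ => 0) a 0 (densityMeasure ρ) →
      IsKarhunenLoeveSystem P X T (klEigenfunction T) (klEigenvalue Var[X 1; P] T) ∧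
      ∃ S : Ω' → EuclideanSpace ℝ (Fin d), Measurable S ∧
        (∀ᵐ ω ∂P', Tendsto (fun n => shotNoisePartialSum ρ T d Γ U n ω) atTop (𝓝 (S ω))) ∧
        IdentDistrib (klCoefficients X T d) (fun ω => klDrift a T d + S ω) P P') ∧
    (HasGeneratingTriple P X (fun _ => 1) 0 0 (densityMeasure ρ) →
      IsKarhunenLoeveSystem P X T (klEigenfunction T) (klEigenvalue Var[X 1; P] T) ∧
      (∀ n : ℕ, IntegrableOn (fun p : ℝ × ℝ => shotNoiseKernel ρ T d p.1 p.2)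
        (Set.Ioc (0 : ℝ) n ×ˢ Set.Icc (0 : ℝ) 1)) ∧
      ∃ M : Ω' → EuclideanSpace ℝ (Fin d), Measurable M ∧
        (∀ᵐ ω ∂P', Tendsto
          (fun n : ℕ => shotNoisePartialSum ρ T d Γ U n ω - shotNoiseCompensator ρ T d n)
          atTop (𝓝 (M ω))) ∧
        IdentDistrib (klCoefficients X T d) M P P') := by
  have hX1 := hX.memLp_two 1
  refine ⟨fun a hsmall h => ?_, fun h => ?_⟩
  · have hν := h.integrable_sq hX1
    have hint := integrable_id_of_smallJumps hsmall hν
    have hKL := isKarhunenLoeveSystem_of_variance_pos hX hT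
      (h.variance_pos hρ hX1 (hX.mean_zero 1))
    obtain ⟨M, hM, hlim, hMc⟩ := exists_limit_shotNoise hρ hT d hν hΓ hU hΓU
    set m := ∫ x, x ∂densityMeasure ρ with hm
    have hy := isJumpProfile_jumpSize hρ hT hν
    have hyi : IntegrableOn (jumpSize ρ T) (Set.Ioi 0) :=
      integrableOn_comp_jumpSize hρ hT (F := fun x => x) rfl hint
    have hym : ∫ r in Set.Ioi 0, jumpSize ρ T r = T * m :=
      integral_comp_jumpSize hρ hT (F := fun x => x) rfl (by fun_prop)
    -- Here the jump profile is itself integrable, with integral `T m`, so the compensators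
    -- converge, and their limit has the form of a drift vector with `m` in place of `a`.
    have hcomp : Tendsto (fun n : ℕ => shotNoiseCompensator ρ T d n) atTop
        (𝓝 (klDrift m T d)) := by
      have hcoord : ∀ k : Fin d, Tendsto (fun n : ℕ => shotNoiseCompensator ρ T d n k) atTop
          (𝓝 (klDrift m T d k)) := by
        intro k
        simp_rw [shotNoiseCompensator_apply]
        have h1 := (intervalIntegral_tendsto_integral_Ioi 0 hyi
          tendsto_natCast_atTop_atTop).const_mul
            (∫ v in Set.Icc (0 : ℝ) 1, klPrimitive T k (T * v))
        rw [hym] at h1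
        rw [klDrift_apply hT, ← integral_comp_mul_unit hT (klPrimitive T k), smul_eq_mul]
        convert! h1 using 2
        ring
      exact ((PiLp.continuous_toLp 2 fun _ : Fin d => ℝ).tendsto _).comp
        (tendsto_pi_nhds.2 hcoord)
    -- Adding back the limit of the compensators gives the sum of the uncentred series. The same
    -- vector is the extra drift from recompensation, so `a + m` splits into `a` and this sum.
    refine ⟨hKL, fun ω => klDrift m T d + M ω, hM.const_add _, ?_, ?_⟩
    · filter_upwards [hlim] with ω hω
      have := hcomp.add hω
      exact this.congr fun n => add_sub_cancel _ _
    · have hid := identDistrib_klCoefficients hX hρ hT (h.compensate hint) hν hM hMc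
      have e : klDrift (a + m) T d = klDrift a T d + klDrift m T d := by
        ext k
        rw [PiLp.add_apply, klDrift_apply hT, klDrift_apply hT, klDrift_apply hT, add_mul]
      rw [← hm, e] at hid
      simpa only [add_assoc] using hid
  · have hν := h.integrable_sq hX1
    have hKL := isKarhunenLoeveSystem_of_variance_pos hX hT
      (h.variance_pos hρ hX1 (hX.mean_zero 1))
    obtain ⟨M, hM, hlim, hMc⟩ := exists_limit_shotNoise hρ hT d hν hΓ hU hΓU
    refine ⟨hKL, fun n => integrableOn_shotNoiseKernel (isJumpProfile_jumpSize hρ hT hν) d n,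
      M, hM, hlim, ?_⟩
    have hid := identDistrib_klCoefficients hX hρ hT h hν hM hMc
    have e : klDrift 0 T d = 0 := by
      ext k
      rw [klDrift_apply hT, zero_mul]; rfl
    simpa only [e, zero_add] using hid
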